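/- Let $k,m,n$ be positive integers with $k\le n-m$. Let $\mathfrak M_{p,q}$ be the space of real $p\times q$ matrices with Lebesgue measure, $x'$ the transpose of $x$, and $|x|_m=\det(x'x)^{1/2}$. Let $\mathcal P_m$ be the cone of positive definite symmetric $m\times m$ matrices; for symmetric $A,B$ write $A<B$ if $B-A\in\mathcal P_m$; put $|a|=\det a$ and $d_*a=|a|^{-(m+1)/2}\prod_{i\le j}da_{i,j}$ on $\mathcal P_m$. Let $V_{n,n-k}=\{\xi\in\mathfrak M_{n,n-k}:\xi'\xi=I_{n-k}\}$ with its $O(n)$-invariant probability measure $d_*\xi$, let $\sigma_{n,m}=2^m\pi^{nm/2}/\Gamma_m(n/2)$ with $\Gamma_m(\alpha)=\int_{\mathcal P_m}e^{-\mathrm{tr}\,r}|r|^{\alpha}\,d_*r$, and let $(\tilde{\mathcal F}w)(y)=\int_{\mathfrak M_{n-k,m}}e^{i\,\mathrm{tr}(y'x)}w(x)\,dx$. A function $w:\mathfrak M_{n-k,m}\to\mathbb C$ is radial if $w(z)=w_0(z'z)$ for some function $w_0$. It is an admissible wavelet if (i) $w$ is radial and integrable; (ii) $(\tilde{\mathcal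 F}w)(y)=u_0(y'y)$, where $u_0(s^{1/2}rs^{1/2})=u_0(r^{1/2}sr^{1/2})$ for all $r,s\in\mathcal P_m$; (iii) with $$c_w(A,B)=\frac{2^{m(k+1)}\pi^{km}}{\sigma_{n,m}}\int_{\{\zeta\in\mathfrak M_{n-k,m}:\,A<\zeta'\zeta<B\}}\frac{(\tilde{\mathcal F}w)(\zeta)}{|\zeta|_m^n}\,d\zeta,\qquad A,B\in\mathcal P_m,$$ the limit $c_w=\lim_{A\to0,\,B\to\infty}c_w(A,B)$ exists and is finite (where $B\to\infty$ means that eventually $B>\lambda I_m$ for every real $\lambda$), and $\sup\{|c_w(\varepsilon r,\rho r)|: r\in\mathcal P_m,\ 0<\varepsilon<\rho<\infty\}<\infty$. (Both hold if the integral of $(\tilde{\mathcal F}w)(\zeta)/|\zeta|_m^n$ over $\mathfrak M_{n-k,m}$ converges absolutely.) Let $u,v$ be integrable radial functions on $\mathfrak M_{n-k,m}$ whose convolution $u*v$ is an admissible wavelet. For $a\in\mathcal P_m$ put $u_a(z)=|a|^{(k-n)/2}u(za^{-1/2})$, $v_a(z)=|a|^{(k-n)/2}v(za^{-1/2})$,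 and $$(U_af)(\xi,t)=\int_{\mathfrak M_{n,m}}f(x)\,u_a(t-\xi'x)\,dx,\qquad (V_a^*\varphi)(x)=\int_{V_{n,n-k}}d_*\xi\int_{\mathfrak M_{n-k,m}}\varphi(\xi,t)\,v_a(\xi'x-t)\,dt.$$ Then the finite limit $$c_{u,v}=\lim_{A\to0,\,B\to\infty}\frac{2^{m(k+1)}\pi^{km}}{\sigma_{n,m}}\int_{\{\zeta\in\mathfrak M_{n-k,m}:\,A<\zeta'\zeta<B\}}\frac{(\tilde{\mathcal F}u)(\zeta)\,(\tilde{\mathcal F}v)(\zeta)}{|\zeta|_m^n}\,d\zeta$$ exists, and for every $f\in L^1(\mathfrak M_{n,m})\cap L^2(\mathfrak M_{n,m})$ the truncated integrals $$I_{\varepsilon,\rho}f(x)=\int_{\varepsilon I_m<a<\rho I_m}\frac{(V_a^*U_af)(x)}{|a|^{k/2}}\,d_*a,\qquad 0<\varepsilon<\rho<\infty,$$ converge absolutely (as integrals in $a$) for almost every $x$, belong to $L^2(\mathfrak M_{n,m})$, and satisfy $I_{\varepsilon,\rho}f\to c_{u,v}f$ in $L^2(\mathfrak M_{n,m})$ as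 $\varepsilon\to0$, $\rho\to\infty$. -/

import Mathlib

open MeasureTheory Filter Topology

namespace MatrixRidgelet

/-- `Mat n m`: real matrices with `n` rows and `m` columns. -/
abbrev Mat (n m : ℕ) := Matrix (Fin n) (Fin m) ℝ

/-- Lebesgue measure `∏ dx_{i,j}` on the space of matrices. -/
noncomputable instance instMeasureSpaceMat (n m : ℕ) : MeasureSpace (Mat n m) :=
  inferInstanceAs (MeasureSpace (Fin n → Fin m → ℝ))

instance instBorelSpaceMat (n m : ℕ) : BorelSpace (Mat n m) :=
  inferInstanceAs (BorelSpace (Fin n → Fin m → ℝ))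

/-! ### The cone of positive definite matrices -/

/-- The cone of positive definite symmetric `m × m` matrices. -/
def posCone (m : ℕ) : Set (Mat m m) := {r | r.PosDef}

/-- The order interval `{s : s - a` and `b - s` positive definite `}`. -/
def coneInterval {m : ℕ} (a b : Mat m m) : Set (Mat m m) :=
  {s | (s - a).PosDef ∧ (b - s).PosDef}

/-- The symmetric matrix with prescribed entries on and above the diagonal. -/
def symOfCoords {m : ℕ} (c : {p : Fin m × Fin m // p.1 ≤ p.2} → ℝ) : Mat m m :=
  Matrix.of fun i j => c ⟨(min i j, max i j), min_le_max⟩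

/-- The measure `dr = ∏_{i ≤ j} dr_{i,j}` on the cone, as a measure on `m × m` matrices. -/
noncomputable def coneMeasure (m : ℕ) : Measure (Mat m m) :=
  (Measure.map symOfCoords volume).restrict (posCone m)

/-- The invariant measure `d_* r = |r|^{-d} dr`, `d = (m + 1) / 2`, on the cone. -/
noncomputable def coneInvMeasure (m : ℕ) : Measure (Mat m m) :=
  (coneMeasure m).withDensity fun r => ENNReal.ofReal (r.det ^ (-(((m : ℝ) + 1) / 2)))

open scoped MatrixOrder in
/-- The positive semidefinite square root `a^{1/2}` of a positive semidefinite matrix. -/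
noncomputable def matSqrt {m : ℕ} (a : Mat m m) : Mat m m := CFC.sqrt a

/-- A function on the cone is symmetric if
`w₀ (s^{1/2} r s^{1/2}) = w₀ (r^{1/2} s r^{1/2})` for all positive definite `r`, `s`. -/
def IsSymmetricOnCone {m : ℕ} (w₀ : Mat m m → ℂ) : Prop :=
  ∀ r s : Mat m m, r.PosDef → s.PosDef →
    w₀ (matSqrt s * r * matSqrt s) = w₀ (matSqrt r * s * matSqrt r)

/-- `A → 0` within the cone. -/
def coneZero (m : ℕ) : Filter (Mat m m) := 𝓝[posCone m] 0

/-- `B → ∞` within the cone: eventually `B > c I` for every real `c`. -/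
def coneInfty (m : ℕ) : Filter (Mat m m) :=
  ⨅ c : ℝ, 𝓟 {B : Mat m m | B.PosDef ∧ (B - c • (1 : Mat m m)).PosDef}

/-- The Siegel gamma function `Γ_m` (for a real argument). -/
noncomputable def siegelGamma (m : ℕ) (α : ℝ) : ℝ :=
  ∫ r : Mat m m, Real.exp (-r.trace) * r.det ^ (α - ((m : ℝ) + 1) / 2) ∂(coneMeasure m)

/-- The total mass `σ_{n,m} = 2^m π^{nm/2} / Γ_m(n/2)` of the Stiefel manifold. -/
noncomputable def stiefelMass (n m : ℕ) : ℝ :=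
  2 ^ m * Real.pi ^ ((n : ℝ) * m / 2) / siegelGamma m ((n : ℝ) / 2)

/-- `|x|_m = det(x'x)^{1/2}`. -/
noncomputable def detNorm {n m : ℕ} (x : Mat n m) : ℝ := Real.sqrt (x.transpose * x).det

/-! ### The Stiefel manifold and its invariant probability measure -/

/-- The Stiefel manifold of orthonormal `p`-frames in `ℝⁿ`. -/
abbrev Stiefel (n p : ℕ) := {ξ : Mat n p // ξ.transpose * ξ = 1}

/-- The frame `ξ₀ = [0; I_{n-k}]`. -/
def stiefelBase (n k : ℕ) : Stiefel n (n - k) :=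
  ⟨Matrix.of fun i j => if (i : ℕ) = k + j then 1 else 0, by
    ext a b
    have hlt : k + (a : ℕ) < n := by have := a.2; omega
    rw [Matrix.mul_apply, Finset.sum_eq_single (⟨k + a, hlt⟩ : Fin n)]
    · simp [Matrix.transpose_apply, Matrix.one_apply, Fin.ext_iff]
    · intro i _ hi
      have : (i : ℕ) ≠ k + a := fun h => hi (Fin.ext h)
      simp [Matrix.transpose_apply, this]
    · simp⟩

/-- The orthogonal group `O(n)`. -/
abbrev OrthGroup (n : ℕ) := Matrix.orthogonalGroup (Fin n) ℝ

instance instCompactSpaceOrthGroup (n : ℕ) : CompactSpace (OrthGroup n) := by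
  have hmem : ∀ A : Mat n n, A ∈ Matrix.orthogonalGroup (Fin n) ℝ ↔ A * A.transpose = 1 :=
    fun A => Matrix.mem_orthogonalGroup_iff (Fin n) ℝ
  refine isCompact_iff_compactSpace.mp ?_
  have hK : IsCompact (Set.univ.pi fun _ : Fin n => Set.univ.pi fun _ : Fin n =>
      Set.Icc (-1 : ℝ) 1) :=
    isCompact_univ_pi fun _ => isCompact_univ_pi fun _ => isCompact_Icc
  refine IsCompact.of_isClosed_subset (X := Mat n n) hK ?_ ?_
  · have : ((Matrix.orthogonalGroup (Fin n) ℝ : Set (Mat n n))) =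
        {A : Mat n n | A * A.transpose = 1} := Set.ext hmem
    rw [this]
    exact isClosed_eq (by fun_prop) continuous_const
  · intro A hA i _ j _
    have h1 : (A * A.transpose) i i = 1 := by rw [(hmem A).1 hA]; simp
    rw [Matrix.mul_apply] at h1
    have h2 : A i j * A i j ≤ ∑ l, A i l * A.transpose l i :=
      Finset.single_le_sum (f := fun l => A i l * A.transpose l i)
        (fun l _ => mul_self_nonneg (A i l)) (Finset.mem_univ j)
    exact abs_le.1 ((sq_le_one_iff_abs_le_one _).1 (by nlinarith))

/-- The action of `O(n)` on the base frame, `γ ↦ γ ξ₀`. -/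
def orbitMap (n k : ℕ) (γ : OrthGroup n) : Stiefel n (n - k) :=
  ⟨(γ : Mat n n) * (stiefelBase n k).1, by
    have h : (γ : Mat n n).transpose * (γ : Mat n n) = 1 :=
      (Matrix.mem_orthogonalGroup_iff' (Fin n) ℝ).1 γ.2
    rw [Matrix.transpose_mul, Matrix.mul_assoc, ← Matrix.mul_assoc _ (γ : Mat n n), h,
      Matrix.one_mul, (stiefelBase n k).2]⟩

/-- The `O(n)`-invariant probability measure `d_* ξ` on the Stiefel manifold of orthonormal
`(n-k)`-frames: the image of the Haar probability measure of `O(n)` under `γ ↦ γ ξ₀`. -/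
noncomputable def stiefelMeasure (n k : ℕ) : Measure (Stiefel n (n - k)) :=
  Measure.map (orbitMap n k) (Measure.haarMeasure ⊤)

/-! ### Fourier transform, ridgelet transforms, admissible wavelets -/

/-- The Fourier transform `(F w)(y) = ∫ exp(tr(i y'x)) w(x) dx`. -/
noncomputable def matFourier {p m : ℕ} (w : Mat p m → ℂ) (y : Mat p m) : ℂ :=
  ∫ x : Mat p m, Complex.exp (Complex.I * ((y.transpose * x).trace : ℂ)) * w x

/-- Radial functions: `w(z) = w₀(z'z)`. -/
def IsRadial {p m : ℕ} (w : Mat p m → ℂ) : Prop :=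
  ∃ w₀ : Mat m m → ℂ, ∀ z, w z = w₀ (z.transpose * z)

/-- The convolution `(u ∗ v)(z) = ∫ u(y) v(z - y) dy`. -/
noncomputable def conv {p m : ℕ} (u v : Mat p m → ℂ) : Mat p m → ℂ :=
  convolution u v (ContinuousLinearMap.mul ℂ ℂ) volume

/-- The scaled function `w_a(z) = |a|^{-p/2} w(z a^{-1/2})`. -/
noncomputable def scaled {p m : ℕ} (w : Mat p m → ℂ) (a : Mat m m) (z : Mat p m) : ℂ :=
  ((a.det ^ (-(p : ℝ) / 2) : ℝ) : ℂ) * w (z * (matSqrt a)⁻¹)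

/-- The continuous ridgelet transform `(W_a f)(ξ, t) = ∫ f(x) w_a(t - ξ'x) dx`. -/
noncomputable def ridgelet {n k m : ℕ} (w : Mat (n - k) m → ℂ) (a : Mat m m)
    (f : Mat n m → ℂ) (ξ : Stiefel n (n - k)) (t : Mat (n - k) m) : ℂ :=
  ∫ x : Mat n m, f x * scaled w a (t - ξ.1.transpose * x)

/-- The dual ridgelet transform `(W_a^* φ)(x) = ∫ d_*ξ ∫ φ(ξ, t) w_a(ξ'x - t) dt`. -/
noncomputable def dualRidgelet {n k m : ℕ} (w : Mat (n - k) m → ℂ) (a : Mat m m)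
    (φ : Stiefel n (n - k) → Mat (n - k) m → ℂ) (x : Mat n m) : ℂ :=
  ∫ ξ : Stiefel n (n - k),
    (∫ t : Mat (n - k) m, φ ξ t * scaled w a (ξ.1.transpose * x - t)) ∂(stiefelMeasure n k)

/-- The truncated normalized integral
`2^{m(k+1)} π^{km} / σ_{n,m} · ∫_{A < ζ'ζ < B} g(ζ) / |ζ|_m^n dζ`. -/
noncomputable def truncConst (n k m : ℕ) (g : Mat (n - k) m → ℂ) (A B : Mat m m) : ℂ :=
  ((2 ^ (m * (k + 1)) * Real.pi ^ (k * m) / stiefelMass n m : ℝ) : ℂ) *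
    ∫ ζ in {ζ : Mat (n - k) m | ζ.transpose * ζ ∈ coneInterval A B},
      g ζ / ((detNorm ζ ^ n : ℝ) : ℂ)

/-- The normalized improper integral of `g(ζ) / |ζ|_m^n` over the space of `(n-k) × m` matrices
equals `c`, as a limit of truncated integrals. -/
def HasConeIntegral (n k m : ℕ) (g : Mat (n - k) m → ℂ) (c : ℂ) : Prop :=
  Tendsto (fun AB : Mat m m × Mat m m => truncConst n k m g AB.1 AB.2)
    (coneZero m ×ˢ coneInfty m) (𝓝 c)

/-- Admissible wavelet functions on the space of `(n-k) × m` matrices. -/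
structure IsAdmissible (n k m : ℕ) (w : Mat (n - k) m → ℂ) : Prop where
  radial : IsRadial w
  integrable : Integrable w
  symmetric : ∃ u₀ : Mat m m → ℂ, IsSymmetricOnCone u₀ ∧
    ∀ y, matFourier w y = u₀ (y.transpose * y)
  /-- The improper integral `c_w` converges. -/
  converges : ∃ c : ℂ, HasConeIntegral n k m (matFourier w) c
  /-- Its truncations over `ε r < ζ'ζ < ρ r` are bounded uniformly in `ε`, `ρ` and `r`. This is
  automatic when the integral converges absolutely. -/
  bounded : ∃ C : ℝ, ∀ r : Mat m m, r.PosDef → ∀ ε ρ : ℝ, 0 < ε → ε < ρ →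
    ‖truncConst n k m (matFourier w) (ε • r) (ρ • r)‖ ≤ C

/-- The integrand `a ↦ (V_a^* U_a f)(x) / |a|^{k/2}`. -/
noncomputable def reproIntegrand {n k m : ℕ} (u v : Mat (n - k) m → ℂ) (f : Mat n m → ℂ)
    (x : Mat n m) (a : Mat m m) : ℂ :=
  dualRidgelet v a (ridgelet u a f) x / ((a.det ^ ((k : ℝ) / 2) : ℝ) : ℂ)

/-- The truncated reproducing integral
`∫_{ε I}^{ρ I} (V_a^* U_a f)(x) |a|^{-k/2} d_* a`. -/
noncomputable def reproTrunc {n k m : ℕ} (u v : Mat (n - k) m → ℂ) (f : Mat n m → ℂ)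
    (ε ρ : ℝ) (x : Mat n m) : ℂ :=
  ∫ a in coneInterval (ε • (1 : Mat m m)) (ρ • (1 : Mat m m)),
    reproIntegrand u v f x a ∂(coneInvMeasure m)

end MatrixRidgelet

/-!
The truncated operator `f ↦ I_{ε,ρ} f` is a Fourier multiplier. At a fixed scale `a`, integration
along the fibres of a frame `ξ` turns `V_a^* U_a` into multiplication by `û v̂` at the frequencies
`η a^{1/2}`, transported to `y = ξ η` and averaged over `ξ`; the law of `ξ η` has a density that
is a power of `|y|_m`, since an invariant function of `y` depends only on `y' y`. The map
`ζ ↦ ζ' ζ` sends Lebesgue measure to a multiple of `|r|^{p/2} d_* r` because the cone carries only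
one invariant measure, and the symmetry of the profile of `û v̂` lets `a` and `y' y` change places.
Together these identify the symbol at `y` as the truncated constant `c_{u,v}(ε r, ρ r)` with
`r = y' y`. By admissibility the symbols are uniformly bounded and converge to `c_{u,v}` for almost
every `y`, so Plancherel and dominated convergence give the convergence in `L²`.

Mathlib's Fourier kernel is `exp (-2 π i ⟨x, y⟩)`, whence the frequencies `±(2 π) • Y` below.
-/

namespace MatrixRidgelet

open scoped ENNReal

/-! ### Lebesgue measure on matrix spaces -/

section Lebesgue

variable {n m p : ℕ}

instance instSigmaFiniteVolumeMat : SigmaFinite (volume : Measure (Mat n m)) :=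
  inferInstanceAs (SigmaFinite (volume : Measure (Fin n → Fin m → ℝ)))

instance instSecondCountableMat : SecondCountableTopology (Mat n m) :=
  inferInstanceAs (SecondCountableTopology (Fin n → Fin m → ℝ))

instance instLocallyCompactMat : LocallyCompactSpace (Mat n m) :=
  inferInstanceAs (LocallyCompactSpace (Fin n → Fin m → ℝ))

instance instIsAddHaarVolumeMat : Measure.IsAddHaarMeasure (volume : Measure (Mat n m)) :=
  have : Measure.IsAddHaarMeasure (volume : Measure (Fin n → Fin m → ℝ)) :=
    Measure.pi.isAddHaarMeasure _
  this

/-- Vectorization: a matrix as the family of its entries. -/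
def vecEquiv (n m : ℕ) : Mat n m ≃L[ℝ] (Fin n × Fin m → ℝ) where
  toFun z q := z q.1 q.2
  invFun c := Matrix.of fun i j => c (i, j)
  map_add' _ _ := rfl
  map_smul' _ _ := rfl
  left_inv _ := rfl
  right_inv _ := rfl
  continuous_toFun := continuous_pi fun q => continuous_id.matrix_elem q.1 q.2
  continuous_invFun := continuous_matrix fun i j => continuous_apply (i, j)

theorem volume_preserving_vecEquiv : MeasurePreserving (vecEquiv n m) := by
  refine ⟨(vecEquiv n m).continuous.measurable, ?_⟩
  have hHaar : Measure.IsAddHaarMeasure (Measure.map (vecEquiv n m) volume) :=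
    (vecEquiv n m).toContinuousAddEquiv.isAddHaarMeasure_map _
  have hpre : vecEquiv n m ⁻¹' (TopologicalSpace.PositiveCompacts.piIcc01 (Fin n × Fin m) : Set _) =
      Set.univ.pi fun _ : Fin n => Set.univ.pi fun _ : Fin m => Set.Icc (0 : ℝ) 1 := by
    ext z
    exact ⟨fun h i _ j _ => h (i, j) trivial, fun h q _ => h q.1 trivial q.2 trivial⟩
  have hcube : Measure.map (vecEquiv n m) volume
      (TopologicalSpace.PositiveCompacts.piIcc01 (Fin n × Fin m) : Set _) = 1 := by
    rw [Measure.map_apply (vecEquiv n m).continuous.measurable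
      (TopologicalSpace.PositiveCompacts.isCompact _).measurableSet, hpre]
    erw [volume_pi_pi]
    simp_rw [volume_pi_pi]
    simp
  rw [Measure.addHaarMeasure_unique (Measure.map (vecEquiv n m) volume)
    (TopologicalSpace.PositiveCompacts.piIcc01 _), hcube, one_smul, addHaarMeasure_eq_volume_pi]

theorem volume_preserving_transpose :
    MeasurePreserving (Matrix.transpose : Mat n m → Mat m n) :=
  have hswap := volume_measurePreserving_piCongrLeft (fun _ : Fin m × Fin n => ℝ)
    (Equiv.prodComm (Fin n) (Fin m))
  have hunvec : MeasurePreserving (vecEquiv m n).symm :=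
    volume_preserving_vecEquiv.symm (vecEquiv m n).toHomeomorph.toMeasurableEquiv
  hunvec.comp (hswap.comp volume_preserving_vecEquiv)

theorem measurable_mul_left (g : Mat n n) : Measurable fun z : Mat n m => g * z :=
  (continuous_const.matrix_mul continuous_id).measurable

theorem measurable_mul_right (g : Mat m m) : Measurable fun z : Mat p m => z * g :=
  (continuous_id.matrix_mul continuous_const).measurable

theorem map_mul_right_volume (g : Mat m m) (hg : g.det ≠ 0) :
    Measure.map (fun z : Mat p m => z * g) volume =
      ENNReal.ofReal ((|g.det| ^ p)⁻¹) • volume := by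
  let L : (Fin p → Fin m → ℝ) →ₗ[ℝ] (Fin p → Fin m → ℝ) :=
    LinearMap.pi fun i => Matrix.toLin' g.transpose ∘ₗ LinearMap.proj i
  have hdet : LinearMap.det L = g.det ^ p := by
    simp [L, LinearMap.det_pi, LinearMap.det_toLin', Matrix.det_transpose]
  have hL : (fun z : Mat p m => z * g) = L := by
    ext z i j
    change (z * g) i j = g.transpose.mulVec (z i) j
    simp [Matrix.mul_apply, Matrix.mulVec, dotProduct, mul_comm]
  have hmap := Measure.map_linearMap_addHaar_eq_smul_addHaar
    (volume : Measure (Fin p → Fin m → ℝ)) (f := L) (hdet ▸ pow_ne_zero p hg)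
  rw [hdet, abs_inv, abs_pow] at hmap
  exact hL ▸ hmap

theorem map_mul_left_volume (g : Mat n n) (hg : g.det ≠ 0) :
    Measure.map (fun z : Mat n m => g * z) volume =
      ENNReal.ofReal ((|g.det| ^ m)⁻¹) • volume := by
  have htr := volume_preserving_transpose (n := n) (m := m)
  have htr' := volume_preserving_transpose (n := m) (m := n)
  have hconj : (fun z : Mat n m => g * z) =
      Matrix.transpose ∘ (fun z : Mat m n => z * g.transpose) ∘ Matrix.transpose := by
    ext1 z; simp
  have hmul := measurable_mul_right (p := m) g.transpose
  rw [hconj, ← Measure.map_map htr'.measurable (hmul.comp htr.measurable),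
    ← Measure.map_map hmul htr.measurable, htr.map_eq,
    map_mul_right_volume _ (by rwa [Matrix.det_transpose]), Measure.map_smul, htr'.map_eq,
    Matrix.det_transpose]

theorem lintegral_mul_right (g : Mat m m) (hg : g.det ≠ 0) {F : Mat p m → ℝ≥0∞}
    (hF : Measurable F) :
    ∫⁻ z : Mat p m, F (z * g) = ENNReal.ofReal ((|g.det| ^ p)⁻¹) * ∫⁻ z, F z := by
  rw [← lintegral_map hF (measurable_mul_right g), map_mul_right_volume g hg,
    lintegral_smul_measure, smul_eq_mul]

theorem abs_det_orthGroup (γ : OrthGroup n) : |(γ : Mat n n).det| = 1 := by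
  have hγ : (γ : Mat n n) * (γ : Mat n n).transpose = 1 :=
    (Matrix.mem_orthogonalGroup_iff (Fin n) ℝ).1 γ.2
  have hsq := congrArg Matrix.det hγ
  rw [Matrix.det_mul, Matrix.det_transpose, Matrix.det_one] at hsq
  exact abs_eq_abs.2 (mul_self_eq_one_iff.1 hsq) |>.trans abs_one

theorem volume_preserving_orthGroup_mul (γ : OrthGroup n) :
    MeasurePreserving (fun z : Mat n m => (γ : Mat n n) * z) := by
  have hdet := abs_det_orthGroup γ
  refine ⟨measurable_mul_left _, ?_⟩
  rw [map_mul_left_volume _ (by intro hzero; simp [hzero] at hdet), hdet]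
  simp

theorem finite_setOf_det_add_smul_one_eq_zero (A : Mat m m) :
    {t : ℝ | (A + t • (1 : Mat m m)).det = 0}.Finite := by
  refine (Polynomial.finite_setOfPred_isRoot
    (Matrix.charpoly_monic (-A)).ne_zero).subset fun t ht => ?_
  rw [Set.mem_ofPred_eq] at ht
  rw [Set.mem_ofPred_eq, Polynomial.IsRoot, Matrix.eval_charpoly, ← ht]
  congr 1
  ext i j
  simp [Matrix.scalar_apply, Matrix.one_apply, Matrix.diagonal_apply, add_comm]

/-- The frame `[I_m; 0]` of the first `m` standard basis vectors of `ℝⁿ`, used as a base point for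
the action of the orthogonal group. -/
def stdFrame (n m : ℕ) : Mat n m := Matrix.of fun i j => if (i : ℕ) = j then 1 else 0

theorem ae_det_topBlock_ne_zero (hmp : m ≤ p) :
    ∀ᵐ z : Mat p m, (z.submatrix (Fin.castLE hmp) id).det ≠ 0 := by
  have hmeas : MeasurableSet {z : Mat p m | (z.submatrix (Fin.castLE hmp) id).det ≠ 0} :=
    (isOpen_compl_singleton.preimage
      (continuous_id.matrix_submatrix _ _).matrix_det).measurableSet
  refine ae_mem_of_ae_add_linearMap_mem (F := Fin p → Fin m → ℝ)
    (LinearMap.toSpanSingleton ℝ _ (stdFrame p m)) volume volume hmeas fun z : Mat p m => ?_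
  have hfin := finite_setOf_det_add_smul_one_eq_zero (z.submatrix (Fin.castLE hmp) id)
  filter_upwards [compl_mem_ae_iff.2 (hfin.measure_zero volume)] with t ht
  have hline : (z + t • stdFrame p m).submatrix (Fin.castLE hmp) id =
      z.submatrix (Fin.castLE hmp) id + t • 1 := by
    ext i j
    simp [stdFrame, Matrix.one_apply, Fin.ext_iff]
  change ((z + t • stdFrame p m).submatrix (Fin.castLE hmp) id).det ≠ 0
  rw [hline]
  exact ht

theorem mulVec_eq_zero_of_gram_mulVec_eq_zero {z : Mat p m} {x : Fin m → ℝ}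
    (h : (z.transpose * z).mulVec x = 0) : z.mulVec x = 0 := by
  rw [← Matrix.conjTranspose_eq_transpose_of_trivial] at h
  exact (Matrix.conjTranspose_mul_self_mulVec_eq_zero z x).1 h

theorem ae_det_gram_ne_zero (hmp : m ≤ p) :
    ∀ᵐ z : Mat p m, (z.transpose * z).det ≠ 0 := by
  filter_upwards [ae_det_topBlock_ne_zero hmp] with z hz hgram
  obtain ⟨x, hx, hx0⟩ := Matrix.exists_mulVec_eq_zero_iff.2 hgram
  refine hz (Matrix.exists_mulVec_eq_zero_iff.1 ⟨x, hx, ?_⟩)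
  ext i
  exact congrFun (mulVec_eq_zero_of_gram_mulVec_eq_zero hx0) (Fin.castLE hmp i)

end Lebesgue

/-! ### Positive definite matrices and square roots -/

section Cone

variable {n m p : ℕ}

theorem isClosed_setOf_posSemidef : IsClosed {a : Mat m m | a.PosSemidef} := by
  have : {a : Mat m m | a.PosSemidef} = {a : Mat m m | a.transpose = a} ∩
      ⋂ x : Fin m → ℝ, {a : Mat m m | 0 ≤ dotProduct x (a.mulVec x)} := by
    ext a
    simp only [Set.mem_ofPred_eq, Matrix.posSemidef_iff_dotProduct_mulVec, Set.mem_inter_iff,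
      Set.mem_iInter, star_trivial]
    rfl
  rw [this]
  refine (isClosed_eq continuous_id.matrix_transpose continuous_id).inter
    (isClosed_iInter fun x => isClosed_le continuous_const ?_)
  exact continuous_const.dotProduct (continuous_id.matrix_mulVec continuous_const)

theorem measurableSet_setOf_posDef : MeasurableSet {a : Mat m m | a.PosDef} := by
  have : {a : Mat m m | a.PosDef} = {a : Mat m m | a.PosSemidef} ∩ {a | a.det ≠ 0} := by
    ext a
    exact ⟨fun h => ⟨h.posSemidef, h.det_pos.ne'⟩, fun h => h.1.posDef_iff_det_ne_zero.2 h.2⟩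
  rw [this]
  exact isClosed_setOf_posSemidef.measurableSet.inter
    (isOpen_compl_singleton.preimage continuous_id.matrix_det).measurableSet

theorem measurableSet_posCone : MeasurableSet (posCone m) := measurableSet_setOf_posDef

theorem measurableSet_coneInterval (A B : Mat m m) : MeasurableSet (coneInterval A B) :=
  (measurableSet_setOf_posDef.preimage
      (continuous_id.sub continuous_const : Continuous fun s : Mat m m => s - A).measurable).inter
    (measurableSet_setOf_posDef.preimage
      (continuous_const.sub continuous_id : Continuous fun s : Mat m m => B - s).measurable)

theorem posSemidef_transpose_mul_self (z : Mat p m) : (z.transpose * z).PosSemidef := by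
  rw [← Matrix.conjTranspose_eq_transpose_of_trivial]
  exact Matrix.posSemidef_conjTranspose_mul_self z

theorem posDef_transpose_mul_self {z : Mat p m} (h : (z.transpose * z).det ≠ 0) :
    (z.transpose * z).PosDef :=
  (posSemidef_transpose_mul_self z).posDef_iff_det_ne_zero.2 h

theorem posDef_congr_iff {g r : Mat m m} (hg : g.det ≠ 0) :
    (g.transpose * r * g).PosDef ↔ r.PosDef := by
  have hU : IsUnit g := (Matrix.isUnit_iff_isUnit_det g).2 hg.isUnit
  have := Matrix.IsUnit.posDef_star_left_conjugate_iff (x := r) hU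
  rwa [Matrix.star_eq_conjTranspose, Matrix.conjTranspose_eq_transpose_of_trivial] at this

theorem mem_coneInterval_congr_iff {g r A B : Mat m m} (hg : g.det ≠ 0) :
    g.transpose * r * g ∈ coneInterval (g.transpose * A * g) (g.transpose * B * g) ↔
      r ∈ coneInterval A B := by
  simp only [coneInterval, Set.mem_ofPred_eq, ← Matrix.mul_sub, ← Matrix.sub_mul,
    posDef_congr_iff hg]

theorem posDef_of_mem_coneInterval {A B s : Mat m m} (hA : A.PosSemidef)
    (hs : s ∈ coneInterval A B) : s.PosDef := by
  simpa using hs.1.add_posSemidef hA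

open scoped MatrixOrder in
theorem posSemidef_matSqrt (a : Mat m m) : (matSqrt a).PosSemidef :=
  Matrix.nonneg_iff_posSemidef.1 (CFC.sqrt_nonneg a)

theorem transpose_matSqrt (a : Mat m m) : (matSqrt a).transpose = matSqrt a := by
  have := (posSemidef_matSqrt a).isHermitian
  rwa [Matrix.IsHermitian, Matrix.conjTranspose_eq_transpose_of_trivial] at this

open scoped MatrixOrder in
theorem matSqrt_mul_self {a : Mat m m} (ha : a.PosSemidef) : matSqrt a * matSqrt a = a :=
  CFC.sqrt_mul_sqrt_self a ha.nonneg

theorem det_matSqrt_pos {a : Mat m m} (ha : a.PosDef) : 0 < (matSqrt a).det := by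
  refine (posSemidef_matSqrt a).det_nonneg.lt_of_ne' fun h => ha.det_pos.ne' ?_
  rw [← matSqrt_mul_self ha.posSemidef, Matrix.det_mul, h, zero_mul]

theorem det_matSqrt_sq {a : Mat m m} (ha : a.PosDef) : (matSqrt a).det ^ 2 = a.det := by
  conv_rhs => rw [← matSqrt_mul_self ha.posSemidef, Matrix.det_mul]
  exact pow_two _

theorem isCompact_setOf_abs_le (C : ℝ) : IsCompact {b : Mat n m | ∀ i j, |b i j| ≤ C} := by
  have : IsCompact (Set.univ.pi fun _ : Fin n => Set.univ.pi fun _ : Fin m =>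
      Set.Icc (-C) C) := isCompact_univ_pi fun _ => isCompact_univ_pi fun _ => isCompact_Icc
  convert! this using 1
  ext b
  exact ⟨fun h i _ j _ => abs_le.1 (h i j), fun h i j => abs_le.2 (h i trivial j trivial)⟩

theorem sq_entry_le_trace (z : Mat p m) (i : Fin p) (j : Fin m) :
    z i j ^ 2 ≤ (z.transpose * z).trace := by
  simp only [Matrix.trace, Matrix.diag_apply, Matrix.mul_apply, Matrix.transpose_apply]
  calc z i j ^ 2 = z i j * z i j := pow_two _
    _ ≤ ∑ l, z l j * z l j := Finset.single_le_sum (f := fun l => z l j * z l j)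
        (fun l _ => mul_self_nonneg _) (Finset.mem_univ i)
    _ ≤ _ := Finset.single_le_sum (f := fun j => ∑ l, z l j * z l j)
        (fun j _ => Finset.sum_nonneg fun l _ => mul_self_nonneg _) (Finset.mem_univ j)

open scoped MatrixOrder Matrix.Norms.L2Operator in
theorem continuousOn_matSqrt : ContinuousOn matSqrt {a : Mat m m | a.PosSemidef} := by
  simp only [← Matrix.nonneg_iff_posSemidef]
  exact CFC.continuousOn_sqrt

open scoped MatrixOrder in
theorem matSqrt_of_not_posSemidef {a : Mat m m} (ha : ¬a.PosSemidef) : matSqrt a = 0 :=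
  CFC.sqrt_of_not_nonneg fun h => ha (Matrix.nonneg_iff_posSemidef.1 h)

theorem measurable_matSqrt : Measurable (matSqrt : Mat m m → Mat m m) := by
  classical
  have hpiecewise : matSqrt = {a : Mat m m | a.PosSemidef}.piecewise matSqrt fun _ => 0 := by
    ext1 a
    by_cases ha : a.PosSemidef
    · exact (Set.piecewise_eq_of_mem {a : Mat m m | a.PosSemidef} _ _ ha).symm
    · rw [Set.piecewise_eq_of_notMem {a : Mat m m | a.PosSemidef} _ _ ha,
        matSqrt_of_not_posSemidef ha]
  rw [hpiecewise]
  exact continuousOn_matSqrt.measurable_piecewise continuousOn_const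
    isClosed_setOf_posSemidef.measurableSet

end Cone

/-! ### The invariant measure of the cone -/

section ConeMeasure

variable {m : ℕ}

theorem measurable_det : Measurable fun r : Mat m m => r.det :=
  continuous_id.matrix_det.measurable

theorem measurable_ofReal_det_rpow (s : ℝ) :
    Measurable fun r : Mat m m => ENNReal.ofReal (r.det ^ s) :=
  (measurable_det.pow_const _).ennreal_ofReal

theorem measurable_congr (g : Mat m m) : Measurable fun r : Mat m m => g.transpose * r * g :=
  ((continuous_const.matrix_mul continuous_id).matrix_mul continuous_const).measurable

theorem det_congr_rpow (g : Mat m m) {r : Mat m m} (hr : r.PosDef) (s : ℝ) :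
    (g.transpose * r * g).det ^ s = |g.det| ^ (2 * s) * r.det ^ s := by
  have hdet : (g.transpose * r * g).det = |g.det| ^ (2 : ℝ) * r.det := by
    rw [Matrix.det_mul, Matrix.det_mul, Matrix.det_transpose, Real.rpow_two, sq_abs]
    ring
  rw [hdet, Real.mul_rpow (by positivity) hr.det_pos.le, ← Real.rpow_mul (abs_nonneg _)]

/-- Index set of the entries on and above the diagonal of an `m × m` matrix. -/
abbrev UpperIndex (m : ℕ) := {p : Fin m × Fin m // p.1 ≤ p.2}

theorem transpose_symOfCoords (c : UpperIndex m → ℝ) :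
    (symOfCoords c).transpose = symOfCoords c := by
  ext i j
  simp only [symOfCoords, Matrix.transpose_apply, Matrix.of_apply]
  congr 3
  · exact min_comm _ _
  · exact max_comm _ _

theorem symOfCoords_apply_of_le (c : UpperIndex m → ℝ) (q : UpperIndex m) :
    symOfCoords c q.1.1 q.1.2 = c q := by
  simp only [symOfCoords, Matrix.of_apply, min_eq_left q.2, max_eq_right q.2]

theorem symOfCoords_restrict {r : Mat m m} (hr : r.transpose = r) :
    symOfCoords (fun q : UpperIndex m => r q.1.1 q.1.2) = r := by
  ext i j
  simp only [symOfCoords, Matrix.of_apply]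
  rcases le_total i j with h | h
  · rw [min_eq_left h, max_eq_right h]
  · rw [min_eq_right h, max_eq_left h]
    exact congrFun (congrFun hr i) j

theorem continuous_symOfCoords : Continuous (symOfCoords (m := m)) :=
  continuous_matrix fun _ _ => continuous_apply _

theorem measurable_symOfCoords : Measurable (symOfCoords (m := m)) :=
  continuous_symOfCoords.measurable

/-- The action `r ↦ g' r g` on symmetric matrices, in coordinates. -/
def congrCoords (g : Mat m m) : (UpperIndex m → ℝ) →ₗ[ℝ] (UpperIndex m → ℝ) where
  toFun c q := (g.transpose * symOfCoords c * g) q.1.1 q.1.2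
  map_add' c d := by
    have : symOfCoords (c + d) = symOfCoords c + symOfCoords d := rfl
    ext q
    simp [this, Matrix.mul_add, Matrix.add_mul]
  map_smul' t c := by
    have : symOfCoords (t • c) = t • symOfCoords c := rfl
    ext q
    simp [this]

theorem symOfCoords_congrCoords (g : Mat m m) (c : UpperIndex m → ℝ) :
    symOfCoords (congrCoords g c) = g.transpose * symOfCoords c * g :=
  symOfCoords_restrict (r := g.transpose * symOfCoords c * g) (by
    simp only [Matrix.transpose_mul, transpose_symOfCoords, Matrix.transpose_transpose,
      Matrix.mul_assoc])

theorem congrCoords_mul (g h : Mat m m) :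
    congrCoords (g * h) = congrCoords h ∘ₗ congrCoords g := by
  refine LinearMap.ext fun c => funext fun q => ?_
  change ((g * h).transpose * symOfCoords c * (g * h) : Mat m m) q.1.1 q.1.2 =
    (h.transpose * symOfCoords (congrCoords g c) * h : Mat m m) q.1.1 q.1.2
  rw [symOfCoords_congrCoords, Matrix.transpose_mul]
  simp only [Matrix.mul_assoc]

theorem det_congrCoords_mul (g h : Mat m m) :
    LinearMap.det (congrCoords (g * h)) =
      LinearMap.det (congrCoords g) * LinearMap.det (congrCoords h) := by
  rw [congrCoords_mul, LinearMap.det_comp, mul_comm]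

theorem prod_upperIndex (d : Fin m → ℝ) :
    ∏ q : UpperIndex m, (d q.1.1 * d q.1.2) = (∏ i, d i) ^ (m + 1) := by
  have hsubtype (f : Fin m × Fin m → ℝ) :
      ∏ q : UpperIndex m, f q.1 = ∏ q : Fin m × Fin m, if q.1 ≤ q.2 then f q else 1 := by
    rw [← Finset.prod_filter]
    exact (Finset.prod_subtype _ (by simp) f).symm
  rw [Finset.prod_mul_distrib, hsubtype fun q => d q.1, hsubtype fun q => d q.2,
    Fintype.prod_prod_type, Fintype.prod_prod_type_right, ← Finset.prod_mul_distrib,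
    ← Finset.prod_pow]
  refine Finset.prod_congr rfl fun i _ => ?_
  have hge : (Finset.univ.filter fun j => i ≤ j) = Finset.Ici i := by ext; simp
  have hle : (Finset.univ.filter fun j => j ≤ i) = Finset.Iic i := by ext; simp
  simp only [← Finset.prod_filter, Finset.prod_const, ← pow_add, hge, hle, Fin.card_Ici,
    Fin.card_Iic]
  congr 1
  omega

theorem det_congrCoords_diagonal (d : Fin m → ℝ) :
    LinearMap.det (congrCoords (Matrix.diagonal d)) = (Matrix.diagonal d).det ^ (m + 1) := by
  have hdiag : congrCoords (Matrix.diagonal d) =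
      Matrix.toLin' (Matrix.diagonal fun q : UpperIndex m => d q.1.1 * d q.1.2) := by
    refine LinearMap.ext fun c => funext fun q => ?_
    rw [Matrix.toLin'_apply, Matrix.mulVec_diagonal]
    change ((Matrix.diagonal d).transpose * symOfCoords c * Matrix.diagonal d : Mat m m)
      q.1.1 q.1.2 = _
    rw [Matrix.diagonal_transpose, Matrix.mul_diagonal, Matrix.diagonal_mul,
      symOfCoords_apply_of_le]
    ring
  rw [hdiag, LinearMap.det_toLin', Matrix.det_diagonal, Matrix.det_diagonal, prod_upperIndex]

theorem det_congrCoords_ne_zero {g : Mat m m} (hg : g.det ≠ 0) :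
    LinearMap.det (congrCoords g) ≠ 0 := by
  have hone := det_congrCoords_diagonal (fun _ : Fin m => (1 : ℝ))
  rw [Matrix.diagonal_one, Matrix.det_one, one_pow, ← Matrix.mul_nonsing_inv g hg.isUnit,
    det_congrCoords_mul] at hone
  exact left_ne_zero_of_mul (hone.trans_ne one_ne_zero)

theorem diagonal_mul_transvection {i j : Fin m} (hij : i ≠ j) (c : ℝ) :
    Matrix.diagonal (fun l => if l = i then (2 : ℝ) else 1) * Matrix.transvection i j c =
      Matrix.transvection i j c * Matrix.transvection i j c *
        Matrix.diagonal (fun l => if l = i then 2 else 1) := by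
  rw [Matrix.transvection_mul_transvection_same _ _ hij]
  simp only [Matrix.transvection, Matrix.mul_add, Matrix.add_mul, Matrix.mul_one, Matrix.one_mul]
  congr 1
  ext a b
  simp only [Matrix.diagonal_mul, Matrix.mul_diagonal, Matrix.single_apply]
  split_ifs <;> grind

theorem det_congrCoords_transvection {i j : Fin m} (hij : i ≠ j) (c : ℝ) :
    LinearMap.det (congrCoords (Matrix.transvection i j c)) = 1 := by
  -- A transvection is conjugate to its own square, so its determinant is its own square.
  have hconj := congrArg (fun g => LinearMap.det (congrCoords g)) (diagonal_mul_transvection hij c)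
  simp only [det_congrCoords_mul] at hconj
  have hD : LinearMap.det (congrCoords (Matrix.diagonal fun l => if l = i then (2 : ℝ) else 1)) ≠
      0 := by
    refine det_congrCoords_ne_zero ?_
    rw [Matrix.det_diagonal, Finset.prod_ne_zero_iff]
    intro l _
    split_ifs <;> norm_num
  have hT : LinearMap.det (congrCoords (Matrix.transvection i j c)) ≠ 0 :=
    det_congrCoords_ne_zero (by rw [Matrix.det_transvection_of_ne _ _ hij]; exact one_ne_zero)
  rw [mul_comm, mul_left_inj' hD] at hconj
  exact (mul_eq_left₀ hT).1 hconj.symm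

theorem det_congrCoords (g : Mat m m) (hg : g.det ≠ 0) :
    LinearMap.det (congrCoords g) = g.det ^ (m + 1) := by
  refine Matrix.diagonal_transvection_induction_of_det_ne_zero
    (fun g => LinearMap.det (congrCoords g) = g.det ^ (m + 1)) g hg
    (fun d _ => det_congrCoords_diagonal d) (fun t => ?_) fun A B _ _ hA hB => ?_
  · rw [Matrix.TransvectionStruct.det, one_pow]
    exact det_congrCoords_transvection t.hij t.c
  · rw [det_congrCoords_mul, hA, hB, Matrix.det_mul, mul_pow]

theorem lintegral_coneMeasure {F : Mat m m → ℝ≥0∞} (hF : Measurable F) :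
    ∫⁻ r, F r ∂(coneMeasure m) =
      ∫⁻ c : UpperIndex m → ℝ, (posCone m).indicator F (symOfCoords c) := by
  rw [coneMeasure, ← lintegral_indicator measurableSet_posCone,
    lintegral_map (hF.indicator measurableSet_posCone) measurable_symOfCoords]

theorem lintegral_coneMeasure_congr (g : Mat m m) (hg : g.det ≠ 0) {F : Mat m m → ℝ≥0∞}
    (hF : Measurable F) :
    ∫⁻ r, F (g.transpose * r * g) ∂(coneMeasure m) =
      ENNReal.ofReal ((|g.det| ^ (m + 1))⁻¹) * ∫⁻ r, F r ∂(coneMeasure m) := by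
  have hmap := Real.map_linearMap_volume_pi_eq_smul_volume_pi (det_congrCoords_ne_zero hg)
  rw [det_congrCoords g hg, abs_inv, abs_pow] at hmap
  have hI : Measurable fun c => (posCone m).indicator F (symOfCoords c) :=
    (hF.indicator measurableSet_posCone).comp measurable_symOfCoords
  have hL : Measurable (congrCoords g) :=
    (congrCoords g).continuous_of_finiteDimensional.measurable
  rw [lintegral_coneMeasure hF, lintegral_coneMeasure (F := fun r => F (g.transpose * r * g))
    (hF.comp (measurable_congr g)), ← smul_eq_mul, ← lintegral_smul_measure, ← hmap,
    lintegral_map hI hL]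
  refine lintegral_congr fun c => ?_
  rw [symOfCoords_congrCoords]
  by_cases h : symOfCoords c ∈ posCone m
  · rw [Set.indicator_of_mem h, Set.indicator_of_mem]
    exact (posDef_congr_iff hg).2 h
  · rw [Set.indicator_of_notMem h, Set.indicator_of_notMem]
    exact fun h' => h ((posDef_congr_iff hg).1 h')

theorem lintegral_coneInvMeasure {F : Mat m m → ℝ≥0∞} (hF : Measurable F) :
    ∫⁻ r, F r ∂(coneInvMeasure m) =
      ∫⁻ r, ENNReal.ofReal (r.det ^ (-(((m : ℝ) + 1) / 2))) * F r ∂(coneMeasure m) := by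
  rw [coneInvMeasure, lintegral_withDensity_eq_lintegral_mul _ (measurable_ofReal_det_rpow _) hF]
  rfl

theorem ae_coneMeasure_posDef : ∀ᵐ r ∂(coneMeasure m), r.PosDef :=
  ae_restrict_mem measurableSet_posCone

theorem ae_coneInvMeasure_posDef : ∀ᵐ r ∂(coneInvMeasure m), r.PosDef :=
  (withDensity_absolutelyContinuous _ _).ae_le ae_coneMeasure_posDef

theorem lintegral_coneInvMeasure_congr (g : Mat m m) (hg : g.det ≠ 0) {F : Mat m m → ℝ≥0∞}
    (hF : Measurable F) :
    ∫⁻ r, F (g.transpose * r * g) ∂(coneInvMeasure m) = ∫⁻ r, F r ∂(coneInvMeasure m) := by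
  have hpos : 0 < |g.det| ^ (m + 1) := pow_pos (abs_pos.2 hg) _
  have hdF : Measurable fun s : Mat m m =>
      ENNReal.ofReal (s.det ^ (-(((m : ℝ) + 1) / 2))) * F s :=
    (measurable_ofReal_det_rpow _).mul hF
  have hdensity (r : Mat m m) (hr : r.PosDef) :
      r.det ^ (-(((m : ℝ) + 1) / 2)) =
        |g.det| ^ (m + 1) * (g.transpose * r * g).det ^ (-(((m : ℝ) + 1) / 2)) := by
    have hexp : (2 : ℝ) * (-(((m : ℝ) + 1) / 2)) = -((m + 1 : ℕ) : ℝ) := by push_cast; ring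
    rw [det_congr_rpow g hr, hexp, Real.rpow_neg (abs_nonneg _), Real.rpow_natCast, ← mul_assoc,
      mul_inv_cancel₀ hpos.ne', one_mul]
  rw [lintegral_coneInvMeasure hF, lintegral_coneInvMeasure (F := fun r => F (g.transpose * r * g))
    (hF.comp (measurable_congr g))]
  calc ∫⁻ r, ENNReal.ofReal (r.det ^ (-(((m : ℝ) + 1) / 2))) * F (g.transpose * r * g)
        ∂(coneMeasure m)
      = ∫⁻ r, ENNReal.ofReal (|g.det| ^ (m + 1)) *
          (ENNReal.ofReal ((g.transpose * r * g).det ^ (-(((m : ℝ) + 1) / 2))) *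
            F (g.transpose * r * g)) ∂(coneMeasure m) := by
        refine lintegral_congr_ae ?_
        filter_upwards [ae_coneMeasure_posDef] with r hr
        rw [hdensity r hr, ENNReal.ofReal_mul hpos.le, mul_assoc]
    _ = ENNReal.ofReal (|g.det| ^ (m + 1)) * (ENNReal.ofReal ((|g.det| ^ (m + 1))⁻¹) *
          ∫⁻ s, ENNReal.ofReal (s.det ^ (-(((m : ℝ) + 1) / 2))) * F s ∂(coneMeasure m)) :=
        (lintegral_const_mul _ (hdF.comp (measurable_congr g))).trans
          (congrArg _ (lintegral_coneMeasure_congr g hg hdF))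
    _ = _ := by
        rw [← mul_assoc, ← ENNReal.ofReal_mul hpos.le, mul_inv_cancel₀ hpos.ne',
          ENNReal.ofReal_one, one_mul]

theorem measurePreserving_congr_coneInvMeasure (g : Mat m m) (hg : g.det ≠ 0) :
    MeasurePreserving (fun r : Mat m m => g.transpose * r * g)
      (coneInvMeasure m) (coneInvMeasure m) := by
  refine ⟨measurable_congr g, Measure.ext_of_lintegral _ fun F hF => ?_⟩
  rw [lintegral_map hF (measurable_congr g), lintegral_coneInvMeasure_congr g hg hF]

end ConeMeasure

section ConeInterval

variable {m : ℕ}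

theorem eventually_posDef {a₀ : Mat m m} (h : a₀.PosDef) :
    ∀ᶠ a : Mat m m in 𝓝 a₀, a.transpose = a → a.PosDef := by
  have hform : Continuous fun q : Mat m m × (Fin m → ℝ) => dotProduct q.2 (q.1.mulVec q.2) :=
    continuous_snd.dotProduct (continuous_fst.matrix_mulVec continuous_snd)
  have hsphere := (isCompact_sphere (0 : Fin m → ℝ) 1).eventually_forall_of_forall_eventually
    (x₀ := a₀) (P := fun a x => 0 < dotProduct x (a.mulVec x)) fun x hx => by
      refine (hform.tendsto (a₀, x)).eventually_const_lt ?_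
      simpa using h.dotProduct_mulVec_pos (Metric.ne_of_mem_sphere hx one_ne_zero)
  filter_upwards [hsphere] with a ha hsym
  refine Matrix.PosDef.of_dotProduct_mulVec_pos
    (by rwa [Matrix.IsHermitian, Matrix.conjTranspose_eq_transpose_of_trivial]) fun x hx => ?_
  have hnorm : 0 < ‖x‖ := norm_pos_iff.2 hx
  have hunit := ha (‖x‖⁻¹ • x) (by simp [norm_smul, hnorm.ne'])
  rw [Matrix.mulVec_smul, dotProduct_smul, smul_dotProduct, smul_eq_mul, smul_eq_mul,
    ← mul_assoc] at hunit
  simpa using (mul_pos_iff_of_pos_left (by positivity)).1 hunit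

theorem posDef_smul_one {c : ℝ} (hc : 0 < c) : (c • (1 : Mat m m)).PosDef :=
  Matrix.PosDef.one.smul hc

theorem smul_one_mem_coneInterval {ε t ρ : ℝ} (hεt : ε < t) (htρ : t < ρ) :
    t • (1 : Mat m m) ∈ coneInterval (ε • (1 : Mat m m)) (ρ • (1 : Mat m m)) := by
  constructor <;> rw [← sub_smul]
  · exact posDef_smul_one (sub_pos.2 hεt)
  · exact posDef_smul_one (sub_pos.2 htρ)

theorem transpose_smul_one (c : ℝ) : (c • (1 : Mat m m)).transpose = c • (1 : Mat m m) := by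
  rw [Matrix.transpose_smul, Matrix.transpose_one]

theorem abs_entry_le_trace_of_posSemidef {a : Mat m m} (ha : a.PosSemidef) (i j : Fin m) :
    |a i j| ≤ a.trace := by
  have hdiag (l : Fin m) : a l l ≤ a.trace :=
    Finset.single_le_sum (f := fun l => a l l) (fun _ _ => ha.diag_nonneg) (Finset.mem_univ l)
  have hsymm : a j i = a i j := ha.isHermitian.apply i j
  have hadd := ha.dotProduct_mulVec_nonneg (Pi.single i 1 + Pi.single j 1)
  have hsub := ha.dotProduct_mulVec_nonneg (Pi.single i 1 - Pi.single j 1)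
  simp only [star_trivial, Matrix.mulVec_add, Matrix.mulVec_sub, Matrix.mulVec_single,
    MulOpposite.op_one, one_smul, dotProduct_add, dotProduct_sub, add_dotProduct, sub_dotProduct,
    single_dotProduct, Matrix.col_apply, one_mul, hsymm] at hadd hsub
  rw [abs_le]
  constructor <;> linarith [hdiag i, hdiag j]

theorem abs_entry_le_of_posSemidef {ρ : ℝ} {a : Mat m m} (ha : a.PosSemidef)
    (hρ : (ρ • (1 : Mat m m) - a).PosSemidef) (i j : Fin m) : |a i j| ≤ m * ρ := by
  refine (abs_entry_le_trace_of_posSemidef ha i j).trans ?_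
  have htrace := hρ.trace_nonneg
  simp only [Matrix.trace_sub, Matrix.trace_smul, Matrix.trace_one, Fintype.card_fin,
    smul_eq_mul] at htrace
  linarith

theorem exists_isCompact_posDef {ε : ℝ} (hε : 0 < ε) (m : ℕ) (ρ : ℝ) :
    ∃ K : Set (Mat m m), IsCompact K ∧ (∀ a ∈ K, a.PosDef) ∧
      coneInterval (ε • (1 : Mat m m)) (ρ • (1 : Mat m m)) ⊆ K := by
  let K : Set (Mat m m) := {a | (a - ε • (1 : Mat m m)).PosSemidef ∧
    (ρ • (1 : Mat m m) - a).PosSemidef}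
  have hpos : ∀ a ∈ K, a.PosDef := fun a ha => by
    simpa using (posDef_smul_one (m := m) hε).posSemidef_add ha.1
  have hclosed : IsClosed K :=
    (isClosed_setOf_posSemidef.preimage
        (continuous_id.sub continuous_const : Continuous fun a => a - ε • (1 : Mat m m))).inter
      (isClosed_setOf_posSemidef.preimage
        (continuous_const.sub continuous_id : Continuous fun a => ρ • (1 : Mat m m) - a))
  exact ⟨K, (isCompact_setOf_abs_le (m * ρ)).of_isClosed_subset hclosed
    fun a ha => abs_entry_le_of_posSemidef (hpos a ha).posSemidef ha.2, hpos,
    fun a ha => ⟨ha.1.posSemidef, ha.2.posSemidef⟩⟩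

theorem exists_det_rpow_le {ε : ℝ} (hε : 0 < ε) (m : ℕ) (ρ s : ℝ) :
    ∃ C : ℝ, ∀ a ∈ coneInterval (ε • (1 : Mat m m)) (ρ • (1 : Mat m m)), a.det ^ s ≤ C := by
  obtain ⟨K, hK, hpos, hsub⟩ := exists_isCompact_posDef hε m ρ
  have hcont : ContinuousOn (fun a : Mat m m => a.det ^ s) K :=
    continuous_id.matrix_det.continuousOn.rpow_const fun a ha => Or.inl (hpos a ha).det_pos.ne'
  obtain ⟨C, hC⟩ := (hK.image_of_continuousOn hcont).bddAbove
  exact ⟨C, fun a ha => hC ⟨a, hsub ha, rfl⟩⟩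

theorem coneMeasure_lt_top_of_isCompact {K : Set (Mat m m)} (hK : IsCompact K) :
    coneMeasure m K < ∞ := by
  let entries : Mat m m → UpperIndex m → ℝ := fun r q => r q.1.1 q.1.2
  have hentries : Continuous entries :=
    continuous_pi fun q => continuous_id.matrix_elem q.1.1 q.1.2
  have hpre : symOfCoords ⁻¹' K ⊆ entries '' K := fun c hc =>
    ⟨symOfCoords c, hc, funext (symOfCoords_apply_of_le c)⟩
  refine (Measure.restrict_apply_le _ _).trans_lt ?_
  rw [Measure.map_apply measurable_symOfCoords hK.isClosed.measurableSet]
  exact (measure_mono hpre).trans_lt (hK.image hentries).measure_lt_top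

theorem coneInvMeasure_coneInterval_lt_top {ε ρ : ℝ} (hε : 0 < ε) :
    coneInvMeasure m (coneInterval (ε • (1 : Mat m m)) (ρ • (1 : Mat m m))) < ∞ := by
  obtain ⟨K, hK, -, hsub⟩ := exists_isCompact_posDef hε m ρ
  obtain ⟨C, hC⟩ := exists_det_rpow_le hε m ρ (-(((m : ℝ) + 1) / 2))
  rw [coneInvMeasure, withDensity_apply _ (measurableSet_coneInterval _ _)]
  refine (setLIntegral_mono measurable_const fun a ha =>
    ENNReal.ofReal_le_ofReal (hC a ha)).trans_lt ?_
  rw [setLIntegral_const]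
  exact ENNReal.mul_lt_top ENNReal.ofReal_lt_top
    ((measure_mono hsub).trans_lt (coneMeasure_lt_top_of_isCompact hK))

theorem preimage_symOfCoords_coneInterval_mem_nhds {A B r : Mat m m} (hA : A.transpose = A)
    (hB : B.transpose = B) (hr : r.transpose = r) (h : r ∈ coneInterval A B) :
    symOfCoords ⁻¹' coneInterval A B ∈ 𝓝 fun q : UpperIndex m => r q.1.1 q.1.2 := by
  have hlower := eventually_posDef h.1
  have hupper := eventually_posDef h.2
  rw [← symOfCoords_restrict hr] at hlower hupper
  have hsubA : Continuous fun c => symOfCoords c - A := continuous_symOfCoords.sub continuous_const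
  have hBsub : Continuous fun c => B - symOfCoords c := continuous_const.sub continuous_symOfCoords
  filter_upwards [hsubA.continuousAt.eventually hlower, hBsub.continuousAt.eventually hupper]
    with c hc hc'
  exact ⟨hc (by rw [Matrix.transpose_sub, transpose_symOfCoords, hA]),
    hc' (by rw [Matrix.transpose_sub, transpose_symOfCoords, hB])⟩

theorem coneInvMeasure_ne_zero_of_coneMeasure_ne_zero {s : Set (Mat m m)}
    (h : coneMeasure m s ≠ 0) : coneInvMeasure m s ≠ 0 := by
  rw [coneInvMeasure, Ne, withDensity_apply_eq_zero (measurable_ofReal_det_rpow _)]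
  intro hnull
  refine h (measure_mono_null_ae ?_ hnull)
  filter_upwards [ae_coneMeasure_posDef] with r hr hrs
  exact ⟨(ENNReal.ofReal_pos.2 (Real.rpow_pos_of_pos hr.det_pos _)).ne', hrs⟩

theorem coneInvMeasure_coneInterval_pos {ε ρ : ℝ} (hε : 0 < ε) (hρ : ε < ρ) :
    0 < coneInvMeasure m (coneInterval (ε • (1 : Mat m m)) (ρ • (1 : Mat m m))) := by
  obtain ⟨t, hεt, htρ⟩ := exists_between hρ
  have hI := measurableSet_coneInterval (ε • (1 : Mat m m)) (ρ • (1 : Mat m m))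
  have hsub : coneInterval (ε • (1 : Mat m m)) (ρ • (1 : Mat m m)) ⊆ posCone m := fun a ha =>
    posDef_of_mem_coneInterval (posDef_smul_one hε).posSemidef ha
  refine pos_iff_ne_zero.2 (coneInvMeasure_ne_zero_of_coneMeasure_ne_zero ?_)
  rw [coneMeasure, Measure.restrict_apply hI, Set.inter_eq_left.2 hsub,
    Measure.map_apply measurable_symOfCoords hI]
  exact (Measure.measure_pos_of_mem_nhds _ (preimage_symOfCoords_coneInterval_mem_nhds
    (transpose_smul_one ε) (transpose_smul_one ρ) (transpose_smul_one t)
    (smul_one_mem_coneInterval hεt htρ))).ne'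

end ConeInterval

/-! ### Uniqueness of the invariant measure and the polar decomposition -/

section Uniqueness

variable {n m p : ℕ}

theorem measurable_matInv : Measurable fun r : Mat m m => r⁻¹ := by
  simp only [Matrix.inv_def, Ring.inverse_eq_inv']
  exact (continuous_fst.smul continuous_snd).measurable.comp
    (measurable_det.inv.prodMk continuous_id.matrix_adjugate.measurable)

theorem measurable_trace : Measurable fun x : Mat m m => x.trace :=
  continuous_id.matrix_trace.measurable

theorem measurable_mul_mul_transpose {α : Type*} [MeasurableSpace α] {f g : α → Mat m m}
    (hf : Measurable f) (hg : Measurable g) :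
    Measurable fun a => g a * f a * (g a).transpose := by
  have hcont : Continuous fun q : Mat m m × Mat m m => q.2 * q.1 * q.2.transpose :=
    (continuous_snd.matrix_mul continuous_fst).matrix_mul continuous_snd.matrix_transpose
  have hcomp := hcont.measurable.comp (hf.prodMk hg)
  exact hcomp

theorem continuous_gram : Continuous fun z : Mat p m => z.transpose * z :=
  continuous_id.matrix_transpose.matrix_mul continuous_id

theorem measurable_gram : Measurable fun z : Mat p m => z.transpose * z :=
  continuous_gram.measurable

theorem measurable_comp_mul_transpose {F : Mat m m → ℝ≥0∞} (hF : Measurable F) :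
    Measurable fun g : Mat m m => F (g * g.transpose) :=
  hF.comp (continuous_id.matrix_mul continuous_id.matrix_transpose).measurable

theorem ae_det_ne_zero : ∀ᵐ g : Mat m m, g.det ≠ 0 := by
  filter_upwards [ae_det_gram_ne_zero (p := m) le_rfl] with g hg h
  exact hg (by rw [Matrix.det_mul, h, mul_zero])

theorem ae_posDef_gram (hmp : m ≤ p) : ∀ᵐ z : Mat p m, (z.transpose * z).PosDef := by
  filter_upwards [ae_det_gram_ne_zero hmp] with z hz using posDef_transpose_mul_self hz

theorem ofReal_det_rpow_mul_ofReal_det_rpow {r : Mat m m} (hr : r.PosDef) (s t : ℝ) :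
    ENNReal.ofReal (r.det ^ s) * ENNReal.ofReal (r.det ^ t) = ENNReal.ofReal (r.det ^ (s + t)) := by
  rw [← ENNReal.ofReal_mul (Real.rpow_pos_of_pos hr.det_pos _).le, ← Real.rpow_add hr.det_pos]

theorem det_congr_rpow_neg_half (g : Mat m m) {r : Mat m m} (hr : r.PosDef) (p : ℕ) :
    (g.transpose * r * g).det ^ (-(p : ℝ) / 2) = (|g.det| ^ p)⁻¹ * r.det ^ (-(p : ℝ) / 2) := by
  rw [det_congr_rpow g hr, show 2 * (-(p : ℝ) / 2) = -p by ring, Real.rpow_neg (abs_nonneg _),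
    Real.rpow_natCast]

/-- The Gaussian mass `∫ exp(-tr(z'z)) dz` of the space of `n × m` matrices. -/
noncomputable def gaussMass (n m : ℕ) : ℝ≥0∞ :=
  ∫⁻ z : Mat n m, ENNReal.ofReal (Real.exp (-(z.transpose * z).trace))

theorem ofReal_exp_neg_trace_gram (z : Mat n m) :
    ENNReal.ofReal (Real.exp (-(z.transpose * z).trace)) =
      ENNReal.ofReal (∏ q, Real.exp (-(vecEquiv n m z q) ^ 2)) := by
  rw [← Real.exp_sum]
  simp only [Matrix.trace, Matrix.diag_apply, Matrix.mul_apply, Matrix.transpose_apply,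
    Finset.sum_neg_distrib, Fintype.sum_prod_type_right, pow_two]
  rfl

theorem gaussMass_eq : gaussMass n m = ENNReal.ofReal (Real.pi ^ ((n : ℝ) * m / 2)) := by
  have hline : Integrable fun t : ℝ => Real.exp (-t ^ 2) := by
    simpa using integrable_exp_neg_mul_sq one_pos
  have hline_eq : ∫ t : ℝ, Real.exp (-t ^ 2) = Real.pi ^ (1 / 2 : ℝ) := by
    simpa [Real.sqrt_eq_rpow] using integral_gaussian 1
  have hprod : Integrable fun c : Fin n × Fin m → ℝ => ∏ q, Real.exp (-(c q) ^ 2) :=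
    Integrable.fintype_prod (f := fun _ t => Real.exp (-t ^ 2)) fun _ => hline
  calc gaussMass n m
      = ∫⁻ c : Fin n × Fin m → ℝ, ENNReal.ofReal (∏ q, Real.exp (-(c q) ^ 2)) := by
        rw [gaussMass, ← volume_preserving_vecEquiv.lintegral_comp (by fun_prop)]
        exact lintegral_congr ofReal_exp_neg_trace_gram
    _ = ENNReal.ofReal ((Real.pi ^ (1 / 2 : ℝ)) ^ Fintype.card (Fin n × Fin m)) := by
        rw [← ofReal_integral_eq_lintegral_ofReal hprod
          (Eventually.of_forall fun c => Finset.prod_nonneg fun _ _ => (Real.exp_pos _).le),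
          integral_fintype_prod_volume_eq_pow (fun t : ℝ => Real.exp (-t ^ 2)), hline_eq]
    _ = _ := by
        rw [← Real.rpow_natCast, ← Real.rpow_mul Real.pi_pos.le]
        simp only [Fintype.card_prod, Fintype.card_fin, Nat.cast_mul]
        ring_nf

theorem gaussMass_ne_zero : gaussMass n m ≠ 0 := by
  rw [gaussMass_eq]
  exact (ENNReal.ofReal_pos.2 (Real.rpow_pos_of_pos Real.pi_pos _)).ne'

theorem gaussMass_ne_top : gaussMass n m ≠ ∞ :=
  gaussMass_eq.trans_ne ENNReal.ofReal_ne_top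

/-- A measure on the cone that is invariant under `r ↦ g' r g` for all invertible `g`, expressed
through integrals of nonnegative functions. -/
structure IsConeInvariant (μ : Measure (Mat m m)) : Prop where
  ae_posDef : ∀ᵐ r ∂μ, r.PosDef
  lintegral_comp_congr : ∀ g : Mat m m, g.det ≠ 0 → ∀ F : Mat m m → ℝ≥0∞, Measurable F →
    ∫⁻ r, F (g.transpose * r * g) ∂μ = ∫⁻ r, F r ∂μ

/-- The weight `|x|^{-m/2} exp(-tr(h x⁻¹ h'))`, which the Gaussian `exp(-tr(gg'))` becomes under
the substitution `h = g x^{1/2}`. -/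
noncomputable def coneWeight (x h : Mat m m) : ℝ≥0∞ :=
  ENNReal.ofReal (x.det ^ (-(m : ℝ) / 2) * Real.exp (-(h * x⁻¹ * h.transpose).trace))

theorem measurable_coneWeight {α : Type*} [MeasurableSpace α] {f g : α → Mat m m}
    (hf : Measurable f) (hg : Measurable g) : Measurable fun a => coneWeight (f a) (g a) := by
  have hexp : Measurable fun a => Real.exp (-(g a * (f a)⁻¹ * (g a).transpose).trace) :=
    Real.continuous_exp.measurable.comp
      (measurable_trace.comp (measurable_mul_mul_transpose (measurable_matInv.comp hf) hg)).neg
  exact (((measurable_det.comp hf).pow_const _).mul hexp).ennreal_ofReal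

theorem measurable_gauss :
    Measurable fun z : Mat m m => ENNReal.ofReal (Real.exp (-(z * z.transpose).trace)) :=
  (Real.continuous_exp.comp
    (continuous_id.matrix_mul continuous_id.matrix_transpose).matrix_trace.neg).measurable
    |>.ennreal_ofReal

theorem coneWeight_mul_matSqrt {x : Mat m m} (hx : x.PosDef) (z : Mat m m) :
    coneWeight x (z * matSqrt x) = ENNReal.ofReal ((|(matSqrt x).det| ^ m)⁻¹) *
      ENNReal.ofReal (Real.exp (-(z * z.transpose).trace)) := by
  have hunit : IsUnit (matSqrt x).det := (det_matSqrt_pos hx).ne'.isUnit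
  have hinv : x⁻¹ = (matSqrt x)⁻¹ * (matSqrt x)⁻¹ := by
    conv_lhs => rw [← matSqrt_mul_self hx.posSemidef, Matrix.mul_inv_rev]
  have hform : z * matSqrt x * x⁻¹ * (z * matSqrt x).transpose = z * z.transpose := by
    rw [Matrix.transpose_mul, transpose_matSqrt, hinv, Matrix.mul_assoc z,
      Matrix.mul_nonsing_inv_cancel_left _ _ hunit, Matrix.mul_assoc z,
      Matrix.nonsing_inv_mul_cancel_left _ _ hunit]
  have hdet := det_congr_rpow_neg_half (matSqrt x) (Matrix.PosDef.one (n := Fin m) (R := ℝ)) m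
  rw [Matrix.mul_one, transpose_matSqrt, matSqrt_mul_self hx.posSemidef, Matrix.det_one,
    Real.one_rpow, mul_one] at hdet
  rw [coneWeight, hform, hdet, ENNReal.ofReal_mul (by positivity)]

theorem lintegral_gauss_mul_eq {x : Mat m m} (hx : x.PosDef) {F : Mat m m → ℝ≥0∞}
    (hF : Measurable F) :
    ∫⁻ g : Mat m m, ENNReal.ofReal (Real.exp (-(g * g.transpose).trace)) *
        F (g * x * g.transpose) =
      ∫⁻ h : Mat m m, coneWeight x h * F (h * h.transpose) := by
  have hpos := det_matSqrt_pos hx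
  have hJ : ENNReal.ofReal ((|(matSqrt x).det| ^ m)⁻¹) ≠ 0 := by
    rw [abs_of_pos hpos]
    exact (ENNReal.ofReal_pos.2 (inv_pos.2 (pow_pos hpos m))).ne'
  have hsubst := lintegral_mul_right (p := m) (matSqrt x) hpos.ne'
    (F := fun h => coneWeight x h * F (h * h.transpose))
    ((measurable_coneWeight measurable_const measurable_id).mul
      (measurable_comp_mul_transpose hF))
  refine (ENNReal.mul_right_inj hJ ENNReal.ofReal_ne_top).1 ?_
  rw [← hsubst, ← lintegral_const_mul' _ _ ENNReal.ofReal_ne_top]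
  refine lintegral_congr fun z => ?_
  have hform : z * matSqrt x * (z * matSqrt x).transpose = z * x * z.transpose := by
    rw [Matrix.transpose_mul, transpose_matSqrt, ← Matrix.mul_assoc, Matrix.mul_assoc z,
      matSqrt_mul_self hx.posSemidef]
  rw [coneWeight_mul_matSqrt hx, hform, mul_assoc (ENNReal.ofReal _)]

theorem coneWeight_congr {h : Mat m m} (hh : h.det ≠ 0) {y : Mat m m} (hy : y.PosDef) :
    coneWeight (h.transpose * y * h) h =
      ENNReal.ofReal ((|h.det| ^ m)⁻¹) * coneWeight y 1 := by
  have hunit' : IsUnit h.transpose.det := by rw [Matrix.det_transpose]; exact hh.isUnit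
  have hform : h * (h.transpose * y * h)⁻¹ * h.transpose = y⁻¹ := by
    rw [Matrix.mul_inv_rev, Matrix.mul_inv_rev, Matrix.mul_nonsing_inv_cancel_left _ _ hh.isUnit,
      Matrix.nonsing_inv_mul_cancel_right _ _ hunit']
  rw [coneWeight, coneWeight, hform, det_congr_rpow_neg_half h hy, Matrix.one_mul,
    Matrix.transpose_one, Matrix.mul_one, mul_assoc, ENNReal.ofReal_mul (by positivity)]

theorem IsConeInvariant.lintegral_coneWeight {μ : Measure (Mat m m)}
    (hμ : IsConeInvariant μ) {h : Mat m m} (hh : h.det ≠ 0) :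
    ∫⁻ x, coneWeight x h ∂μ = ENNReal.ofReal ((|h.det| ^ m)⁻¹) * ∫⁻ x, coneWeight x 1 ∂μ := by
  rw [← hμ.lintegral_comp_congr h hh (fun x => coneWeight x h)
      (measurable_coneWeight measurable_id measurable_const),
    ← lintegral_const_mul' _ _ ENNReal.ofReal_ne_top]
  refine lintegral_congr_ae ?_
  filter_upwards [hμ.ae_posDef] with y hy using coneWeight_congr hh hy

theorem IsConeInvariant.gaussMass_mul_lintegral {μ : Measure (Mat m m)}
    (hμ : IsConeInvariant μ) {F : Mat m m → ℝ≥0∞} (hF : Measurable F) :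
    gaussMass m m * ∫⁻ r, F r ∂μ =
      ∫⁻ g : Mat m m, ∫⁻ r, ENNReal.ofReal (Real.exp (-(g * g.transpose).trace)) *
        F (g * r * g.transpose) ∂μ := by
  simp only [gaussMass, Matrix.trace_mul_comm (Matrix.transpose _)]
  rw [← lintegral_mul_const _ measurable_gauss]
  refine lintegral_congr_ae ?_
  filter_upwards [ae_det_ne_zero] with g hg
  have hinv := hμ.lintegral_comp_congr g.transpose (by rwa [Matrix.det_transpose]) F hF
  rw [Matrix.transpose_transpose] at hinv
  rw [← hinv, lintegral_const_mul' _ _ ENNReal.ofReal_ne_top]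

theorem IsConeInvariant.lintegral_mul_eq {μ : Measure (Mat m m)} [SFinite μ]
    (hμ : IsConeInvariant μ) {F : Mat m m → ℝ≥0∞} (hF : Measurable F) :
    gaussMass m m * ∫⁻ r, F r ∂μ =
      (∫⁻ g : Mat m m, F (g * g.transpose) * ENNReal.ofReal ((|g.det| ^ m)⁻¹)) *
        ∫⁻ x, coneWeight x 1 ∂μ := by
  have hFgram := measurable_comp_mul_transpose hF
  have hgauss : Measurable fun q : Mat m m × Mat m m =>
      ENNReal.ofReal (Real.exp (-(q.1 * q.1.transpose).trace)) * F (q.1 * q.2 * q.1.transpose) :=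
    (measurable_gauss.comp measurable_fst).mul
      (hF.comp (measurable_mul_mul_transpose measurable_snd measurable_fst))
  have hweight : Measurable fun q : Mat m m × Mat m m =>
      coneWeight q.1 q.2 * F (q.2 * q.2.transpose) :=
    (measurable_coneWeight measurable_fst measurable_snd).mul (hFgram.comp measurable_snd)
  have hint : Measurable fun g : Mat m m =>
      F (g * g.transpose) * ENNReal.ofReal ((|g.det| ^ m)⁻¹) :=
    hFgram.mul ((measurable_det.abs.pow_const m).inv).ennreal_ofReal
  rw [← lintegral_mul_const _ hint]
  calc gaussMass m m * ∫⁻ r, F r ∂μ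
      = ∫⁻ x, (∫⁻ g : Mat m m, ENNReal.ofReal (Real.exp (-(g * g.transpose).trace)) *
          F (g * x * g.transpose)) ∂μ := by
        rw [hμ.gaussMass_mul_lintegral hF, lintegral_lintegral_swap hgauss.aemeasurable]
    _ = ∫⁻ x, (∫⁻ h : Mat m m, coneWeight x h * F (h * h.transpose)) ∂μ := by
        refine lintegral_congr_ae ?_
        filter_upwards [hμ.ae_posDef] with x hx using lintegral_gauss_mul_eq hx hF
    _ = ∫⁻ h : Mat m m, ∫⁻ x, coneWeight x h * F (h * h.transpose) ∂μ :=
        lintegral_lintegral_swap hweight.aemeasurable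
    _ = _ := by
        refine lintegral_congr_ae ?_
        filter_upwards [ae_det_ne_zero] with h hh
        have hmeas : Measurable fun x => coneWeight x h :=
          measurable_coneWeight measurable_id measurable_const
        rw [lintegral_mul_const _ hmeas, hμ.lintegral_coneWeight hh]
        ring

theorem isConeInvariant_coneInvMeasure : IsConeInvariant (coneInvMeasure m) :=
  ⟨ae_coneInvMeasure_posDef, fun g hg _ hF => lintegral_coneInvMeasure_congr g hg hF⟩

instance instSFiniteConeInvMeasure : SFinite (coneInvMeasure m) := by
  unfold coneInvMeasure coneMeasure; infer_instance

theorem lintegral_coneWeight_one_coneInvMeasure_ne_zero_and_ne_top (m : ℕ) :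
    ∫⁻ x, coneWeight x 1 ∂(coneInvMeasure m) ≠ 0 ∧
      ∫⁻ x, coneWeight x 1 ∂(coneInvMeasure m) ≠ ∞ := by
  have hI : MeasurableSet (coneInterval ((1 : ℝ) • (1 : Mat m m)) ((2 : ℝ) • (1 : Mat m m))) :=
    measurableSet_coneInterval _ _
  have hmass := isConeInvariant_coneInvMeasure.lintegral_mul_eq (measurable_one.indicator hI)
  rw [lintegral_indicator_one hI] at hmass
  have hne_zero := hmass.symm.trans_ne (mul_ne_zero gaussMass_ne_zero
    (coneInvMeasure_coneInterval_pos one_pos one_lt_two).ne')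
  have hne_top := hmass.symm.trans_ne (ENNReal.mul_ne_top gaussMass_ne_top
    (coneInvMeasure_coneInterval_lt_top one_pos).ne)
  refine ⟨right_ne_zero_of_mul hne_zero, fun htop => hne_top ?_⟩
  rw [htop, ENNReal.mul_top (left_ne_zero_of_mul hne_zero)]

theorem IsConeInvariant.exists_eq_smul {μ : Measure (Mat m m)} [SFinite μ]
    (hμ : IsConeInvariant μ) : ∃ c : ℝ≥0∞, μ = c • coneInvMeasure m := by
  obtain ⟨hne_zero, hne_top⟩ := lintegral_coneWeight_one_coneInvMeasure_ne_zero_and_ne_top m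
  refine ⟨(∫⁻ x, coneWeight x 1 ∂μ) / ∫⁻ x, coneWeight x 1 ∂(coneInvMeasure m),
    Measure.ext_of_lintegral _ fun F hF => ?_⟩
  rw [lintegral_smul_measure, smul_eq_mul]
  refine (ENNReal.mul_right_inj (gaussMass_ne_zero (n := m) (m := m)) gaussMass_ne_top).1 ?_
  rw [hμ.lintegral_mul_eq hF, mul_left_comm, isConeInvariant_coneInvMeasure.lintegral_mul_eq hF,
    mul_left_comm, ENNReal.div_mul_cancel hne_zero hne_top]

/-- The image of the measure `|z'z|^{-p/2} dz` on `p × m` matrices under `z ↦ z'z`. -/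
noncomputable def gramInvMeasure (p m : ℕ) : Measure (Mat m m) :=
  (Measure.map (fun z : Mat p m => z.transpose * z) volume).withDensity
    fun r => ENNReal.ofReal (r.det ^ (-(p : ℝ) / 2))

instance instSFiniteGramInvMeasure : SFinite (gramInvMeasure p m) := by
  unfold gramInvMeasure; infer_instance

theorem lintegral_gramInvMeasure {F : Mat m m → ℝ≥0∞} (hF : Measurable F) :
    ∫⁻ r, F r ∂(gramInvMeasure p m) = ∫⁻ z : Mat p m,
      ENNReal.ofReal ((z.transpose * z).det ^ (-(p : ℝ) / 2)) * F (z.transpose * z) := by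
  rw [gramInvMeasure, lintegral_withDensity_eq_lintegral_mul _ (measurable_ofReal_det_rpow _) hF,
    lintegral_map ((measurable_ofReal_det_rpow _).mul hF) measurable_gram]
  rfl

theorem isConeInvariant_gramInvMeasure (hmp : m ≤ p) : IsConeInvariant (gramInvMeasure p m) := by
  refine ⟨(withDensity_absolutelyContinuous _ _).ae_le
    ((ae_map_iff measurable_gram.aemeasurable measurableSet_setOf_posDef).2
      (ae_posDef_gram hmp)), fun g hg F hF => ?_⟩
  have hJ : ENNReal.ofReal ((|g.det| ^ p)⁻¹) ≠ 0 :=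
    (ENNReal.ofReal_pos.2 (inv_pos.2 (pow_pos (abs_pos.2 hg) p))).ne'
  have hmeas : Measurable fun z : Mat p m =>
      ENNReal.ofReal ((z.transpose * z).det ^ (-(p : ℝ) / 2)) * F (z.transpose * z) :=
    ((measurable_ofReal_det_rpow _).comp measurable_gram).mul (hF.comp measurable_gram)
  have hFg : Measurable fun r => F (g.transpose * r * g) := hF.comp (measurable_congr g)
  rw [lintegral_gramInvMeasure hF, lintegral_gramInvMeasure hFg]
  refine (ENNReal.mul_right_inj hJ ENNReal.ofReal_ne_top).1 ?_
  rw [← lintegral_mul_right g hg hmeas, ← lintegral_const_mul' _ _ ENNReal.ofReal_ne_top]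
  refine lintegral_congr_ae ?_
  filter_upwards [ae_posDef_gram hmp] with z hz
  have hgram : (z * g).transpose * (z * g) = g.transpose * (z.transpose * z) * g := by
    simp only [Matrix.transpose_mul, Matrix.mul_assoc]
  rw [hgram, det_congr_rpow_neg_half g hz, ENNReal.ofReal_mul (by positivity)]
  exact (_root_.mul_assoc _ _ _).symm

/-- The integrand `|r|^α exp(-tr r)` of the Siegel gamma function with respect to `d_* r`. -/
noncomputable def siegelIntegrand (m : ℕ) (α : ℝ) (r : Mat m m) : ℝ≥0∞ :=
  ENNReal.ofReal (r.det ^ α) * ENNReal.ofReal (Real.exp (-r.trace))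

theorem measurable_siegelIntegrand (α : ℝ) : Measurable (siegelIntegrand m α) :=
  (measurable_ofReal_det_rpow α).mul
    (Real.continuous_exp.measurable.comp measurable_trace.neg).ennreal_ofReal

theorem siegelGamma_eq_toReal (α : ℝ) :
    siegelGamma m α = (∫⁻ r, siegelIntegrand m α r ∂(coneInvMeasure m)).toReal := by
  have hmeas : Measurable fun r : Mat m m =>
      Real.exp (-r.trace) * r.det ^ (α - ((m : ℝ) + 1) / 2) :=
    (Real.continuous_exp.measurable.comp measurable_trace.neg).mul (measurable_det.pow_const _)
  rw [siegelGamma, integral_eq_lintegral_of_nonneg_ae _ hmeas.aestronglyMeasurable,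
    lintegral_coneInvMeasure (measurable_siegelIntegrand α)]
  · congr 1
    refine lintegral_congr_ae ?_
    filter_upwards [ae_coneMeasure_posDef] with r hr
    rw [siegelIntegrand, ← mul_assoc, ofReal_det_rpow_mul_ofReal_det_rpow hr,
      ENNReal.ofReal_mul (Real.exp_pos _).le, mul_comm, neg_add_eq_sub]
  · filter_upwards [ae_coneMeasure_posDef] with r hr
    exact mul_nonneg (Real.exp_pos _).le (Real.rpow_pos_of_pos hr.det_pos _).le

theorem lintegral_siegelIntegrand_gramInvMeasure (hmp : m ≤ p) :
    ∫⁻ r, siegelIntegrand m ((p : ℝ) / 2) r ∂(gramInvMeasure p m) = gaussMass p m := by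
  rw [lintegral_gramInvMeasure (measurable_siegelIntegrand _), gaussMass]
  refine lintegral_congr_ae ?_
  filter_upwards [ae_posDef_gram hmp] with z hz
  rw [siegelIntegrand, ← mul_assoc, ofReal_det_rpow_mul_ofReal_det_rpow hz,
    neg_div, neg_add_cancel, Real.rpow_zero, ENNReal.ofReal_one, one_mul]

/-- The constant `π^{pm/2} / Γ_m(p/2)` of the polar decomposition. -/
noncomputable def polarConst (p m : ℕ) : ℝ :=
  Real.pi ^ ((p : ℝ) * m / 2) / siegelGamma m ((p : ℝ) / 2)

theorem polarConst_pos_and_gramInvMeasure_eq (hmp : m ≤ p) : 0 < polarConst p m ∧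
    gramInvMeasure p m = ENNReal.ofReal (polarConst p m) • coneInvMeasure m := by
  obtain ⟨c, hc⟩ := (isConeInvariant_gramInvMeasure hmp).exists_eq_smul
  set L := ∫⁻ r, siegelIntegrand m ((p : ℝ) / 2) r ∂(coneInvMeasure m)
  -- Testing against the integrand of the Siegel gamma function identifies the constant.
  have hgauss : ENNReal.ofReal (Real.pi ^ ((p : ℝ) * m / 2)) = c * L := by
    rw [← gaussMass_eq, ← lintegral_siegelIntegrand_gramInvMeasure hmp, hc,
      lintegral_smul_measure, smul_eq_mul]
  have hpi : 0 < Real.pi ^ ((p : ℝ) * m / 2) := Real.rpow_pos_of_pos Real.pi_pos _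
  have hcL : c * L ≠ 0 := hgauss.symm.trans_ne (ENNReal.ofReal_pos.2 hpi).ne'
  have hL : L ≠ ∞ := fun h => ENNReal.ofReal_ne_top
    (hgauss.trans (by rw [h, ENNReal.mul_top (left_ne_zero_of_mul hcL)]))
  have hΓ : siegelGamma m ((p : ℝ) / 2) = L.toReal := siegelGamma_eq_toReal _
  have hΓpos : 0 < siegelGamma m ((p : ℝ) / 2) :=
    hΓ ▸ ENNReal.toReal_pos (right_ne_zero_of_mul hcL) hL
  refine ⟨div_pos hpi hΓpos, ?_⟩
  rw [hc, polarConst, ENNReal.ofReal_div_of_pos hΓpos, hgauss, hΓ, ENNReal.ofReal_toReal hL,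
    ENNReal.mul_div_cancel_right (right_ne_zero_of_mul hcL) hL]

theorem polarConst_pos (hmp : m ≤ p) : 0 < polarConst p m :=
  (polarConst_pos_and_gramInvMeasure_eq hmp).1

theorem gramInvMeasure_eq (hmp : m ≤ p) :
    gramInvMeasure p m = ENNReal.ofReal (polarConst p m) • coneInvMeasure m :=
  (polarConst_pos_and_gramInvMeasure_eq hmp).2

theorem lintegral_gram (hmp : m ≤ p) {F : Mat m m → ℝ≥0∞} (hF : Measurable F) :
    ∫⁻ z : Mat p m, F (z.transpose * z) = ENNReal.ofReal (polarConst p m) *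
      ∫⁻ r, ENNReal.ofReal (r.det ^ ((p : ℝ) / 2)) * F r ∂(coneInvMeasure m) := by
  have hmeas : Measurable fun r => ENNReal.ofReal (r.det ^ ((p : ℝ) / 2)) * F r :=
    (measurable_ofReal_det_rpow _).mul hF
  rw [← smul_eq_mul, ← lintegral_smul_measure, ← gramInvMeasure_eq hmp,
    lintegral_gramInvMeasure hmeas]
  refine lintegral_congr_ae ?_
  filter_upwards [ae_posDef_gram hmp] with z hz
  rw [← mul_assoc, ofReal_det_rpow_mul_ofReal_det_rpow hz, neg_div, neg_add_cancel,
    Real.rpow_zero, ENNReal.ofReal_one, one_mul]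

theorem map_gram_volume (hmp : m ≤ p) :
    Measure.map (fun z : Mat p m => z.transpose * z) volume =
      ENNReal.ofReal (polarConst p m) • (coneInvMeasure m).withDensity
        fun r => ENNReal.ofReal (r.det ^ ((p : ℝ) / 2)) := by
  refine Measure.ext_of_lintegral _ fun F hF => ?_
  rw [lintegral_map hF measurable_gram, lintegral_gram hmp hF, lintegral_smul_measure,
    lintegral_withDensity_eq_lintegral_mul _ (measurable_ofReal_det_rpow _) hF]
  rfl

theorem polarConst_eq_stiefelMass : polarConst n m = stiefelMass n m / 2 ^ m := by
  have hpow : (2 : ℝ) ^ m ≠ 0 := by positivity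
  rw [polarConst, stiefelMass]
  field_simp

end Uniqueness

/-! ### Averaging over the orthogonal group -/

section Orthogonal

variable {n m p k : ℕ}

instance instSecondCountableOrthGroup : SecondCountableTopology (OrthGroup n) :=
  TopologicalSpace.Subtype.secondCountableTopology
    (Matrix.orthogonalGroup (Fin n) ℝ : Set (Mat n n))

/-- The Haar probability measure of `O(n)`. -/
noncomputable abbrev orthHaar (n : ℕ) : Measure (OrthGroup n) := Measure.haarMeasure ⊤

instance instIsProbabilityOrthHaar : IsProbabilityMeasure (orthHaar n) :=
  ⟨Measure.haarMeasure_self⟩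

theorem map_mul_right_orthHaar (γ₀ : OrthGroup n) :
    Measure.map (fun γ => γ * γ₀) (orthHaar n) = orthHaar n := by
  have : IsProbabilityMeasure (Measure.map (fun γ => γ * γ₀) (orthHaar n)) :=
    Measure.isProbabilityMeasure_map (measurable_mul_const γ₀).aemeasurable
  exact Measure.isHaarMeasure_eq_of_isProbabilityMeasure _ _

theorem lintegral_orthHaar_mul_right (γ₀ : OrthGroup n) {F : OrthGroup n → ℝ≥0∞}
    (hF : Measurable F) : ∫⁻ γ, F (γ * γ₀) ∂(orthHaar n) = ∫⁻ γ, F γ ∂(orthHaar n) := by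
  conv_rhs => rw [← map_mul_right_orthHaar γ₀, lintegral_map hF (measurable_mul_const γ₀)]

theorem transpose_stdFrame_mul_self (hmn : m ≤ n) :
    (stdFrame n m).transpose * stdFrame n m = 1 := by
  ext a b
  rw [Matrix.mul_apply, Finset.sum_eq_single (Fin.castLE hmn a)]
  · simp [stdFrame, Matrix.one_apply, Fin.ext_iff]
  · intro i _ hi
    have hne : (i : ℕ) ≠ a := fun h => hi (Fin.ext h)
    simp [stdFrame, hne]
  · simp

theorem orthonormal_columns_iff {ι κ : Type*} [Fintype ι] [DecidableEq κ]
    (A : Matrix ι κ ℝ) :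
    Orthonormal ℝ (fun j => WithLp.toLp 2 (A.col j) : κ → EuclideanSpace ℝ ι) ↔
      A.transpose * A = 1 := by
  rw [orthonormal_iff_ite, ← Matrix.ext_iff]
  simp only [Matrix.mul_apply, Matrix.one_apply, PiLp.inner_apply, Matrix.transpose_apply,
    Matrix.col_apply, RCLike.inner_apply, conj_trivial, mul_comm]

theorem exists_orthGroup_mul_stdFrame (hmn : m ≤ n) {V : Mat n m} (hV : V.transpose * V = 1) :
    ∃ γ : OrthGroup n, V = (γ : Mat n n) * stdFrame n m := by
  classical
  let v : Fin n → EuclideanSpace ℝ (Fin n) := fun j =>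
    if h : (j : ℕ) < m then WithLp.toLp 2 (V.col ⟨j, h⟩) else 0
  have hv : Orthonormal ℝ (({j : Fin n | (j : ℕ) < m} : Set (Fin n)).domRestrict v) := by
    have hcomp := ((orthonormal_columns_iff V).2 hV).comp
      (fun j : {j : Fin n | (j : ℕ) < m} => (⟨j.1, j.2⟩ : Fin m))
      fun a b hab => Subtype.ext (Fin.ext (Fin.mk.inj hab))
    convert hcomp using 1
    ext1 j
    exact dif_pos j.2
  obtain ⟨b, hb⟩ := hv.exists_orthonormalBasis_extension_of_card_eq (by simp)
  let A : Mat n n := Matrix.of fun i j => b j i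
  have hA : A.transpose * A = 1 := (orthonormal_columns_iff A).1 b.orthonormal
  refine ⟨⟨A, (Matrix.mem_orthogonalGroup_iff' (Fin n) ℝ).2 hA⟩, ?_⟩
  ext i j
  rw [Matrix.mul_apply, Finset.sum_eq_single (Fin.castLE hmn j)]
  · have hcol := hb (Fin.castLE hmn j) (show ((Fin.castLE hmn j : Fin n) : ℕ) < m by simp)
    simp [stdFrame, A, hcol, v]
  · intro l _ hl
    have hne : (l : ℕ) ≠ j := fun h => hl (Fin.ext h)
    simp [stdFrame, hne]
  · simp

theorem exists_orthGroup_mul_matSqrt (hmn : m ≤ n) {Y : Mat n m}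
    (hY : (Y.transpose * Y).PosDef) :
    ∃ γ : OrthGroup n, Y = (γ : Mat n n) * (stdFrame n m * matSqrt (Y.transpose * Y)) := by
  set s := matSqrt (Y.transpose * Y)
  have hs : IsUnit s.det := (det_matSqrt_pos hY).ne'.isUnit
  have hss : s * s = Y.transpose * Y := matSqrt_mul_self hY.posSemidef
  have hV : (Y * s⁻¹).transpose * (Y * s⁻¹) = 1 := by
    rw [Matrix.transpose_mul, Matrix.transpose_nonsing_inv, transpose_matSqrt]
    calc s⁻¹ * Y.transpose * (Y * s⁻¹) = s⁻¹ * (Y.transpose * Y) * s⁻¹ := by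
          simp only [Matrix.mul_assoc]
      _ = (s⁻¹ * s) * (s * s⁻¹) := by rw [← hss]; simp only [Matrix.mul_assoc]
      _ = 1 := by rw [Matrix.nonsing_inv_mul _ hs, Matrix.mul_nonsing_inv _ hs, Matrix.one_mul]
  obtain ⟨γ, hγ⟩ := exists_orthGroup_mul_stdFrame hmn hV
  refine ⟨γ, ?_⟩
  rw [← Matrix.mul_assoc, ← hγ, Matrix.mul_assoc, Matrix.nonsing_inv_mul _ hs, Matrix.mul_one]

/-- The average of a function over the orbits of `O(n)`. -/
noncomputable def orthAvg (F : Mat n m → ℝ≥0∞) (Y : Mat n m) : ℝ≥0∞ :=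
  ∫⁻ γ, F ((γ : Mat n n) * Y) ∂(orthHaar n)

theorem measurable_orth_mul {α : Type*} [MeasurableSpace α] {g : α → OrthGroup n}
    {f : α → Mat n m} (hg : Measurable g) (hf : Measurable f) :
    Measurable fun a => (g a : Mat n n) * f a := by
  have hcont : Continuous fun q : OrthGroup n × Mat n m => (q.1 : Mat n n) * q.2 :=
    (continuous_subtype_val.comp continuous_fst).matrix_mul continuous_snd
  have hcomp := hcont.measurable.comp (hg.prodMk hf)
  exact hcomp

theorem measurable_orthAvg {F : Mat n m → ℝ≥0∞} (hF : Measurable F) : Measurable (orthAvg F) :=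
  (hF.comp (measurable_orth_mul measurable_snd measurable_fst)).lintegral_prod_right'

theorem orthAvg_orth_mul {F : Mat n m → ℝ≥0∞} (hF : Measurable F) (γ₀ : OrthGroup n)
    (Y : Mat n m) : orthAvg F ((γ₀ : Mat n n) * Y) = orthAvg F Y := by
  rw [orthAvg, orthAvg, ← lintegral_orthHaar_mul_right γ₀ (F := fun γ => F ((γ : Mat n n) * Y))
    (hF.comp (measurable_orth_mul measurable_id measurable_const))]
  refine lintegral_congr fun γ => ?_
  rw [Submonoid.coe_mul, Matrix.mul_assoc]

/-- The average of `F` over the `O(n)`-orbit `{Y | Y'Y = r}`, as a function of `r`. -/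
noncomputable def radialAvg (F : Mat n m → ℝ≥0∞) (r : Mat m m) : ℝ≥0∞ :=
  orthAvg F (stdFrame n m * matSqrt r)

theorem measurable_radialAvg {F : Mat n m → ℝ≥0∞} (hF : Measurable F) :
    Measurable (radialAvg F) :=
  (measurable_orthAvg hF).comp
    ((continuous_const.matrix_mul continuous_id).measurable.comp measurable_matSqrt)

theorem orthAvg_eq_radialAvg (hmn : m ≤ n) {F : Mat n m → ℝ≥0∞} (hF : Measurable F)
    {Y : Mat n m} (hY : (Y.transpose * Y).PosDef) :
    orthAvg F Y = radialAvg F (Y.transpose * Y) := by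
  obtain ⟨γ, hγ⟩ := exists_orthGroup_mul_matSqrt hmn hY
  conv_lhs => rw [hγ, orthAvg_orth_mul hF]
  rfl

theorem gram_mul_of_gram_eq_one {ξ : Mat n p} (hξ : ξ.transpose * ξ = 1) (η : Mat p m) :
    (ξ * η).transpose * (ξ * η) = η.transpose * η := by
  rw [Matrix.transpose_mul, Matrix.mul_assoc, ← Matrix.mul_assoc _ ξ, hξ, Matrix.one_mul]

theorem gram_orth_mul (γ : OrthGroup n) (Y : Mat n m) :
    ((γ : Mat n n) * Y).transpose * ((γ : Mat n n) * Y) = Y.transpose * Y :=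
  gram_mul_of_gram_eq_one ((Matrix.mem_orthogonalGroup_iff' (Fin n) ℝ).1 γ.2) Y

theorem lintegral_gram_mul_orthAvg {F : Mat n m → ℝ≥0∞} (hF : Measurable F)
    {W : Mat m m → ℝ≥0∞} (hW : Measurable W) :
    ∫⁻ Y : Mat n m, W (Y.transpose * Y) * orthAvg F Y =
      ∫⁻ Y : Mat n m, W (Y.transpose * Y) * F Y := by
  have hWg : Measurable fun Y : Mat n m => W (Y.transpose * Y) := hW.comp measurable_gram
  have hFo : Measurable fun q : Mat n m × OrthGroup n => F ((q.2 : Mat n n) * q.1) :=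
    hF.comp (measurable_orth_mul measurable_snd measurable_fst)
  calc ∫⁻ Y : Mat n m, W (Y.transpose * Y) * orthAvg F Y
      = ∫⁻ Y : Mat n m, (∫⁻ γ, W (Y.transpose * Y) * F ((γ : Mat n n) * Y) ∂(orthHaar n)) := by
        refine lintegral_congr fun Y => ?_
        rw [orthAvg, lintegral_const_mul]
        exact hF.comp (measurable_orth_mul measurable_id measurable_const)
    _ = ∫⁻ γ, (∫⁻ Y : Mat n m, W (Y.transpose * Y) * F ((γ : Mat n n) * Y)) ∂(orthHaar n) := by
        rw [lintegral_lintegral_swap]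
        exact ((hWg.comp measurable_fst).mul hFo).aemeasurable
    _ = ∫⁻ _, (∫⁻ Y : Mat n m, W (Y.transpose * Y) * F Y) ∂(orthHaar n) := by
        refine lintegral_congr fun γ => ?_
        refine Eq.trans (lintegral_congr fun Y => ?_)
          ((volume_preserving_orthGroup_mul γ).lintegral_comp (hWg.mul hF))
        rw [gram_orth_mul]
    _ = _ := by rw [lintegral_const, measure_univ, mul_one]

theorem lintegral_gram_mul_eq_radialAvg (hmn : m ≤ n) {F : Mat n m → ℝ≥0∞} (hF : Measurable F)
    {W : Mat m m → ℝ≥0∞} (hW : Measurable W) :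
    ∫⁻ Y : Mat n m, W (Y.transpose * Y) * F Y = ENNReal.ofReal (polarConst n m) *
      ∫⁻ r, ENNReal.ofReal (r.det ^ ((n : ℝ) / 2)) * (W r * radialAvg F r)
        ∂(coneInvMeasure m) := by
  have hmeas : Measurable fun r => W r * radialAvg F r := hW.mul (measurable_radialAvg hF)
  rw [← lintegral_gram hmn hmeas, ← lintegral_gram_mul_orthAvg hF hW]
  refine lintegral_congr_ae ?_
  filter_upwards [ae_posDef_gram hmn] with Y hY
  rw [orthAvg_eq_radialAvg hmn hF hY]

theorem lintegral_orthHaar_lintegral_eq_radialAvg (hmp : m ≤ p) (hpn : p ≤ n) {ξ₀ : Mat n p}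
    (hξ : ξ₀.transpose * ξ₀ = 1) {F : Mat n m → ℝ≥0∞} (hF : Measurable F) :
    ∫⁻ γ, (∫⁻ η : Mat p m, F ((γ : Mat n n) * (ξ₀ * η))) ∂(orthHaar n) =
      ENNReal.ofReal (polarConst p m) *
        ∫⁻ r, ENNReal.ofReal (r.det ^ ((p : ℝ) / 2)) * radialAvg F r ∂(coneInvMeasure m) := by
  have hmul : Measurable fun η : Mat p m => ξ₀ * η :=
    (continuous_const.matrix_mul continuous_id).measurable
  have hmeas : Measurable fun q : OrthGroup n × Mat p m => F ((q.1 : Mat n n) * (ξ₀ * q.2)) :=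
    hF.comp (measurable_orth_mul measurable_fst (hmul.comp measurable_snd))
  rw [← lintegral_gram hmp (measurable_radialAvg hF), lintegral_lintegral_swap hmeas.aemeasurable]
  refine lintegral_congr_ae ?_
  filter_upwards [ae_posDef_gram hmp] with η hη
  rw [← gram_mul_of_gram_eq_one hξ η] at hη ⊢
  exact orthAvg_eq_radialAvg (hmp.trans hpn) hF hη

theorem lintegral_orthHaar_lintegral_mul (hmp : m ≤ p) (hpn : p ≤ n) {ξ₀ : Mat n p}
    (hξ : ξ₀.transpose * ξ₀ = 1) {F : Mat n m → ℝ≥0∞} (hF : Measurable F) :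
    ∫⁻ γ, (∫⁻ η : Mat p m, F ((γ : Mat n n) * (ξ₀ * η))) ∂(orthHaar n) =
      ENNReal.ofReal (polarConst p m / polarConst n m) * ∫⁻ Y : Mat n m,
        ENNReal.ofReal ((Y.transpose * Y).det ^ (((p : ℝ) - n) / 2)) * F Y := by
  have hcn := polarConst_pos (hmp.trans hpn)
  have hcp := polarConst_pos hmp
  rw [lintegral_orthHaar_lintegral_eq_radialAvg hmp hpn hξ hF,
    lintegral_gram_mul_eq_radialAvg (hmp.trans hpn) hF (measurable_ofReal_det_rpow _), ← mul_assoc,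
    ← ENNReal.ofReal_mul (div_pos hcp hcn).le, div_mul_cancel₀ _ hcn.ne']
  congr 1
  refine lintegral_congr_ae ?_
  filter_upwards [ae_coneInvMeasure_posDef] with r hr
  rw [← mul_assoc, ofReal_det_rpow_mul_ofReal_det_rpow hr, ← add_div, add_sub_cancel]

theorem continuous_orbitMap : Continuous (orbitMap n k) :=
  (continuous_subtype_val.matrix_mul continuous_const).subtype_mk _

instance instIsProbabilityStiefelMeasure : IsProbabilityMeasure (stiefelMeasure n k) :=
  Measure.isProbabilityMeasure_map continuous_orbitMap.measurable.aemeasurable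

theorem measurable_stiefel_mul {α : Type*} [MeasurableSpace α] {g : α → Stiefel n p}
    {f : α → Mat p m} (hg : Measurable g) (hf : Measurable f) :
    Measurable fun a => (g a).1 * f a := by
  have hcont : Continuous fun q : Stiefel n p × Mat p m => q.1.1 * q.2 :=
    (continuous_subtype_val.comp continuous_fst).matrix_mul continuous_snd
  have hcomp := hcont.measurable.comp (hg.prodMk hf)
  exact hcomp

theorem measurable_stiefel_prod_mul :
    Measurable fun q : Stiefel n (n - k) × Mat (n - k) m => q.1.1 * q.2 :=
  measurable_stiefel_mul measurable_fst measurable_snd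

/-- For `k ≤ n` this is `|Y|_m^{-k}`, the density up to a constant of the image of the product of
`stiefelMeasure` and Lebesgue measure under `(ξ, η) ↦ ξη`. -/
noncomputable def stiefelDensity (k : ℕ) (Y : Mat n m) : ℝ :=
  (Y.transpose * Y).det ^ ((((n - k : ℕ) : ℝ) - n) / 2)

theorem measurable_stiefelDensity : Measurable (stiefelDensity k : Mat n m → ℝ) :=
  (measurable_det.comp measurable_gram).pow_const _

theorem stiefelDensity_nonneg (Y : Mat n m) : 0 ≤ stiefelDensity k Y :=
  Real.rpow_nonneg (posSemidef_transpose_mul_self Y).det_nonneg _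

theorem map_stiefel_mul (hm : m ≤ n - k) :
    Measure.map (fun q : Stiefel n (n - k) × Mat (n - k) m => q.1.1 * q.2)
        ((stiefelMeasure n k).prod volume) =
      ENNReal.ofReal (polarConst (n - k) m / polarConst n m) •
        (volume : Measure (Mat n m)).withDensity fun Y => ENNReal.ofReal (stiefelDensity k Y) := by
  refine Measure.ext_of_lintegral _ fun F hF => ?_
  have hmul := measurable_stiefel_prod_mul (n := n) (k := k) (m := m)
  have hFmul : Measurable fun q : Stiefel n (n - k) × Mat (n - k) m => F (q.1.1 * q.2) :=
    hF.comp hmul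
  rw [lintegral_map hF hmul, lintegral_prod _ hFmul.aemeasurable, lintegral_smul_measure,
    lintegral_withDensity_eq_lintegral_mul _ measurable_stiefelDensity.ennreal_ofReal hF,
    stiefelMeasure,
    lintegral_map hFmul.lintegral_prod_right' continuous_orbitMap.measurable]
  refine Eq.trans (lintegral_congr fun γ => lintegral_congr fun η => ?_)
    (lintegral_orthHaar_lintegral_mul hm (Nat.sub_le n k) (stiefelBase n k).2 hF)
  rw [← Matrix.mul_assoc]
  rfl

end Orthogonal

/-! ### Integrals over the cone and the truncated constant -/

section ConeIntegral

variable {n m p k : ℕ}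

theorem continuous_matFourier {w : Mat p m → ℂ} (hw : Integrable w) :
    Continuous (matFourier w) := by
  unfold matFourier
  have htr (x : Mat p m) : Continuous fun y : Mat p m => (y.transpose * x).trace :=
    (continuous_id.matrix_transpose.matrix_mul continuous_const).matrix_trace
  have htr' (y : Mat p m) : Continuous fun x : Mat p m => (y.transpose * x).trace :=
    (continuous_const.matrix_mul continuous_id).matrix_trace
  refine continuous_of_dominated (bound := fun x => ‖w x‖) (fun y => ?_) (fun y => ?_) hw.norm ?_
  · refine (Continuous.aestronglyMeasurable ?_).mul hw.aestronglyMeasurable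
    exact Complex.continuous_exp.comp
      (continuous_const.mul (Complex.continuous_ofReal.comp (htr' y)))
  · refine Eventually.of_forall fun x => ?_
    rw [norm_mul, mul_comm Complex.I, Complex.norm_exp_ofReal_mul_I, one_mul]
  · refine Eventually.of_forall fun x => ?_
    exact (Complex.continuous_exp.comp
      (continuous_const.mul (Complex.continuous_ofReal.comp (htr x)))).mul continuous_const

theorem norm_matFourier_le (w : Mat p m → ℂ) (y : Mat p m) :
    ‖matFourier w y‖ ≤ ∫ x, ‖w x‖ := by
  refine (norm_integral_le_integral_norm _).trans_eq ?_
  refine integral_congr_ae (Eventually.of_forall fun x => ?_)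
  simp only
  rw [norm_mul, mul_comm Complex.I, Complex.norm_exp_ofReal_mul_I, one_mul]

theorem gram_stdFrame_mul (hmp : m ≤ p) {r : Mat m m} (hr : r.PosSemidef) :
    (stdFrame p m * matSqrt r).transpose * (stdFrame p m * matSqrt r) = r := by
  rw [Matrix.transpose_mul, Matrix.mul_assoc, ← Matrix.mul_assoc _ (stdFrame p m),
    transpose_stdFrame_mul_self hmp, Matrix.one_mul, transpose_matSqrt, matSqrt_mul_self hr]

theorem posDef_matSqrt_mul_mul {r s : Mat m m} (hr : r.PosDef) (hs : s.PosDef) :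
    (matSqrt s * r * matSqrt s).PosDef := by
  simpa only [transpose_matSqrt] using (posDef_congr_iff (r := r) (det_matSqrt_pos hs).ne').2 hr

theorem exists_measurable_profile (hmp : m ≤ p) {G : Mat p m → ℂ} (hG : Measurable G) {B : ℝ}
    (hB : ∀ y, ‖G y‖ ≤ B)
    (hs : ∃ u₀ : Mat m m → ℂ, IsSymmetricOnCone u₀ ∧ ∀ y, G y = u₀ (y.transpose * y)) :
    ∃ w : Mat m m → ℂ, Measurable w ∧ IsSymmetricOnCone w ∧
      (∀ y, G y = w (y.transpose * y)) ∧ ∀ r, ‖w r‖ ≤ B := by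
  obtain ⟨u₀, hsym, hu⟩ := hs
  refine ⟨fun r => G (stdFrame p m * matSqrt r), ?_, ?_, ?_, fun r => hB _⟩
  · exact hG.comp
      ((continuous_const.matrix_mul continuous_id).measurable.comp measurable_matSqrt)
  · intro r s hr hs
    simp only [hu, gram_stdFrame_mul hmp (posDef_matSqrt_mul_mul hr hs).posSemidef,
      gram_stdFrame_mul hmp (posDef_matSqrt_mul_mul hs hr).posSemidef]
    exact hsym r s hr hs
  · intro y
    simp only [hu, gram_stdFrame_mul hmp (posSemidef_transpose_mul_self y)]

theorem integral_comp_measurePreserving {α β : Type*} [MeasurableSpace α] [MeasurableSpace β]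
    {μ : Measure α} {ν : Measure β} {f : α → β} (hf : MeasurePreserving f μ ν)
    {h : β → ℂ} (hh : AEStronglyMeasurable h ν) : ∫ a, h (f a) ∂μ = ∫ b, h b ∂ν := by
  rw [← hf.map_eq] at hh ⊢
  exact (integral_map hf.measurable.aemeasurable hh).symm

theorem integral_gram (hmp : m ≤ p) {h : Mat m m → ℂ} (hh : Measurable h) :
    ∫ z : Mat p m, h (z.transpose * z) =
      (polarConst p m : ℂ) * ∫ r, ((r.det ^ ((p : ℝ) / 2) : ℝ) : ℂ) * h r ∂(coneInvMeasure m) := by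
  rw [← integral_map (φ := fun z : Mat p m => z.transpose * z) (f := h)
    measurable_gram.aemeasurable hh.aestronglyMeasurable, map_gram_volume hmp,
    integral_smul_measure, ENNReal.toReal_ofReal (polarConst_pos hmp).le,
    integral_withDensity_eq_integral_toReal_smul (measurable_ofReal_det_rpow _)
      (Eventually.of_forall fun _ => ENNReal.ofReal_lt_top), Complex.real_smul]
  congr 1
  refine integral_congr_ae ?_
  filter_upwards [ae_coneInvMeasure_posDef] with r hr
  rw [ENNReal.toReal_ofReal (Real.rpow_pos_of_pos hr.det_pos _).le, Complex.real_smul]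

theorem det_rpow_mul_div_sqrt_det_pow (hkn : k ≤ n) {r : Mat m m} (hr : r.PosDef) (z : ℂ) :
    ((r.det ^ (((n - k : ℕ) : ℝ) / 2) : ℝ) : ℂ) * (z / ((Real.sqrt r.det ^ n : ℝ) : ℂ)) =
      ((r.det ^ (-(k : ℝ) / 2) : ℝ) : ℂ) * z := by
  have hsqrt : Real.sqrt r.det ^ n = r.det ^ ((n : ℝ) / 2) := by
    rw [Real.sqrt_eq_rpow, ← Real.rpow_natCast, ← Real.rpow_mul hr.det_pos.le]
    ring_nf
  have hsplit : r.det ^ (((n - k : ℕ) : ℝ) / 2) =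
      r.det ^ (-(k : ℝ) / 2) * r.det ^ ((n : ℝ) / 2) := by
    rw [← Real.rpow_add hr.det_pos, Nat.cast_sub hkn]
    ring_nf
  have hne : ((r.det ^ ((n : ℝ) / 2) : ℝ) : ℂ) ≠ 0 :=
    Complex.ofReal_ne_zero.2 (Real.rpow_pos_of_pos hr.det_pos _).ne'
  rw [hsqrt, hsplit, Complex.ofReal_mul, mul_assoc, mul_div_cancel₀ _ hne]

theorem setIntegral_gram_mem_coneInterval (hmp : m ≤ p) {h : Mat m m → ℂ} (hh : Measurable h)
    (A B : Mat m m) :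
    ∫ z in {z : Mat p m | z.transpose * z ∈ coneInterval A B}, h (z.transpose * z) =
      (polarConst p m : ℂ) *
        ∫ r in coneInterval A B, ((r.det ^ ((p : ℝ) / 2) : ℝ) : ℂ) * h r ∂(coneInvMeasure m) := by
  have hI := measurableSet_coneInterval A B
  have hS : MeasurableSet {z : Mat p m | z.transpose * z ∈ coneInterval A B} :=
    measurable_gram hI
  rw [← integral_indicator hS, ← integral_indicator hI]
  refine (integral_gram hmp (hh.indicator hI)).trans ?_
  simp only [Set.indicator_mul_right]

theorem two_pow_mul_div_stiefelMass_mul (c : ℝ) :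
    2 ^ (m * (k + 1)) * Real.pi ^ (k * m) / stiefelMass n m * c =
      (2 * Real.pi) ^ (k * m) * c / polarConst n m := by
  rw [polarConst_eq_stiefelMass, mul_pow, mul_add, pow_add, mul_one, mul_comm m k,
    div_div_eq_mul_div]
  ring

theorem truncConst_eq (hmp : m ≤ n - k) (hkn : k ≤ n) {G : Mat (n - k) m → ℂ} {g : Mat m m → ℂ}
    (hg : Measurable g) (hG : ∀ y, G y = g (y.transpose * y)) (A B : Mat m m) :
    truncConst n k m G A B =
      (((2 * Real.pi) ^ (k * m) * polarConst (n - k) m / polarConst n m : ℝ) : ℂ) *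
        ∫ r in coneInterval A B, ((r.det ^ (-(k : ℝ) / 2) : ℝ) : ℂ) * g r ∂(coneInvMeasure m) := by
  have hquot : Measurable fun r : Mat m m => g r / ((Real.sqrt r.det ^ n : ℝ) : ℂ) :=
    hg.div (Complex.measurable_ofReal.comp
      ((Real.continuous_sqrt.measurable.comp measurable_det).pow_const n))
  simp only [truncConst, hG, detNorm]
  rw [setIntegral_gram_mem_coneInterval hmp hquot, ← mul_assoc, ← Complex.ofReal_mul,
    two_pow_mul_div_stiefelMass_mul]
  congr 1
  refine integral_congr_ae (ae_restrict_of_ae ?_)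
  filter_upwards [ae_coneInvMeasure_posDef] with r hr using det_rpow_mul_div_sqrt_det_pow hkn hr _

theorem setIntegral_coneInterval_smul {r : Mat m m} (hr : r.PosDef) {h : Mat m m → ℂ}
    (hh : Measurable h) (ε ρ : ℝ) :
    ∫ a in coneInterval (ε • r) (ρ • r), h a ∂(coneInvMeasure m) =
      ∫ a in coneInterval (ε • (1 : Mat m m)) (ρ • (1 : Mat m m)),
        h (matSqrt r * a * matSqrt r) ∂(coneInvMeasure m) := by
  have hdet := (det_matSqrt_pos hr).ne'
  have hI := measurableSet_coneInterval (ε • r) (ρ • r)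
  have hend (c : ℝ) : (matSqrt r).transpose * (c • 1) * matSqrt r = c • r := by
    rw [transpose_matSqrt, Matrix.mul_smul, Matrix.mul_one, Matrix.smul_mul,
      matSqrt_mul_self hr.posSemidef]
  have hpre : (fun a => (matSqrt r).transpose * a * matSqrt r) ⁻¹' coneInterval (ε • r) (ρ • r) =
      coneInterval (ε • (1 : Mat m m)) (ρ • (1 : Mat m m)) := by
    ext a
    rw [Set.mem_preimage, ← hend ε, ← hend ρ, mem_coneInterval_congr_iff hdet]
  rw [← integral_indicator hI, ← integral_indicator (measurableSet_coneInterval _ _), ← hpre]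
  refine (integral_comp_measurePreserving (measurePreserving_congr_coneInvMeasure _ hdet)
    (hh.indicator hI).aestronglyMeasurable).symm.trans ?_
  simp only [transpose_matSqrt]
  rfl

theorem truncConst_smul_eq (hmp : m ≤ n - k) (hkn : k ≤ n) {G : Mat (n - k) m → ℂ}
    {g : Mat m m → ℂ} (hg : Measurable g) (hG : ∀ y, G y = g (y.transpose * y))
    (hsym : IsSymmetricOnCone g) {r : Mat m m} (hr : r.PosDef) (ε ρ : ℝ) :
    truncConst n k m G (ε • r) (ρ • r) =
      (((2 * Real.pi) ^ (k * m) * polarConst (n - k) m / polarConst n m *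
          r.det ^ (-(k : ℝ) / 2) : ℝ) : ℂ) *
        ∫ a in coneInterval (ε • (1 : Mat m m)) (ρ • (1 : Mat m m)),
          ((a.det ^ (-(k : ℝ) / 2) : ℝ) : ℂ) * g (matSqrt a * r * matSqrt a)
          ∂(coneInvMeasure m) := by
  have hweight : Measurable fun a : Mat m m => ((a.det ^ (-(k : ℝ) / 2) : ℝ) : ℂ) * g a :=
    (Complex.measurable_ofReal.comp (measurable_det.pow_const _)).mul hg
  rw [truncConst_eq hmp hkn hg hG, setIntegral_coneInterval_smul hr hweight, Complex.ofReal_mul,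
    mul_assoc]
  congr 1
  rw [← integral_const_mul]
  refine integral_congr_ae (ae_restrict_of_ae ?_)
  filter_upwards [ae_coneInvMeasure_posDef] with a ha
  have hdet : (matSqrt r * a * matSqrt r).det = r.det * a.det := by
    rw [Matrix.det_mul_right_comm, matSqrt_mul_self hr.posSemidef, Matrix.det_mul]
  rw [hdet, Real.mul_rpow hr.det_pos.le ha.det_pos.le, hsym r a hr ha, Complex.ofReal_mul,
    mul_assoc]

end ConeIntegral

/-! ### Fourier multipliers on square integrable functions -/

section Multiplier

open scoped FourierTransform SchwartzMap ContDiff InnerProductSpace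

variable {V : Type*} [NormedAddCommGroup V] [InnerProductSpace ℝ V] [FiniteDimensional ℝ V]
  [MeasurableSpace V] [BorelSpace V]

theorem continuous_fourier {f : V → ℂ} (hf : Integrable f) : Continuous (𝓕 f) :=
  VectorFourier.fourierIntegral_continuous Real.continuous_fourierChar
    (by exact continuous_inner) hf

/-- A smooth compactly supported real function, regarded as a complex Schwartz function. -/
noncomputable def testSchwartz {g : V → ℝ} (hg : ContDiff ℝ ∞ g) (hgc : HasCompactSupport g) :
    𝓢(V, ℂ) :=
  HasCompactSupport.toSchwartzMap (f := fun x => (g x : ℂ))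
    (hgc.comp_left Complex.ofReal_zero) (Complex.ofRealCLM.contDiff.comp hg)

theorem integral_testSchwartz_smul {g : V → ℝ} (hg : ContDiff ℝ ∞ g) (hgc : HasCompactSupport g)
    (F : V → ℂ) : ∫ x, testSchwartz hg hgc x • F x = ∫ x, g x • F x := by
  refine integral_congr_ae (Eventually.of_forall fun x => ?_)
  change ((g x : ℂ)) • F x = g x • F x
  rw [Complex.real_smul, smul_eq_mul]

theorem coeFn_fourier_toLp {f : V → ℂ} (hf : Integrable f) (hf2 : MemLp f 2) :
    (𝓕 (hf2.toLp f) : Lp ℂ 2 (volume : Measure V)) =ᵐ[volume] 𝓕 f := by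
  refine ae_eq_of_integral_contDiff_smul_eq ?_ (continuous_fourier hf).locallyIntegrable ?_
  · exact (Lp.memLp _).locallyIntegrable one_le_two
  intro g hg hgc
  have hdistrib := congrArg (fun T : 𝓢'(V, ℂ) => T (testSchwartz hg hgc))
    (Lp.fourier_toTemperedDistribution_eq (hf2.toLp f))
  simp only [TemperedDistribution.fourier_apply, Lp.toTemperedDistribution_apply] at hdistrib
  have hswap : ∫ x, (𝓕 (testSchwartz hg hgc)) x • f x =
      ∫ x, testSchwartz hg hgc x • (𝓕 f) x := by
    simpa using! VectorFourier.integral_fourierIntegral_smul_eq_flip (L := innerₗ V)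
      (μ := volume) (ν := volume) Real.continuous_fourierChar continuous_inner
      (testSchwartz hg hgc).integrable hf
  rw [← integral_testSchwartz_smul hg hgc, ← integral_testSchwartz_smul hg hgc, ← hdistrib,
    ← hswap]
  refine integral_congr_ae ?_
  filter_upwards [hf2.coeFn_toLp] with x hx
  rw [hx]

theorem memLp_fourier {f : V → ℂ} (hf : Integrable f) (hf2 : MemLp f 2) : MemLp (𝓕 f) 2 :=
  (memLp_congr_ae (coeFn_fourier_toLp hf hf2)).1 (Lp.memLp _)

theorem integral_smul_fourierInv_toLp {φ : V → ℂ} (hφ : MemLp φ 2) {g : V → ℝ}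
    (hg : ContDiff ℝ ∞ g) (hgc : HasCompactSupport g) :
    ∫ x, g x • (𝓕⁻ (hφ.toLp φ) : Lp ℂ 2 (volume : Measure V)) x =
      ∫ Y, 𝓕⁻ (fun x => (g x : ℂ)) Y * φ Y := by
  have hdistrib := congrArg (fun T : 𝓢'(V, ℂ) => T (testSchwartz hg hgc))
    (Lp.fourierInv_toTemperedDistribution_eq (hφ.toLp φ))
  simp only [TemperedDistribution.fourierInv_apply, Lp.toTemperedDistribution_apply] at hdistrib
  have hcoe : ⇑(𝓕⁻ (testSchwartz hg hgc) : 𝓢(V, ℂ)) = 𝓕⁻ (fun x => (g x : ℂ)) :=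
    SchwartzMap.fourierInv_coe _
  rw [← integral_testSchwartz_smul hg hgc, ← hdistrib]
  refine integral_congr_ae ?_
  filter_upwards [hφ.coeFn_toLp] with Y hY
  rw [hY, hcoe, smul_eq_mul]

theorem eLpNorm_sub_const_mul_eq_enorm {g : V → ℂ} (F G : Lp ℂ 2 (volume : Measure V))
    (hg : G =ᵐ[volume] g) (c : ℂ) :
    eLpNorm (fun x => F x - c * g x) 2 volume = ‖F - c • G‖ₑ := by
  rw [Lp.enorm_def]
  refine eLpNorm_congr_ae ?_
  filter_upwards [Lp.coeFn_sub F (c • G), Lp.coeFn_smul c G, hg] with x hsub hsmul hgx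
  rw [hsub, Pi.sub_apply, hsmul, Pi.smul_apply, hgx, smul_eq_mul]

theorem enorm_fourierInv_sub_smul (φ F : Lp ℂ 2 (volume : Measure V)) (c : ℂ) :
    ‖(𝓕⁻ φ - c • F : Lp ℂ 2 (volume : Measure V))‖ₑ =
      ‖(φ - c • 𝓕 F : Lp ℂ 2 (volume : Measure V))‖ₑ := by
  rw [← ofReal_norm, ← ofReal_norm, ← Lp.norm_fourier_eq, sub_eq_add_neg,
    FourierTransform.fourier_add, FourierTransform.fourier_neg,
    FourierTransform.fourier_smul, FourierTransform.fourier_fourierInv_eq, ← sub_eq_add_neg]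

theorem exists_multiplier {f M : V → ℂ} (hf : Integrable f) (hf2 : MemLp f 2)
    (hM : Measurable M) {C : ℝ} (hC : ∀ y, ‖M y‖ ≤ C) :
    ∃ T : V → ℂ, MemLp T 2 ∧
      (∀ g : V → ℝ, ContDiff ℝ ∞ g → HasCompactSupport g →
        ∫ x, g x • T x = ∫ Y, 𝓕⁻ (fun x => (g x : ℂ)) Y * (M Y * 𝓕 f Y)) ∧
      ∀ c : ℂ, eLpNorm (fun x => T x - c * f x) 2 volume =
        eLpNorm (fun Y => (M Y - c) * 𝓕 f Y) 2 volume := by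
  have hφ := memLp_fourier hf hf2
  have hMφ : MemLp (fun Y => M Y * 𝓕 f Y) 2 := by
    refine hφ.of_le_mul (c := C) (hM.aestronglyMeasurable.mul hφ.aestronglyMeasurable)
      (Eventually.of_forall fun Y => ?_)
    rw [norm_mul]
    exact mul_le_mul_of_nonneg_right (hC Y) (norm_nonneg _)
  refine ⟨(𝓕⁻ (hMφ.toLp _) : Lp ℂ 2 (volume : Measure V)), Lp.memLp _,
    fun g hg hgc => integral_smul_fourierInv_toLp hMφ hg hgc, fun c => ?_⟩
  rw [eLpNorm_sub_const_mul_eq_enorm _ _ hf2.coeFn_toLp, enorm_fourierInv_sub_smul,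
    ← eLpNorm_sub_const_mul_eq_enorm _ _ (coeFn_fourier_toLp hf hf2)]
  refine eLpNorm_congr_ae ?_
  filter_upwards [hMφ.coeFn_toLp] with Y hY
  rw [hY, sub_mul]

end Multiplier

/-! ### The Fourier transform on matrices -/

section Transport

open scoped FourierTransform SchwartzMap ContDiff InnerProductSpace

variable {n m p k : ℕ}

/-- Matrices as vectors of a Euclidean space, which carries the norm and the inner product that
Mathlib's Fourier analysis requires. -/
noncomputable def matE (n m : ℕ) : Mat n m ≃L[ℝ] EuclideanSpace ℝ (Fin n × Fin m) :=
  (vecEquiv n m).trans (PiLp.continuousLinearEquiv 2 ℝ (fun _ : Fin n × Fin m => ℝ)).symm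

theorem measurePreserving_matE : MeasurePreserving (matE n m) :=
  (PiLp.volume_preserving_toLp (Fin n × Fin m)).comp volume_preserving_vecEquiv

theorem measurableEmbedding_matE : MeasurableEmbedding (matE n m) :=
  (matE n m).toHomeomorph.measurableEmbedding

theorem measurePreserving_matE_symm : MeasurePreserving (matE n m).symm :=
  measurePreserving_matE.symm (matE n m).toHomeomorph.toMeasurableEquiv

theorem measurableEmbedding_matE_symm : MeasurableEmbedding (matE n m).symm :=
  (matE n m).symm.toHomeomorph.measurableEmbedding

theorem inner_matE (Y x : Mat n m) :
    ⟪matE n m Y, matE n m x⟫_ℝ = (Y.transpose * x).trace := by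
  rw [PiLp.inner_apply, Fintype.sum_prod_type, Finset.sum_comm]
  simp only [Matrix.trace, Matrix.diag, Matrix.mul_apply, Matrix.transpose_apply]
  refine Finset.sum_congr rfl fun j _ => Finset.sum_congr rfl fun i _ => ?_
  change x i j * Y i j = _
  ring

theorem norm_matE_sq (x : Mat n m) : ‖matE n m x‖ ^ 2 = (x.transpose * x).trace := by
  rw [← inner_matE, real_inner_self_eq_norm_sq]

theorem fourierInv_matE (F : Mat n m → ℂ) (Y : Mat n m) :
    𝓕⁻ (F ∘ (matE n m).symm) (matE n m Y) = matFourier F ((2 * Real.pi) • Y) := by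
  rw [Real.fourierInv_eq', matFourier,
    ← measurePreserving_matE.integral_comp measurableEmbedding_matE]
  refine integral_congr_ae (Eventually.of_forall fun x => ?_)
  simp only [Function.comp, ContinuousLinearEquiv.symm_apply_apply, real_inner_comm, inner_matE,
    smul_eq_mul, Matrix.transpose_smul, Matrix.smul_mul, Matrix.trace_smul]
  rw [mul_comm Complex.I]

theorem fourier_matE (F : Mat n m → ℂ) (Y : Mat n m) :
    𝓕 (F ∘ (matE n m).symm) (matE n m Y) = matFourier F (-(2 * Real.pi) • Y) := by
  rw [← neg_neg (matE n m Y), ← Real.fourierInv_eq_fourier_neg, ← map_neg, fourierInv_matE,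
    smul_neg, neg_smul]

/-- Test functions: smooth compactly supported functions of a matrix. Smoothness is expressed in
Euclidean coordinates because `Mat n m` carries no norm. -/
def IsTest (g : Mat n m → ℝ) : Prop :=
  ContDiff ℝ ∞ (g ∘ (matE n m).symm) ∧ HasCompactSupport g

theorem IsTest.hasCompactSupport_comp {g : Mat n m → ℝ} (hg : IsTest g) :
    HasCompactSupport (g ∘ (matE n m).symm) :=
  hg.2.comp_homeomorph (matE n m).symm.toHomeomorph

theorem IsTest.continuous {g : Mat n m → ℝ} (hg : IsTest g) : Continuous g := by
  simpa [Function.comp_assoc] using hg.1.continuous.comp (matE n m).continuous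

theorem isTest_comp_matE {g : EuclideanSpace ℝ (Fin n × Fin m) → ℝ} (hg : ContDiff ℝ ∞ g)
    (hgc : HasCompactSupport g) : IsTest (g ∘ matE n m) :=
  ⟨by simpa [Function.comp_assoc] using hg, hgc.comp_homeomorph (matE n m).toHomeomorph⟩

theorem locallyIntegrable_comp_matE_symm {F : Mat n m → ℂ} (hF : LocallyIntegrable F) :
    LocallyIntegrable (F ∘ (matE n m).symm) := by
  rw [locallyIntegrable_iff] at hF ⊢
  intro K hK
  rw [← measurePreserving_matE_symm.integrableOn_image measurableEmbedding_matE_symm]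
  exact hF _ (hK.image (matE n m).symm.continuous)

theorem ae_eq_of_integral_isTest {F G : Mat n m → ℂ} (hF : LocallyIntegrable F)
    (hG : LocallyIntegrable G)
    (h : ∀ g : Mat n m → ℝ, IsTest g → ∫ x, g x • F x = ∫ x, g x • G x) : F =ᵐ[volume] G := by
  have heq : F ∘ (matE n m).symm =ᵐ[volume] G ∘ (matE n m).symm := by
    refine ae_eq_of_integral_contDiff_smul_eq (locallyIntegrable_comp_matE_symm hF)
      (locallyIntegrable_comp_matE_symm hG) fun g hg hgc => ?_
    rw [← measurePreserving_matE.integral_comp measurableEmbedding_matE,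
      ← measurePreserving_matE.integral_comp measurableEmbedding_matE]
    simpa using h _ (isTest_comp_matE hg hgc)
  simpa [Function.comp_assoc] using measurePreserving_matE.quasiMeasurePreserving.ae_eq_comp heq

theorem memLp_matFourier {f : Mat n m → ℂ} (hf : Integrable f) (hf2 : MemLp f 2) :
    MemLp (fun Y : Mat n m => matFourier f (-(2 * Real.pi) • Y)) 2 := by
  have hs := measurePreserving_matE_symm (n := n) (m := m)
  have hφ := (memLp_fourier ((hs.integrable_comp_emb measurableEmbedding_matE_symm).2 hf)
    (hf2.comp_measurePreserving hs)).comp_measurePreserving measurePreserving_matE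
  exact hφ.ae_eq (Eventually.of_forall (fourier_matE f))

theorem exists_matrix_multiplier {f M : Mat n m → ℂ} (hf : Integrable f) (hf2 : MemLp f 2)
    (hM : Measurable M) {C : ℝ} (hC : ∀ y, ‖M y‖ ≤ C) :
    ∃ T : Mat n m → ℂ, MemLp T 2 ∧
      (∀ g : Mat n m → ℝ, IsTest g →
        ∫ x, g x • T x = ∫ Y : Mat n m,
          matFourier (fun x => (g x : ℂ)) ((2 * Real.pi) • Y) *
            (M Y * matFourier f (-(2 * Real.pi) • Y))) ∧
      ∀ c : ℂ, eLpNorm (fun x => T x - c * f x) 2 volume =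
        eLpNorm (fun Y : Mat n m => (M Y - c) * matFourier f (-(2 * Real.pi) • Y)) 2 volume := by
  have hs := measurePreserving_matE_symm (n := n) (m := m)
  have hfE := (hs.integrable_comp_emb measurableEmbedding_matE_symm).2 hf
  have hfE2 := hf2.comp_measurePreserving hs
  obtain ⟨T, hT, hpair, hnorm⟩ := exists_multiplier hfE hfE2 (hM.comp hs.measurable) (fun y => hC _)
  refine ⟨T ∘ matE n m, hT.comp_measurePreserving measurePreserving_matE, fun g hg => ?_,
    fun c => ?_⟩
  · have hpairg := hpair _ hg.1 hg.hasCompactSupport_comp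
    rw [← measurePreserving_matE.integral_comp measurableEmbedding_matE,
      ← measurePreserving_matE.integral_comp measurableEmbedding_matE] at hpairg
    simp only [Function.comp_apply, ContinuousLinearEquiv.symm_apply_apply, ← fourier_matE,
      ← fourierInv_matE] at hpairg ⊢
    exact hpairg
  · have hmeasT : AEStronglyMeasurable (fun x => T x - c * (f ∘ (matE n m).symm) x) :=
      hT.aestronglyMeasurable.sub (aestronglyMeasurable_const.mul hfE2.aestronglyMeasurable)
    have hmeasM : AEStronglyMeasurable fun Y =>
        ((M ∘ (matE n m).symm) Y - c) * 𝓕 (f ∘ (matE n m).symm) Y :=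
      ((hM.comp hs.measurable).aestronglyMeasurable.sub aestronglyMeasurable_const).mul
        (memLp_fourier hfE hfE2).aestronglyMeasurable
    calc eLpNorm (fun x => (T ∘ matE n m) x - c * f x) 2 volume
        = eLpNorm ((fun x => T x - c * (f ∘ (matE n m).symm) x) ∘ matE n m) 2 volume := rfl
      _ = eLpNorm ((fun Y => ((M ∘ (matE n m).symm) Y - c) * 𝓕 (f ∘ (matE n m).symm) Y) ∘
            matE n m) 2 volume := by
          rw [eLpNorm_comp_measurePreserving hmeasT measurePreserving_matE, hnorm,
            ← eLpNorm_comp_measurePreserving hmeasM measurePreserving_matE]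
      _ = _ := by
          congr 1 with Y
          simp only [Function.comp_apply, ContinuousLinearEquiv.symm_apply_apply, ← fourier_matE]

theorem eq_integral_matFourier {h : Mat p m → ℂ} (hc : Continuous h) (hi : Integrable h)
    (hF : Integrable fun η : Mat p m => matFourier h ((2 * Real.pi) • η)) (τ : Mat p m) :
    h τ = ∫ η : Mat p m, matFourier h ((2 * Real.pi) • η) *
      Complex.exp (-(2 * Real.pi * Complex.I) * ((η.transpose * τ).trace : ℂ)) := by
  have hs := measurePreserving_matE_symm (n := p) (m := m)
  have hhE := (hs.integrable_comp_emb measurableEmbedding_matE_symm).2 hi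
  have hFE : Integrable (𝓕 (h ∘ (matE p m).symm)) := by
    have hFinv : Integrable (𝓕⁻ (h ∘ (matE p m).symm)) := by
      rw [← measurePreserving_matE.integrable_comp_emb measurableEmbedding_matE]
      exact hF.congr (Eventually.of_forall fun η => (fourierInv_matE h η).symm)
    refine hFinv.comp_neg.congr (Eventually.of_forall fun x => ?_)
    simp only [Real.fourierInv_eq_fourier_neg, neg_neg]
  have hinv := congrFun (Continuous.fourier_fourierInv_eq
    (hc.comp (matE p m).symm.continuous) hhE hFE) (matE p m τ)
  rw [Real.fourier_eq', ← measurePreserving_matE.integral_comp measurableEmbedding_matE] at hinv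
  simp only [Function.comp_apply, ContinuousLinearEquiv.symm_apply_apply] at hinv
  rw [← hinv]
  refine integral_congr_ae (Eventually.of_forall fun η => ?_)
  simp only [fourierInv_matE, inner_matE, smul_eq_mul]
  rw [mul_comm]
  congr 2
  push_cast
  ring

theorem IsTest.exists_decay {g : Mat n m → ℝ} (hg : IsTest g) (N : ℕ) :
    ∃ C : ℝ, ∀ Y : Mat n m, ‖matFourier (fun x => (g x : ℂ)) ((2 * Real.pi) • Y)‖ ≤
      C * (1 + ‖matE n m Y‖) ^ (-(N : ℝ)) := by
  set G : 𝓢(EuclideanSpace ℝ (Fin n × Fin m), ℂ) :=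
    𝓕⁻ (testSchwartz hg.1 hg.hasCompactSupport_comp)
  refine ⟨2 ^ N * (Finset.Iic (N, 0)).sup (schwartzSeminormFamily ℝ _ ℂ) G, fun Y => ?_⟩
  have hbound := G.one_add_le_sup_seminorm_apply (𝕜 := ℝ) (m := (N, 0)) (k := N) (n := 0) le_rfl
    le_rfl (matE n m Y)
  have hG : G (matE n m Y) = matFourier (fun x => (g x : ℂ)) ((2 * Real.pi) • Y) := by
    rw [← fourierInv_matE, SchwartzMap.fourierInv_coe]
    rfl
  rw [norm_iteratedFDeriv_zero, hG] at hbound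
  rwa [Real.rpow_neg (by positivity), Real.rpow_natCast, ← div_eq_mul_inv,
    le_div_iff₀ (by positivity), mul_comm]

theorem integrable_decay (p m : ℕ) :
    Integrable fun η : Mat p m => (1 + ‖matE p m η‖) ^ (-((p * m + 1 : ℕ) : ℝ)) := by
  have hdecay := integrable_one_add_norm (E := EuclideanSpace ℝ (Fin p × Fin m)) (μ := volume)
    (r := ((p * m + 1 : ℕ) : ℝ)) (by simp)
  exact (measurePreserving_matE.integrable_comp_emb measurableEmbedding_matE).2 hdecay

end Transport

/-! ### Integration over the fibres of a frame -/

section Fibre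

variable {n m p k : ℕ}

/-- Stacking a `p × m` matrix on top of a `k × m` matrix. -/
noncomputable def stack (h : p + k = n) : Mat p m × Mat k m ≃ᵐ Mat n m :=
  (MeasurableEquiv.sumPiEquivProdPi (fun _ : Fin p ⊕ Fin k => Fin m → ℝ)).symm.trans
    (MeasurableEquiv.piCongrLeft (fun _ : Fin n => Fin m → ℝ)
      (finSumFinEquiv.trans (finCongr h)))

theorem stack_inl (h : p + k = n) (q : Mat p m × Mat k m) (i : Fin p) (j : Fin m) :
    stack h q (finCongr h (Fin.castAdd k i)) j = q.1 i j := by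
  exact congrFun (Equiv.piCongrLeft_apply_apply (fun _ : Fin n => Fin m → ℝ)
    (finSumFinEquiv.trans (finCongr h))
    ((MeasurableEquiv.sumPiEquivProdPi (fun _ : Fin p ⊕ Fin k => Fin m → ℝ)).symm q)
    (Sum.inl i)) j

theorem stack_inr (h : p + k = n) (q : Mat p m × Mat k m) (i : Fin k) (j : Fin m) :
    stack h q (finCongr h (Fin.natAdd p i)) j = q.2 i j := by
  exact congrFun (Equiv.piCongrLeft_apply_apply (fun _ : Fin n => Fin m → ℝ)
    (finSumFinEquiv.trans (finCongr h))
    ((MeasurableEquiv.sumPiEquivProdPi (fun _ : Fin p ⊕ Fin k => Fin m → ℝ)).symm q)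
    (Sum.inr i)) j

theorem measurePreserving_stack (h : p + k = n) :
    MeasurePreserving (stack (m := m) h) (volume.prod volume) volume :=
  (volume_measurePreserving_piCongrLeft (fun _ : Fin n => Fin m → ℝ) _).comp
    (volume_measurePreserving_sumPiEquivProdPi_symm (fun _ : Fin p ⊕ Fin k => Fin m → ℝ))

theorem continuous_stack (h : p + k = n) : Continuous (stack (m := m) h) := by
  refine continuous_pi fun i => continuous_pi fun j => ?_
  obtain ⟨s, rfl⟩ := (finSumFinEquiv.trans (finCongr h)).surjective i
  rcases s with s | s
  · exact (continuous_fst.matrix_elem s j).congr fun q => (stack_inl h q s j).symm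
  · exact (continuous_snd.matrix_elem s j).congr fun q => (stack_inr h q s j).symm

theorem stdFrame_transpose_mul_stack (h : p + k = n) (q : Mat p m × Mat k m) :
    (stdFrame n p).transpose * stack h q = q.1 := by
  ext i j
  rw [Matrix.mul_apply, Finset.sum_eq_single (finCongr h (Fin.castAdd k i)), stack_inl]
  · simp [stdFrame]
  · intro b _ hb
    have hbi : (b : ℕ) ≠ i := fun hbi => hb (Fin.ext (by simpa using hbi))
    simp [stdFrame, hbi]
  · simp

theorem measurableEmbedding_orthGroup_mul (γ : OrthGroup n) :
    MeasurableEmbedding fun z : Mat n m => (γ : Mat n n) * z := by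
  have hcont (A : Mat n n) : Continuous fun z : Mat n m => A * z :=
    continuous_const.matrix_mul continuous_id
  exact (Homeomorph.mk
    { toFun := fun z : Mat n m => (γ : Mat n n) * z
      invFun := fun z => (γ : Mat n n).transpose * z
      left_inv := fun z => by
        simp only [← Matrix.mul_assoc, (Matrix.mem_orthogonalGroup_iff' (Fin n) ℝ).1 γ.2,
          Matrix.one_mul]
      right_inv := fun z => by
        simp only [← Matrix.mul_assoc, (Matrix.mem_orthogonalGroup_iff (Fin n) ℝ).1 γ.2,
          Matrix.one_mul] }
    (hcont _) (hcont _)).measurableEmbedding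

/-- Volume-preserving coordinates `(τ, z)` on the space of `n × m` matrices in which `ξ'x` is the
first component, and which are bounded by the Frobenius norm of `x` in the second component. -/
structure IsFrameCoordinates (ξ : Mat n p) (Θ : Mat p m × Mat k m → Mat n m) : Prop where
  continuous : Continuous Θ
  measurableEmbedding : MeasurableEmbedding Θ
  measurePreserving : MeasurePreserving Θ (volume.prod volume) volume
  transpose_mul : ∀ q, ξ.transpose * Θ q = q.1
  sq_le_trace : ∀ q i j, q.2 i j ^ 2 ≤ ((Θ q).transpose * Θ q).trace

theorem exists_isFrameCoordinates (h : p + k = n) (m : ℕ) {ξ : Mat n p}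
    (hξ : ξ.transpose * ξ = 1) :
    ∃ Θ : Mat p m × Mat k m → Mat n m, IsFrameCoordinates ξ Θ := by
  obtain ⟨γ, rfl⟩ := exists_orthGroup_mul_stdFrame (by omega : p ≤ n) hξ
  have hγ : (γ : Mat n n).transpose * (γ : Mat n n) = 1 :=
    (Matrix.mem_orthogonalGroup_iff' (Fin n) ℝ).1 γ.2
  refine ⟨fun q => (γ : Mat n n) * stack h q, continuous_const.matrix_mul (continuous_stack h),
    (measurableEmbedding_orthGroup_mul γ).comp (stack h).measurableEmbedding,
    (volume_preserving_orthGroup_mul γ).comp (measurePreserving_stack h), fun q => ?_,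
    fun q i j => ?_⟩
  · rw [Matrix.transpose_mul, Matrix.mul_assoc, ← Matrix.mul_assoc _ (γ : Mat n n), hγ,
      Matrix.one_mul, stdFrame_transpose_mul_stack]
  · rw [gram_mul_of_gram_eq_one hγ, ← stack_inr h q i j]
    exact sq_entry_le_trace _ _ _

/-- The closed ball of radius `R` for the Frobenius norm. -/
def frobBall (n m : ℕ) (R : ℝ) : Set (Mat n m) := {x | (x.transpose * x).trace ≤ R ^ 2}

theorem isClosed_frobBall (R : ℝ) : IsClosed (frobBall n m R) :=
  isClosed_le ((continuous_id.matrix_transpose.matrix_mul continuous_id).matrix_trace)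
    continuous_const

theorem exists_subset_frobBall {K : Set (Mat n m)} (hK : IsCompact K) :
    ∃ R : ℝ, 0 ≤ R ∧ K ⊆ frobBall n m R := by
  obtain ⟨C, hC⟩ := (hK.image (f := fun x : Mat n m => (x.transpose * x).trace)
    (continuous_id.matrix_transpose.matrix_mul continuous_id).matrix_trace).bddAbove
  refine ⟨Real.sqrt C, Real.sqrt_nonneg _, fun x hx => ?_⟩
  have htrace : (x.transpose * x).trace ≤ C := hC ⟨x, hx, rfl⟩
  have hC₀ : 0 ≤ C := (norm_matE_sq x ▸ sq_nonneg ‖matE n m x‖).trans htrace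
  rwa [frobBall, Set.mem_ofPred_eq, Real.sq_sqrt hC₀]

theorem IsFrameCoordinates.abs_le {ξ : Mat n p} {Θ : Mat p m × Mat k m → Mat n m}
    (hΘ : IsFrameCoordinates ξ Θ) {R : ℝ} (hR : 0 ≤ R) {q : Mat p m × Mat k m}
    (hq : Θ q ∈ frobBall n m R) (i : Fin k) (j : Fin m) : |q.2 i j| ≤ R :=
  abs_le_of_sq_le_sq ((hΘ.sq_le_trace q i j).trans hq) hR

theorem setLIntegral_frame_le (h : p + k = n) {R : ℝ} (hR : 0 ≤ R) {ξ : Mat n p}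
    (hξ : ξ.transpose * ξ = 1) {F : Mat p m → ℝ≥0∞} (hF : Measurable F) :
    ∫⁻ x in frobBall n m R, F (ξ.transpose * x) ≤
      volume {z : Mat k m | ∀ i j, |z i j| ≤ R} * ∫⁻ τ, F τ := by
  obtain ⟨Θ, hΘ⟩ := exists_isFrameCoordinates h m hξ
  set S := {z : Mat k m | ∀ i j, |z i j| ≤ R}
  have hS : MeasurableSet S := (isCompact_setOf_abs_le R).isClosed.measurableSet
  calc ∫⁻ x in frobBall n m R, F (ξ.transpose * x)
      = ∫⁻ q, (frobBall n m R).indicator (fun x => F (ξ.transpose * x)) (Θ q)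
          ∂((volume : Measure (Mat p m)).prod (volume : Measure (Mat k m))) := by
        rw [← lintegral_indicator (isClosed_frobBall R).measurableSet,
          ← hΘ.measurePreserving.lintegral_comp_emb hΘ.measurableEmbedding]
    _ ≤ ∫⁻ q, F q.1 * S.indicator 1 q.2
          ∂((volume : Measure (Mat p m)).prod (volume : Measure (Mat k m))) := by
        refine lintegral_mono fun q => ?_
        by_cases hq : Θ q ∈ frobBall n m R
        · rw [Set.indicator_of_mem hq, hΘ.transpose_mul,
            Set.indicator_of_mem (show q.2 ∈ S from hΘ.abs_le hR hq), Pi.one_apply, mul_one]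
        · rw [Set.indicator_of_notMem hq]
          exact zero_le
    _ = volume S * ∫⁻ τ, F τ := by
        rw [lintegral_prod_mul hF.aemeasurable (measurable_one.indicator hS).aemeasurable,
          lintegral_indicator_one hS, mul_comm]

theorem norm_matE_frame_mul {ξ : Mat n p} (hξ : ξ.transpose * ξ = 1) (η : Mat p m) :
    ‖matE n m (ξ * η)‖ = ‖matE p m η‖ := by
  rw [← sq_eq_sq₀ (norm_nonneg _) (norm_nonneg _), norm_matE_sq, norm_matE_sq,
    gram_mul_of_gram_eq_one hξ]

theorem IsTest.integrable {g : Mat n m → ℝ} (hg : IsTest g) :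
    Integrable fun x => (g x : ℂ) :=
  (hg.continuous.integrable_of_hasCompactSupport hg.2).ofReal

theorem IsTest.continuous_fourier {g : Mat n m → ℝ} (hg : IsTest g) :
    Continuous fun Y : Mat n m => matFourier (fun x => (g x : ℂ)) ((2 * Real.pi) • Y) :=
  (continuous_matFourier hg.integrable).comp (continuous_const_smul _)

theorem IsTest.integrable_fourier_frame_mul {g : Mat n m → ℝ} (hg : IsTest g) {ξ : Mat n p}
    (hξ : ξ.transpose * ξ = 1) :
    Integrable fun η : Mat p m => matFourier (fun x => (g x : ℂ)) ((2 * Real.pi) • (ξ * η)) := by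
  obtain ⟨C, hC⟩ := hg.exists_decay (p * m + 1)
  refine ((integrable_decay p m).const_mul C).mono' ?_ (Eventually.of_forall fun η => ?_)
  · exact (hg.continuous_fourier.comp
      (continuous_const.matrix_mul continuous_id)).aestronglyMeasurable
  · exact norm_matE_frame_mul hξ η ▸ hC (ξ * η)

theorem cexp_two_pi_eq (r : ℝ) : Complex.exp (-(2 * Real.pi * Complex.I) * (r : ℂ)) =
    Complex.exp (((-(2 * Real.pi * r) : ℝ) : ℂ) * Complex.I) := by
  congr 1
  push_cast
  ring

theorem norm_cexp_two_pi (r : ℝ) :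
    ‖Complex.exp (-(2 * Real.pi * Complex.I) * (r : ℂ))‖ = 1 := by
  rw [cexp_two_pi_eq, Complex.norm_exp_ofReal_mul_I]

theorem continuous_cexp_trace {α : Type*} [TopologicalSpace α] {Y x : α → Mat p m}
    (hY : Continuous Y) (hx : Continuous x) : Continuous fun a =>
      Complex.exp (-(2 * Real.pi * Complex.I) * ((((Y a).transpose * x a).trace : ℝ) : ℂ)) :=
  Complex.continuous_exp.comp (continuous_const.mul (Complex.continuous_ofReal.comp
    (hY.matrix_transpose.matrix_mul hx).matrix_trace))

theorem matFourier_neg_two_pi (w : Mat p m → ℂ) (η : Mat p m) :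
    matFourier w (-(2 * Real.pi) • η) =
      ∫ τ : Mat p m, Complex.exp (-(2 * Real.pi * Complex.I) *
        ((η.transpose * τ).trace : ℂ)) * w τ := by
  unfold matFourier
  refine integral_congr_ae (Eventually.of_forall fun τ => ?_)
  simp only [Matrix.transpose_smul, Matrix.smul_mul, Matrix.trace_smul, smul_eq_mul]
  congr 2
  push_cast
  ring

theorem integral_cexp_mul_sub (w : Mat p m → ℂ) (η t : Mat p m) :
    ∫ τ : Mat p m, Complex.exp (-(2 * Real.pi * Complex.I) *
        ((η.transpose * τ).trace : ℂ)) * w (τ - t) =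
      Complex.exp (-(2 * Real.pi * Complex.I) * ((η.transpose * t).trace : ℂ)) *
        matFourier w (-(2 * Real.pi) • η) := by
  rw [matFourier_neg_two_pi, ← integral_const_mul,
    ← integral_sub_right_eq_self (fun τ : Mat p m => Complex.exp (-(2 * Real.pi * Complex.I) *
        ((η.transpose * t).trace : ℂ)) * (Complex.exp (-(2 * Real.pi * Complex.I) *
        ((η.transpose * τ).trace : ℂ)) * w τ)) t]
  refine integral_congr_ae (Eventually.of_forall fun τ => ?_)
  simp only
  rw [← mul_assoc, ← Complex.exp_add, Matrix.mul_sub, Matrix.trace_sub]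
  congr 2
  push_cast
  ring

/-- The integrals of a function over the fibres of `x ↦ ξ'x`, in frame coordinates for `ξ`. -/
noncomputable def fibreIntegral (Θ : Mat p m × Mat k m → Mat n m) (g : Mat n m → ℝ) (τ : Mat p m) :
    ℂ :=
  ∫ z : Mat k m, (g (Θ (τ, z)) : ℂ)

variable {ξ : Mat n p} {Θ : Mat p m × Mat k m → Mat n m} {g : Mat n m → ℝ}

theorem IsFrameCoordinates.exists_isCompact_fibre (hΘ : IsFrameCoordinates ξ Θ)
    (hg : HasCompactSupport g) :
    ∃ S : Set (Mat k m), IsCompact S ∧ ∀ τ, ∀ z ∉ S, (g (Θ (τ, z)) : ℂ) = 0 := by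
  obtain ⟨R, hR, hsub⟩ := exists_subset_frobBall hg
  refine ⟨{z | ∀ i j, |z i j| ≤ R}, isCompact_setOf_abs_le R, fun τ z hz => ?_⟩
  by_contra hne
  exact hz fun i j => hΘ.abs_le hR (q := (τ, z)) (hsub (subset_tsupport g (by simpa using hne))) i j

theorem IsFrameCoordinates.integrable_comp (hΘ : IsFrameCoordinates ξ Θ) (hg : IsTest g) :
    Integrable (fun q => (g (Θ q) : ℂ))
      ((volume : Measure (Mat p m)).prod (volume : Measure (Mat k m))) :=
  (hΘ.measurePreserving.integrable_comp_emb hΘ.measurableEmbedding).2 hg.integrable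

theorem IsFrameCoordinates.integrable_fibreIntegral (hΘ : IsFrameCoordinates ξ Θ)
    (hg : IsTest g) : Integrable (fibreIntegral Θ g) :=
  (hΘ.integrable_comp hg).integral_prod_left

theorem IsFrameCoordinates.continuous_fibreIntegral (hΘ : IsFrameCoordinates ξ Θ)
    (hg : IsTest g) : Continuous (fibreIntegral Θ g) := by
  obtain ⟨S, hS, hzero⟩ := hΘ.exists_isCompact_fibre hg.2
  have hcont : Continuous (Function.uncurry fun (τ : Mat p m) (z : Mat k m) =>
      (g (Θ (τ, z)) : ℂ)) :=
    Complex.continuous_ofReal.comp (hg.continuous.comp hΘ.continuous)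
  exact (continuous_parametric_integral_of_continuous hcont hS).congr fun τ =>
    setIntegral_eq_integral_of_forall_compl_eq_zero (hzero τ)

theorem IsFrameCoordinates.matFourier_fibreIntegral (hΘ : IsFrameCoordinates ξ Θ)
    (hg : IsTest g) (y : Mat p m) :
    matFourier (fibreIntegral Θ g) y = matFourier (fun x => (g x : ℂ)) (ξ * y) := by
  have hphase (q : Mat p m × Mat k m) :
      ((ξ * y).transpose * Θ q).trace = (y.transpose * q.1).trace := by
    rw [Matrix.transpose_mul, Matrix.mul_assoc, hΘ.transpose_mul]
  unfold matFourier
  rw [← hΘ.measurePreserving.integral_comp hΘ.measurableEmbedding]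
  simp only [hphase]
  rw [integral_prod]
  · simp only [fibreIntegral, integral_const_mul]
  · refine (hΘ.integrable_comp hg).bdd_mul (c := 1) ?_ (Eventually.of_forall fun q => ?_)
    · exact (Complex.continuous_exp.comp (continuous_const.mul (Complex.continuous_ofReal.comp
        (continuous_const.matrix_mul continuous_fst).matrix_trace))).aestronglyMeasurable
    · rw [mul_comm, Complex.norm_exp_ofReal_mul_I]

theorem IsFrameCoordinates.integrable_test_mul (hΘ : IsFrameCoordinates ξ Θ) (hg : IsTest g)
    {w : Mat p m → ℂ} (hw : Integrable w) :
    Integrable (fun q : Mat p m × Mat k m => (g (Θ q) : ℂ) * w q.1) (volume.prod volume) := by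
  obtain ⟨S, hS, hzero⟩ := hΘ.exists_isCompact_fibre hg.2
  obtain ⟨B, hB⟩ := hg.continuous.bounded_above_of_compact_support hg.2
  have hwS : Integrable (fun q : Mat p m × Mat k m => w q.1 * S.indicator (fun _ => (1 : ℂ)) q.2)
      (volume.prod volume) :=
    hw.mul_prod ((integrable_indicator_iff hS.isClosed.measurableSet).2
      (integrableOn_const hS.measure_lt_top.ne))
  refine (hwS.bdd_mul (c := B) (f := fun q => (g (Θ q) : ℂ)) ?_ ?_).congr ?_
  · exact (Complex.continuous_ofReal.comp
      (hg.continuous.comp hΘ.continuous)).aestronglyMeasurable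
  · exact Eventually.of_forall fun q => by simpa using hB (Θ q)
  · refine Eventually.of_forall fun q => ?_
    by_cases hq : q.2 ∈ S
    · simp only [Set.indicator_of_mem hq, mul_one]
    · simp only [Set.indicator_of_notMem hq, mul_zero, hzero q.1 q.2 hq, zero_mul]

theorem IsFrameCoordinates.integral_test_mul (hΘ : IsFrameCoordinates ξ Θ) (hg : IsTest g)
    {w : Mat p m → ℂ} (hw : Integrable w) :
    ∫ x : Mat n m, (g x : ℂ) * w (ξ.transpose * x) = ∫ τ, fibreIntegral Θ g τ * w τ := by
  rw [← hΘ.measurePreserving.integral_comp hΘ.measurableEmbedding]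
  simp only [hΘ.transpose_mul]
  rw [integral_prod _ (hΘ.integrable_test_mul hg hw)]
  simp only [fibreIntegral, integral_mul_const]

theorem integral_test_mul_frame (h : p + k = n) (hg : IsTest g) {v : Mat p m → ℂ}
    (hv : Integrable v) (hξ : ξ.transpose * ξ = 1) (t : Mat p m) :
    ∫ x : Mat n m, (g x : ℂ) * v (ξ.transpose * x - t) =
      ∫ η : Mat p m, matFourier (fun x => (g x : ℂ)) ((2 * Real.pi) • (ξ * η)) *
        (Complex.exp (-(2 * Real.pi * Complex.I) * ((η.transpose * t).trace : ℂ)) *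
          matFourier v (-(2 * Real.pi) • η)) := by
  obtain ⟨Θ, hΘ⟩ := exists_isFrameCoordinates h m hξ
  have hfib (η : Mat p m) : matFourier (fibreIntegral Θ g) ((2 * Real.pi) • η) =
      matFourier (fun x => (g x : ℂ)) ((2 * Real.pi) • (ξ * η)) := by
    rw [hΘ.matFourier_fibreIntegral hg, Matrix.mul_smul]
  have hFi := hg.integrable_fourier_frame_mul hξ (m := m)
  have hvt : Integrable fun τ : Mat p m => v (τ - t) := hv.comp_sub_right t
  have hswap : Integrable (Function.uncurry fun τ η : Mat p m =>
      matFourier (fun x => (g x : ℂ)) ((2 * Real.pi) • (ξ * η)) *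
        (Complex.exp (-(2 * Real.pi * Complex.I) * ((η.transpose * τ).trace : ℂ)) * v (τ - t)))
      (volume.prod volume) := by
    refine ((hvt.mul_prod hFi).mul_bdd (c := 1) (g := fun q : Mat p m × Mat p m =>
      Complex.exp (-(2 * Real.pi * Complex.I) * ((q.2.transpose * q.1).trace : ℂ)))
      (continuous_cexp_trace continuous_snd continuous_fst).aestronglyMeasurable
      (Eventually.of_forall fun q => (norm_cexp_two_pi _).le)).congr
      (Eventually.of_forall fun q => ?_)
    simp only [Function.uncurry]
    ring
  calc ∫ x : Mat n m, (g x : ℂ) * v (ξ.transpose * x - t)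
      = ∫ τ : Mat p m, fibreIntegral Θ g τ * v (τ - t) := hΘ.integral_test_mul hg hvt
    _ = ∫ τ : Mat p m, ∫ η : Mat p m,
          matFourier (fun x => (g x : ℂ)) ((2 * Real.pi) • (ξ * η)) *
            (Complex.exp (-(2 * Real.pi * Complex.I) * ((η.transpose * τ).trace : ℂ)) *
              v (τ - t)) := by
        refine integral_congr_ae (Eventually.of_forall fun τ => ?_)
        simp only [eq_integral_matFourier (hΘ.continuous_fibreIntegral hg)
          (hΘ.integrable_fibreIntegral hg) (by simpa only [hfib] using hFi) τ,
          ← integral_mul_const, hfib, mul_assoc]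
    _ = _ := by
        rw [integral_integral_swap hswap]
        simp only [integral_const_mul, integral_cexp_mul_sub]

end Fibre

/-! ### Scaled wavelets and convolutions -/

section Scaled

variable {n m p k : ℕ}

theorem measurable_stiefel_transpose_mul {α : Type*} [MeasurableSpace α]
    {g : α → Stiefel n (n - k)} {f : α → Mat n m} (hg : Measurable g) (hf : Measurable f) :
    Measurable fun a => (g a).1.transpose * f a := by
  have hcont : Continuous fun q : Stiefel n (n - k) × Mat n m => q.1.1.transpose * q.2 :=
    (continuous_subtype_val.comp continuous_fst).matrix_transpose.matrix_mul continuous_snd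
  have hcomp := hcont.measurable.comp (hg.prodMk hf)
  exact hcomp

theorem measurable_matrix_mul {α : Type*} [MeasurableSpace α] {f : α → Mat p m}
    {g : α → Mat m k} (hf : Measurable f) (hg : Measurable g) :
    Measurable fun a => f a * g a := by
  have hcont : Continuous fun q : Mat p m × Mat m k => q.1 * q.2 :=
    continuous_fst.matrix_mul continuous_snd
  have hcomp := hcont.measurable.comp (hf.prodMk hg)
  exact hcomp

theorem measurable_scaled {w : Mat p m → ℂ} (hw : Measurable w) {α : Type*}
    [MeasurableSpace α] {a : α → Mat m m} {z : α → Mat p m} (ha : Measurable a)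
    (hz : Measurable z) : Measurable fun b => scaled w (a b) (z b) := by
  have hdet : Measurable fun b => (a b).det := measurable_det.comp ha
  have hinv : Measurable fun b => (matSqrt (a b))⁻¹ :=
    measurable_matInv.comp (measurable_matSqrt.comp ha)
  exact (Complex.measurable_ofReal.comp (hdet.pow_const _)).mul
    (hw.comp (measurable_matrix_mul hz hinv))

theorem isUnit_det_matSqrt {a : Mat m m} (ha : a.PosDef) : IsUnit (matSqrt a).det :=
  isUnit_iff_ne_zero.2 (det_matSqrt_pos ha).ne'

theorem scaled_mul_matSqrt (w : Mat p m → ℂ) {a : Mat m m} (ha : a.PosDef) (z : Mat p m) :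
    scaled w a (z * matSqrt a) = ((a.det ^ (-(p : ℝ) / 2) : ℝ) : ℂ) * w z := by
  rw [scaled, Matrix.mul_assoc, Matrix.mul_nonsing_inv _ (isUnit_det_matSqrt ha), Matrix.mul_one]

theorem abs_det_matSqrt_pow {a : Mat m m} (ha : a.PosDef) :
    |(matSqrt a).det| ^ p = a.det ^ ((p : ℝ) / 2) := by
  rw [abs_of_pos (det_matSqrt_pos ha), ← det_matSqrt_sq ha, ← Real.rpow_natCast,
    ← Real.rpow_natCast, ← Real.rpow_mul (det_matSqrt_pos ha).le]
  congr 1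
  push_cast
  ring

theorem measurableEmbedding_mul_right {g : Mat m m} (hg : IsUnit g.det) :
    MeasurableEmbedding fun z : Mat p m => z * g := by
  have hcont (A : Mat m m) : Continuous fun z : Mat p m => z * A :=
    continuous_id.matrix_mul continuous_const
  exact (Homeomorph.mk
    { toFun := fun z : Mat p m => z * g
      invFun := fun z => z * g⁻¹
      left_inv := fun z => by
        simp only [Matrix.mul_assoc, Matrix.mul_nonsing_inv _ hg, Matrix.mul_one]
      right_inv := fun z => by
        simp only [Matrix.mul_assoc, Matrix.nonsing_inv_mul _ hg, Matrix.mul_one] }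
    (hcont _) (hcont _)).measurableEmbedding

theorem integral_mul_right {g : Mat m m} (hg : g.det ≠ 0) (F : Mat p m → ℂ) :
    ∫ z : Mat p m, F (z * g) = (((|g.det| ^ p)⁻¹ : ℝ) : ℂ) * ∫ z, F z := by
  rw [← (measurableEmbedding_mul_right (isUnit_iff_ne_zero.2 hg)).integral_map,
    map_mul_right_volume g hg, integral_smul_measure, ENNReal.toReal_ofReal (by positivity),
    Complex.real_smul]

theorem lintegral_enorm_scaled {w : Mat p m → ℂ} (hw : Measurable w) {a : Mat m m}
    (ha : a.PosDef) : ∫⁻ z, ‖scaled w a z‖ₑ = ∫⁻ z, ‖w z‖ₑ := by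
  have hs := det_matSqrt_pos ha
  have hd : 0 < |(matSqrt a).det| ^ p := pow_pos (abs_pos.2 hs.ne') p
  have hpoint (z : Mat p m) : ‖scaled w a (z * matSqrt a)‖ₑ =
      ENNReal.ofReal ((|(matSqrt a).det| ^ p)⁻¹) * ‖w z‖ₑ := by
    rw [scaled_mul_matSqrt w ha, enorm_mul, abs_det_matSqrt_pow ha, ← Real.rpow_neg ha.det_pos.le,
      neg_div, ← ofReal_norm, Complex.norm_real,
      Real.norm_of_nonneg (Real.rpow_nonneg ha.det_pos.le _)]
  have hscaled : Measurable fun z : Mat p m => ‖scaled w a z‖ₑ :=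
    (measurable_scaled hw measurable_const measurable_id).enorm
  have hsubst := lintegral_mul_right (matSqrt a) hs.ne' hscaled
  rw [lintegral_congr hpoint, lintegral_const_mul _ hw.enorm] at hsubst
  exact ((ENNReal.mul_right_inj (by simpa using hd) ENNReal.ofReal_ne_top).1 hsubst).symm

theorem integrable_scaled {w : Mat p m → ℂ} (hw : Measurable w) (hwi : Integrable w)
    {a : Mat m m} (ha : a.PosDef) : Integrable (scaled w a) := by
  refine ⟨(measurable_scaled hw measurable_const measurable_id).aestronglyMeasurable, ?_⟩
  rw [HasFiniteIntegral, lintegral_enorm_scaled hw ha]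
  exact hwi.2

theorem matFourier_scaled (w : Mat p m → ℂ) {a : Mat m m} (ha : a.PosDef) (y : Mat p m) :
    matFourier (scaled w a) y = matFourier w (y * matSqrt a) := by
  have hd : 0 < a.det ^ ((p : ℝ) / 2) := Real.rpow_pos_of_pos ha.det_pos _
  have hsubst := integral_mul_right (det_matSqrt_pos ha).ne' (fun x : Mat p m =>
    Complex.exp (Complex.I * ((y.transpose * x).trace : ℂ)) * scaled w a x)
  rw [abs_det_matSqrt_pow ha] at hsubst
  have hscaled : ∫ z : Mat p m, Complex.exp (Complex.I *
        ((y.transpose * (z * matSqrt a)).trace : ℂ)) * scaled w a (z * matSqrt a) =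
      (((a.det ^ ((p : ℝ) / 2))⁻¹ : ℝ) : ℂ) * matFourier w (y * matSqrt a) := by
    rw [matFourier, ← integral_const_mul]
    refine integral_congr_ae (Eventually.of_forall fun z => ?_)
    simp only
    rw [scaled_mul_matSqrt w ha, Matrix.transpose_mul, transpose_matSqrt,
      ← Matrix.mul_assoc, Matrix.trace_mul_comm, ← Matrix.mul_assoc, neg_div,
      Real.rpow_neg ha.det_pos.le]
    ring
  exact mul_left_cancel₀ (by simpa using hd.ne') (hsubst.symm.trans hscaled)

theorem matFourier_conv {u v : Mat p m → ℂ} (hu : Integrable u) (hv : Integrable v)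
    (y : Mat p m) : matFourier (conv u v) y = matFourier u y * matFourier v y := by
  have hs := measurePreserving_matE_symm (n := p) (m := m)
  have hy : -(2 * Real.pi) • (-(2 * Real.pi)⁻¹) • y = y := by
    rw [smul_smul, neg_mul_neg, mul_inv_cancel₀ (by positivity), one_smul]
  have hconv : convolution (u ∘ (matE p m).symm) (v ∘ (matE p m).symm)
      (ContinuousLinearMap.mul ℂ ℂ) volume = conv u v ∘ (matE p m).symm := by
    ext x
    rw [Function.comp, conv, convolution, convolution,
      ← measurePreserving_matE.integral_comp measurableEmbedding_matE]
    simp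
  have hmul := Real.fourier_mul_convolution_eq
    ((hs.integrable_comp_emb measurableEmbedding_matE_symm).2 hu)
    ((hs.integrable_comp_emb measurableEmbedding_matE_symm).2 hv)
    (matE p m ((-(2 * Real.pi)⁻¹) • y))
  rwa [hconv, fourier_matE, fourier_matE, fourier_matE, hy] at hmul

theorem quasiMeasurePreserving_sub_left_mul (t : Mat p m) {g : Mat m m} (hg : IsUnit g.det) :
    Measure.QuasiMeasurePreserving (fun z : Mat p m => (t - z) * g) := by
  have hmul : Measure.QuasiMeasurePreserving (fun z : Mat p m => z * g) := by
    refine ⟨(measurableEmbedding_mul_right hg).measurable, ?_⟩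
    rw [map_mul_right_volume g (isUnit_iff_ne_zero.1 hg)]
    exact Measure.smul_absolutelyContinuous
  exact hmul.comp (Measure.measurePreserving_sub_left volume t).quasiMeasurePreserving

theorem quasiMeasurePreserving_frame_mul (h : p + k = n) {ξ : Mat n p}
    (hξ : ξ.transpose * ξ = 1) :
    Measure.QuasiMeasurePreserving (fun y : Mat n m => ξ.transpose * y) := by
  have hmeas : Measurable fun y : Mat n m => ξ.transpose * y :=
    (continuous_const.matrix_mul continuous_id).measurable
  refine ⟨hmeas, Measure.AbsolutelyContinuous.mk fun s hs hs0 => ?_⟩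
  obtain ⟨Θ, hΘ⟩ := exists_isFrameCoordinates h m hξ
  have hpre : Θ ⁻¹' ((fun y : Mat n m => ξ.transpose * y) ⁻¹' s) = s ×ˢ Set.univ := by
    ext q
    simp [hΘ.transpose_mul]
  rw [Measure.map_apply hmeas hs,
    ← hΘ.measurePreserving.measure_preimage (hmeas hs).nullMeasurableSet, hpre,
    Measure.prod_prod, hs0, zero_mul]

theorem ridgelet_congr (hkn : k ≤ n) {u u' : Mat (n - k) m → ℂ} {f f' : Mat n m → ℂ}
    (hu : u =ᵐ[volume] u') (hf : f =ᵐ[volume] f') {a : Mat m m} (ha : a.PosDef)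
    (ξ : Stiefel n (n - k)) (t : Mat (n - k) m) : ridgelet u a f ξ t = ridgelet u' a f' ξ t := by
  have hcomp := ((quasiMeasurePreserving_sub_left_mul t
    (Matrix.isUnit_nonsing_inv_det _ (isUnit_det_matSqrt ha))).comp
    (quasiMeasurePreserving_frame_mul (m := m) (Nat.sub_add_cancel hkn) ξ.2)).ae_eq_comp hu
  refine integral_congr_ae ?_
  filter_upwards [hcomp, hf] with y hy hy'
  simp only [Function.comp] at hy
  rw [hy', scaled, scaled, hy]

theorem reproIntegrand_congr (hkn : k ≤ n) {u u' v v' : Mat (n - k) m → ℂ} {f f' : Mat n m → ℂ}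
    (hu : u =ᵐ[volume] u') (hv : v =ᵐ[volume] v') (hf : f =ᵐ[volume] f') (x : Mat n m)
    {a : Mat m m} (ha : a.PosDef) : reproIntegrand u v f x a = reproIntegrand u' v' f' x a := by
  unfold reproIntegrand dualRidgelet
  congr 1
  refine integral_congr_ae (Eventually.of_forall fun ξ => integral_congr_ae ?_)
  have hcomp := (quasiMeasurePreserving_sub_left_mul (ξ.1.transpose * x)
    (Matrix.isUnit_nonsing_inv_det _ (isUnit_det_matSqrt ha))).ae_eq_comp hv
  filter_upwards [hcomp] with t ht
  simp only [Function.comp] at ht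
  rw [ridgelet_congr hkn hu hf ha, scaled, scaled, ht]

end Scaled

/-! ### The composed ridgelet transform at a fixed scale -/

section FixedScale

variable {n m k : ℕ}

/-- The parameters `(ξ, t, y)` of `ridgeletKernel`: a frame, an offset and a point. -/
abbrev KernelParam (n m k : ℕ) := Stiefel n (n - k) × (Mat (n - k) m × Mat n m)

/-- The integrand of the composition of the ridgelet transform and its dual, at `q = (ξ, t, y)`. -/
noncomputable def ridgeletKernel (u v : Mat (n - k) m → ℂ) (f : Mat n m → ℂ) (a : Mat m m)
    (x : Mat n m) (q : KernelParam n m k) : ℂ :=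
  f q.2.2 * scaled u a (q.2.1 - q.1.1.transpose * q.2.2) *
    scaled v a (q.1.1.transpose * x - q.2.1)

/-- The measure on the parameters of `ridgeletKernel`. -/
noncomputable abbrev kernelMeasure (n m k : ℕ) : Measure (KernelParam n m k) :=
  (stiefelMeasure n k).prod (volume.prod volume)

variable {u v : Mat (n - k) m → ℂ} {f : Mat n m → ℂ} {g : Mat n m → ℝ}

theorem measurable_scaled_sub_stiefel_mul (hu : Measurable u) {α : Type*} [MeasurableSpace α]
    {a : α → Mat m m} {q : α → KernelParam n m k}
    (ha : Measurable a) (hq : Measurable q) :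
    Measurable fun b => scaled u (a b) ((q b).2.1 - (q b).1.1.transpose * (q b).2.2) :=
  measurable_scaled hu ha (hq.snd.fst.sub (measurable_stiefel_transpose_mul hq.fst hq.snd.snd))

theorem measurable_ridgeletKernel (hu : Measurable u) (hv : Measurable v) (hf : Measurable f)
    {α : Type*} [MeasurableSpace α] {a : α → Mat m m} {x : α → Mat n m}
    {q : α → KernelParam n m k} (ha : Measurable a)
    (hx : Measurable x) (hq : Measurable q) :
    Measurable fun b => ridgeletKernel u v f (a b) (x b) (q b) :=
  ((hf.comp hq.snd.snd).mul (measurable_scaled_sub_stiefel_mul hu ha hq)).mul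
    (measurable_scaled hv ha ((measurable_stiefel_transpose_mul hq.fst hx).sub hq.snd.fst))

theorem lintegral_enorm_mul_comp_sub {p : ℕ} {U : Mat p m → ℂ} (hU : Measurable U)
    (hf : Measurable f) (ξ : Mat n p) :
    ∫⁻ z : Mat p m × Mat n m, ‖f z.2 * U (z.1 - ξ.transpose * z.2)‖ₑ =
      (∫⁻ y, ‖f y‖ₑ) * ∫⁻ t, ‖U t‖ₑ := by
  have hsub : Measurable fun z : Mat p m × Mat n m => z.1 - ξ.transpose * z.2 :=
    (continuous_fst.sub (continuous_const.matrix_mul continuous_snd)).measurable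
  have hmeas : Measurable fun z : Mat p m × Mat n m => ‖f z.2 * U (z.1 - ξ.transpose * z.2)‖ₑ :=
    ((hf.comp measurable_snd).mul (hU.comp hsub)).enorm
  rw [Measure.volume_eq_prod, lintegral_prod_symm _ hmeas.aemeasurable,
    ← lintegral_mul_const _ hf.enorm]
  refine lintegral_congr fun y => ?_
  simp only [enorm_mul]
  rw [lintegral_const_mul' _ _ enorm_ne_top, lintegral_sub_right_eq_self (fun t => ‖U t‖ₑ)]

theorem integrable_mul_comp_sub {p : ℕ} {U : Mat p m → ℂ} (hU : Measurable U)
    (hf : Measurable f) (hUi : Integrable U) (hfi : Integrable f) (ξ : Mat n p) :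
    Integrable (fun z : Mat p m × Mat n m => f z.2 * U (z.1 - ξ.transpose * z.2)) := by
  have hsub : Measurable fun z : Mat p m × Mat n m => z.1 - ξ.transpose * z.2 :=
    (continuous_fst.sub (continuous_const.matrix_mul continuous_snd)).measurable
  refine ⟨((hf.comp measurable_snd).mul (hU.comp hsub)).aestronglyMeasurable, ?_⟩
  rw [HasFiniteIntegral, lintegral_enorm_mul_comp_sub hU hf]
  exact ENNReal.mul_lt_top hfi.2 hUi.2

theorem lintegral_kernelMeasure_enorm_mul_scaled (hu : Measurable u) (hf : Measurable f)
    {a : Mat m m} (ha : a.PosDef) :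
    ∫⁻ q, ‖f q.2.2 * scaled u a (q.2.1 - q.1.1.transpose * q.2.2)‖ₑ ∂(kernelMeasure n m k) =
      (∫⁻ y, ‖f y‖ₑ) * ∫⁻ z, ‖u z‖ₑ := by
  have hmeas : Measurable fun q : KernelParam n m k =>
      ‖f q.2.2 * scaled u a (q.2.1 - q.1.1.transpose * q.2.2)‖ₑ :=
    ((hf.comp measurable_snd.snd).mul
      (measurable_scaled_sub_stiefel_mul hu measurable_const measurable_id)).enorm
  rw [lintegral_prod _ hmeas.aemeasurable]
  have hξ (ξ : Stiefel n (n - k)) := lintegral_enorm_mul_comp_sub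
    (measurable_scaled hu measurable_const measurable_id : Measurable (scaled u a)) hf ξ.1
  simp only [Measure.volume_eq_prod, lintegral_enorm_scaled hu ha] at hξ
  simp only [hξ, lintegral_const, measure_univ, mul_one]

theorem setLIntegral_enorm_scaled_frame_le (hkn : k ≤ n) (hv : Measurable v) {R : ℝ}
    (hR : 0 ≤ R) {a : Mat m m} (ha : a.PosDef) (ξ : Stiefel n (n - k)) (t : Mat (n - k) m) :
    ∫⁻ x in frobBall n m R, ‖scaled v a (ξ.1.transpose * x - t)‖ₑ ≤
      volume {z : Mat k m | ∀ i j, |z i j| ≤ R} * ∫⁻ z, ‖v z‖ₑ := by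
  have hvs : Measurable (scaled v a) := measurable_scaled hv measurable_const measurable_id
  refine (setLIntegral_frame_le (Nat.sub_add_cancel hkn) hR ξ.2
    (F := fun τ => ‖scaled v a (τ - t)‖ₑ) (hvs.comp (measurable_id.sub_const t)).enorm).trans_eq ?_
  rw [lintegral_sub_right_eq_self (fun τ => ‖scaled v a τ‖ₑ) t, lintegral_enorm_scaled hv ha]

theorem setLIntegral_ridgeletKernel_le (hkn : k ≤ n) (hu : Measurable u) (hv : Measurable v)
    (hf : Measurable f) {R : ℝ} (hR : 0 ≤ R) {a : Mat m m} (ha : a.PosDef) :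
    ∫⁻ x in frobBall n m R, (∫⁻ q, ‖ridgeletKernel u v f a x q‖ₑ ∂(kernelMeasure n m k)) ≤
      (volume {z : Mat k m | ∀ i j, |z i j| ≤ R} * ∫⁻ z, ‖v z‖ₑ) *
        ((∫⁻ y, ‖f y‖ₑ) * ∫⁻ z, ‖u z‖ₑ) := by
  have hK : Measurable fun z : Mat n m × KernelParam n m k =>
      ‖ridgeletKernel u v f a z.1 z.2‖ₑ :=
    (measurable_ridgeletKernel hu hv hf measurable_const measurable_fst measurable_snd).enorm
  have hvx (q : KernelParam n m k) :
      Measurable fun x : Mat n m => ‖scaled v a (q.1.1.transpose * x - q.2.1)‖ₑ :=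
    (measurable_scaled hv measurable_const
      ((measurable_stiefel_transpose_mul measurable_const measurable_id).sub_const _)).enorm
  have hmeas : Measurable fun q : KernelParam n m k =>
      ‖f q.2.2 * scaled u a (q.2.1 - q.1.1.transpose * q.2.2)‖ₑ :=
    ((hf.comp measurable_snd.snd).mul
      (measurable_scaled_sub_stiefel_mul hu measurable_const measurable_id)).enorm
  rw [lintegral_lintegral_swap hK.aemeasurable, ← lintegral_kernelMeasure_enorm_mul_scaled hu hf ha,
    mul_comm, ← lintegral_mul_const _ hmeas]
  refine lintegral_mono fun q => ?_
  simp only [ridgeletKernel, enorm_mul _ (scaled v a _)]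
  rw [lintegral_const_mul _ (hvx q)]
  gcongr
  exact setLIntegral_enorm_scaled_frame_le hkn hv hR ha q.1 q.2.1

theorem IsTest.exists_lintegral_enorm_mul_le (hg : IsTest g) :
    ∃ R : ℝ, 0 ≤ R ∧ ∃ B : ℝ, ∀ G : Mat n m → ℝ≥0∞,
      ∫⁻ x, ‖(g x : ℂ)‖ₑ * G x ≤ ENNReal.ofReal B * ∫⁻ x in frobBall n m R, G x := by
  obtain ⟨R, hR, hsub⟩ := exists_subset_frobBall hg.2
  obtain ⟨B, hB⟩ := hg.continuous.bounded_above_of_compact_support hg.2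
  refine ⟨R, hR, B, fun G => ?_⟩
  rw [← lintegral_const_mul' _ _ ENNReal.ofReal_ne_top,
    ← lintegral_indicator (isClosed_frobBall R).measurableSet]
  refine lintegral_mono fun x => ?_
  by_cases hx : x ∈ frobBall n m R
  · rw [Set.indicator_of_mem hx]
    gcongr
    rw [← ofReal_norm, Complex.norm_real]
    exact ENNReal.ofReal_le_ofReal (hB x)
  · rw [image_eq_zero_of_notMem_tsupport fun h => hx (hsub h)]
    simp

theorem integrable_test_mul_ridgeletKernel (hkn : k ≤ n) (hu : Measurable u) (hv : Measurable v)
    (hf : Measurable f) (hui : Integrable u) (hvi : Integrable v) (hfi : Integrable f)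
    (hg : IsTest g) {a : Mat m m} (ha : a.PosDef) :
    Integrable (fun z : KernelParam n m k × Mat n m =>
      (g z.2 : ℂ) * ridgeletKernel u v f a z.2 z.1) ((kernelMeasure n m k).prod volume) := by
  obtain ⟨R, hR, B, hB⟩ := hg.exists_lintegral_enorm_mul_le
  have hgm : Measurable fun x => (g x : ℂ) :=
    Complex.measurable_ofReal.comp hg.continuous.measurable
  have hmeas : Measurable fun z : KernelParam n m k × Mat n m =>
      (g z.2 : ℂ) * ridgeletKernel u v f a z.2 z.1 :=
    (hgm.comp measurable_snd).mul
      (measurable_ridgeletKernel hu hv hf measurable_const measurable_snd measurable_fst)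
  have hK (x : Mat n m) : Measurable fun q => ‖ridgeletKernel u v f a x q‖ₑ :=
    (measurable_ridgeletKernel hu hv hf measurable_const measurable_const measurable_id).enorm
  refine ⟨hmeas.aestronglyMeasurable, ?_⟩
  rw [HasFiniteIntegral, lintegral_prod_symm _ hmeas.enorm.aemeasurable]
  simp only [enorm_mul (g _ : ℂ)]
  simp only [lintegral_const_mul _ (hK _)]
  refine ((hB _).trans (mul_le_mul_right
    (setLIntegral_ridgeletKernel_le hkn hu hv hf hR ha) _)).trans_lt ?_
  exact ENNReal.mul_lt_top ENNReal.ofReal_lt_top (ENNReal.mul_lt_top (ENNReal.mul_lt_top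
    (isCompact_setOf_abs_le R).measure_lt_top hvi.2) (ENNReal.mul_lt_top hfi.2 hui.2))

theorem integral_cexp_mul_frame {p : ℕ} {U : Mat p m → ℂ} (ξ : Mat n p) (η : Mat p m) :
    ∫ y : Mat n m, ∫ t : Mat p m, f y * U (t - ξ.transpose * y) *
      Complex.exp (-(2 * Real.pi * Complex.I) * ((η.transpose * t).trace : ℂ)) =
    matFourier U (-(2 * Real.pi) • η) * matFourier f (-(2 * Real.pi) • (ξ * η)) := by
  rw [matFourier_neg_two_pi f, ← integral_const_mul]
  refine integral_congr_ae (Eventually.of_forall fun y => ?_)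
  simp only
  calc ∫ t : Mat p m, f y * U (t - ξ.transpose * y) *
        Complex.exp (-(2 * Real.pi * Complex.I) * ((η.transpose * t).trace : ℂ))
      = f y * ∫ t : Mat p m, Complex.exp (-(2 * Real.pi * Complex.I) *
          ((η.transpose * t).trace : ℂ)) * U (t - ξ.transpose * y) := by
        rw [← integral_const_mul]
        refine integral_congr_ae (Eventually.of_forall fun t => ?_)
        simp only
        ring
    _ = _ := by
        rw [integral_cexp_mul_sub U η (ξ.transpose * y), Matrix.transpose_mul, Matrix.mul_assoc]
        ring

theorem integrable_fourier_pairing {p : ℕ} {U V : Mat p m → ℂ}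
    (hU : Measurable U) (hf : Measurable f) (hUi : Integrable U) (hVi : Integrable V)
    (hfi : Integrable f) (hg : IsTest g) {ξ : Mat n p} (hξ : ξ.transpose * ξ = 1) :
    Integrable (fun z : (Mat p m × Mat n m) × Mat p m =>
      f z.1.2 * U (z.1.1 - ξ.transpose * z.1.2) *
        (matFourier (fun x => (g x : ℂ)) ((2 * Real.pi) • (ξ * z.2)) *
          (Complex.exp (-(2 * Real.pi * Complex.I) * ((z.2.transpose * z.1.1).trace : ℂ)) *
            matFourier V (-(2 * Real.pi) • z.2)))) := by
  have hexp : Continuous fun z : (Mat p m × Mat n m) × Mat p m =>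
      Complex.exp (-(2 * Real.pi * Complex.I) * ((z.2.transpose * z.1.1).trace : ℂ)) :=
    continuous_cexp_trace continuous_snd (continuous_fst.comp continuous_fst)
  have hV : Continuous fun z : (Mat p m × Mat n m) × Mat p m =>
      matFourier V (-(2 * Real.pi) • z.2) :=
    (continuous_matFourier hVi).comp ((continuous_const_smul _).comp continuous_snd)
  have hbdd : Integrable (fun z : (Mat p m × Mat n m) × Mat p m =>
      f z.1.2 * U (z.1.1 - ξ.transpose * z.1.2) *
        matFourier (fun x => (g x : ℂ)) ((2 * Real.pi) • (ξ * z.2)) *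
          (Complex.exp (-(2 * Real.pi * Complex.I) * ((z.2.transpose * z.1.1).trace : ℂ)) *
            matFourier V (-(2 * Real.pi) • z.2))) := by
    refine ((integrable_mul_comp_sub hU hf hUi hfi ξ).mul_prod
      (hg.integrable_fourier_frame_mul hξ)).mul_bdd (c := ∫ t, ‖V t‖)
      (hexp.mul hV).aestronglyMeasurable (Eventually.of_forall fun z => ?_)
    rw [norm_mul, norm_cexp_two_pi, one_mul]
    exact norm_matFourier_le _ _
  simpa only [mul_assoc (f _ * U _)] using hbdd

/-- Expanding the test function by Fourier inversion along the frame and integrating first over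
the offset and the point turns the pairing into a product of Fourier transforms. -/
theorem integral_mul_integral_test_mul_frame {p : ℕ} (h : p + k = n) {U V : Mat p m → ℂ}
    (hU : Measurable U) (hf : Measurable f) (hUi : Integrable U) (hVi : Integrable V)
    (hfi : Integrable f) (hg : IsTest g) {ξ : Mat n p} (hξ : ξ.transpose * ξ = 1) :
    ∫ z : Mat p m × Mat n m, f z.2 * U (z.1 - ξ.transpose * z.2) *
        ∫ x : Mat n m, (g x : ℂ) * V (ξ.transpose * x - z.1) =
      ∫ η : Mat p m, matFourier (fun x => (g x : ℂ)) ((2 * Real.pi) • (ξ * η)) *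
        (matFourier U (-(2 * Real.pi) • η) * matFourier V (-(2 * Real.pi) • η)) *
          matFourier f (-(2 * Real.pi) • (ξ * η)) := by
  simp only [integral_test_mul_frame h hg hVi hξ]
  simp only [← integral_const_mul]
  rw [integral_integral_swap (integrable_fourier_pairing hU hf hUi hVi hfi hg hξ)]
  refine integral_congr_ae (Eventually.of_forall fun η => ?_)
  simp only
  have hint : Integrable fun z : Mat p m × Mat n m => f z.2 * U (z.1 - ξ.transpose * z.2) *
      Complex.exp (-(2 * Real.pi * Complex.I) * ((η.transpose * z.1).trace : ℂ)) :=
    (integrable_mul_comp_sub hU hf hUi hfi ξ).mul_bdd (c := 1)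
      (continuous_cexp_trace continuous_const continuous_fst).aestronglyMeasurable
      (Eventually.of_forall fun z => (norm_cexp_two_pi _).le)
  calc ∫ z : Mat p m × Mat n m, f z.2 * U (z.1 - ξ.transpose * z.2) *
        (matFourier (fun x => (g x : ℂ)) ((2 * Real.pi) • (ξ * η)) *
          (Complex.exp (-(2 * Real.pi * Complex.I) * ((η.transpose * z.1).trace : ℂ)) *
            matFourier V (-(2 * Real.pi) • η)))
      = (matFourier (fun x => (g x : ℂ)) ((2 * Real.pi) • (ξ * η)) *
          matFourier V (-(2 * Real.pi) • η)) *
          ∫ z : Mat p m × Mat n m, f z.2 * U (z.1 - ξ.transpose * z.2) *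
            Complex.exp (-(2 * Real.pi * Complex.I) * ((η.transpose * z.1).trace : ℂ)) := by
        rw [← integral_const_mul]
        refine integral_congr_ae (Eventually.of_forall fun z => ?_)
        simp only
        ring
    _ = _ := by
        rw [Measure.volume_eq_prod, integral_prod_symm _ hint, integral_cexp_mul_frame]
        ring

theorem integral_kernelMeasure_eq (hkn : k ≤ n) (hu : Measurable u) (hv : Measurable v)
    (hf : Measurable f) (hui : Integrable u) (hvi : Integrable v) (hfi : Integrable f)
    (hg : IsTest g) {a : Mat m m} (ha : a.PosDef) :
    ∫ q, (∫ x : Mat n m, (g x : ℂ) * ridgeletKernel u v f a x q) ∂(kernelMeasure n m k) =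
      ∫ ξ : Stiefel n (n - k), (∫ η : Mat (n - k) m,
        matFourier (fun x => (g x : ℂ)) ((2 * Real.pi) • (ξ.1 * η)) *
          (matFourier u (-(2 * Real.pi) • (η * matSqrt a)) *
            matFourier v (-(2 * Real.pi) • (η * matSqrt a))) *
          matFourier f (-(2 * Real.pi) • (ξ.1 * η))) ∂(stiefelMeasure n k) := by
  have hus : Measurable (scaled u a) := measurable_scaled hu measurable_const measurable_id
  rw [integral_prod _
    (integrable_test_mul_ridgeletKernel hkn hu hv hf hui hvi hfi hg ha).integral_prod_left]
  refine integral_congr_ae (Eventually.of_forall fun ξ => ?_)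
  have hpair := integral_mul_integral_test_mul_frame (Nat.sub_add_cancel hkn) hus hf
    (integrable_scaled hu hui ha) (integrable_scaled hv hvi ha) hfi hg ξ.2
  simp only [matFourier_scaled u ha, matFourier_scaled v ha, Matrix.smul_mul,
    ← integral_const_mul] at hpair
  simp only [ridgeletKernel, mul_left_comm (g _ : ℂ)]
  exact hpair

end FixedScale

/-! ### The truncated reproducing integral as a Fourier multiplier -/

section Truncation

variable {n m k : ℕ} {u v : Mat (n - k) m → ℂ} {f : Mat n m → ℂ}

/-- The invariant measure of the cone restricted to the interval `ε I < a < ρ I`. -/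
noncomputable abbrev truncMeasure (m : ℕ) (ε ρ : ℝ) : Measure (Mat m m) :=
  (coneInvMeasure m).restrict (coneInterval (ε • (1 : Mat m m)) (ρ • (1 : Mat m m)))

/-- The integrand of the truncated reproducing integral as an integral over the scale `a` and the
parameters `q` of `ridgeletKernel` jointly, at `z = (a, q)`. -/
noncomputable def truncKernel (u v : Mat (n - k) m → ℂ) (f : Mat n m → ℂ) (x : Mat n m)
    (z : Mat m m × KernelParam n m k) : ℂ :=
  ridgeletKernel u v f z.1 x z.2 / ((z.1.det ^ ((k : ℝ) / 2) : ℝ) : ℂ)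

theorem isFiniteMeasure_truncMeasure {ε ρ : ℝ} (hε : 0 < ε) :
    IsFiniteMeasure (truncMeasure m ε ρ) :=
  ⟨by rw [Measure.restrict_apply_univ]; exact coneInvMeasure_coneInterval_lt_top hε⟩

theorem ae_truncMeasure_posDef {ε ρ : ℝ} : ∀ᵐ a ∂(truncMeasure m ε ρ), a.PosDef :=
  ae_restrict_of_ae ae_coneInvMeasure_posDef

theorem measurable_truncKernel (hu : Measurable u) (hv : Measurable v) (hf : Measurable f)
    {α : Type*} [MeasurableSpace α] {x : α → Mat n m} {z : α → Mat m m × KernelParam n m k}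
    (hx : Measurable x) (hz : Measurable z) :
    Measurable fun b => truncKernel u v f (x b) (z b) :=
  (measurable_ridgeletKernel hu hv hf hz.fst hx hz.snd).div
    (Complex.measurable_ofReal.comp ((measurable_det.comp hz.fst).pow_const _))

theorem setLIntegral_truncKernel_le (hkn : k ≤ n) (hu : Measurable u) (hv : Measurable v)
    (hf : Measurable f) {R : ℝ} (hR : 0 ≤ R) {a : Mat m m} (ha : a.PosDef) :
    ∫⁻ x in frobBall n m R, (∫⁻ q, ‖truncKernel u v f x (a, q)‖ₑ ∂(kernelMeasure n m k)) ≤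
      ENNReal.ofReal (a.det ^ (-((k : ℝ) / 2))) *
        ((volume {z : Mat k m | ∀ i j, |z i j| ≤ R} * ∫⁻ z, ‖v z‖ₑ) *
          ((∫⁻ y, ‖f y‖ₑ) * ∫⁻ z, ‖u z‖ₑ)) := by
  have hinv : ‖((a.det ^ ((k : ℝ) / 2) : ℝ) : ℂ)⁻¹‖ₑ =
      ENNReal.ofReal (a.det ^ (-((k : ℝ) / 2))) := by
    rw [← ofReal_norm, norm_inv, Complex.norm_real,
      Real.norm_of_nonneg (Real.rpow_nonneg ha.det_pos.le _), ← Real.rpow_neg ha.det_pos.le]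
  simp only [truncKernel, div_eq_mul_inv (ridgeletKernel _ _ _ _ _ _), enorm_mul, hinv]
  simp only [lintegral_mul_const' _ _ ENNReal.ofReal_ne_top]
  rw [mul_comm (ENNReal.ofReal _)]
  gcongr
  exact setLIntegral_ridgeletKernel_le hkn hu hv hf hR ha

theorem integrable_truncKernel (hkn : k ≤ n) (hu : Measurable u) (hv : Measurable v)
    (hf : Measurable f) (hui : Integrable u) (hvi : Integrable v) (hfi : Integrable f)
    {ε : ℝ} (hε : 0 < ε) (ρ : ℝ) {R : ℝ} (hR : 0 ≤ R) :
    Integrable (fun z : Mat n m × (Mat m m × KernelParam n m k) => truncKernel u v f z.1 z.2)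
      ((volume.restrict (frobBall n m R)).prod
        ((truncMeasure m ε ρ).prod (kernelMeasure n m k))) := by
  have hfin := isFiniteMeasure_truncMeasure (m := m) (ρ := ρ) hε
  have hmeas : Measurable fun z : Mat n m × (Mat m m × KernelParam n m k) =>
      truncKernel u v f z.1 z.2 := measurable_truncKernel hu hv hf measurable_fst measurable_snd
  have hsec (x : Mat n m) : Measurable fun z => ‖truncKernel u v f x z‖ₑ :=
    (measurable_truncKernel hu hv hf measurable_const measurable_id).enorm
  have hscale : Measurable fun z : Mat n m × Mat m m =>
      ∫⁻ q, ‖truncKernel u v f z.1 (z.2, q)‖ₑ ∂(kernelMeasure n m k) :=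
    (measurable_truncKernel hu hv hf measurable_fst.fst
      (measurable_fst.snd.prodMk measurable_snd)).enorm.lintegral_prod_right'
  obtain ⟨C, hC⟩ := exists_det_rpow_le hε m ρ (-((k : ℝ) / 2))
  refine ⟨hmeas.aestronglyMeasurable, ?_⟩
  rw [HasFiniteIntegral, lintegral_prod _ hmeas.enorm.aemeasurable]
  simp only [lintegral_prod _ (hsec _).aemeasurable]
  rw [lintegral_lintegral_swap hscale.aemeasurable]
  refine (setLIntegral_mono_ae (g := fun _ => ENNReal.ofReal C * _)
    measurable_const.aemeasurable (ae_coneInvMeasure_posDef.mono fun a ha haI =>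
      (setLIntegral_truncKernel_le hkn hu hv hf hR ha).trans
        (mul_le_mul_left (ENNReal.ofReal_le_ofReal (hC a haI)) _))).trans_lt ?_
  rw [lintegral_const]
  exact ENNReal.mul_lt_top (ENNReal.mul_lt_top ENNReal.ofReal_lt_top (ENNReal.mul_lt_top
    (ENNReal.mul_lt_top (isCompact_setOf_abs_le R).measure_lt_top hvi.2)
    (ENNReal.mul_lt_top hfi.2 hui.2))) (measure_lt_top _ _)

theorem ae_integrable_truncKernel (hkn : k ≤ n) (hu : Measurable u) (hv : Measurable v)
    (hf : Measurable f) (hui : Integrable u) (hvi : Integrable v) (hfi : Integrable f)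
    {ε : ℝ} (hε : 0 < ε) (ρ : ℝ) :
    ∀ᵐ x : Mat n m, Integrable (truncKernel u v f x)
      ((truncMeasure m ε ρ).prod (kernelMeasure n m k)) := by
  have hball (N : ℕ) : ∀ᵐ x : Mat n m, x ∈ frobBall n m N → Integrable (truncKernel u v f x)
      ((truncMeasure m ε ρ).prod (kernelMeasure n m k)) :=
    (ae_restrict_iff' (isClosed_frobBall _).measurableSet).1
      (integrable_truncKernel hkn hu hv hf hui hvi hfi hε ρ (Nat.cast_nonneg N)).prod_right_ae
  filter_upwards [ae_all_iff.2 hball] with x hx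
  obtain ⟨R, hR, hsub⟩ := exists_subset_frobBall (isCompact_singleton (x := x))
  obtain ⟨N, hN⟩ := exists_nat_ge R
  have hxR : (x.transpose * x).trace ≤ R ^ 2 := hsub rfl
  exact hx N (hxR.trans (pow_le_pow_left₀ hR hN 2))

theorem integral_truncKernel_ae_eq_reproIntegrand {μ : Measure (Mat m m)} [SFinite μ]
    {x : Mat n m} (hint : Integrable (truncKernel u v f x) (μ.prod (kernelMeasure n m k)))
    (hμ : ∀ᵐ a ∂μ, a.PosDef) :
    (fun a => ∫ q, truncKernel u v f x (a, q) ∂(kernelMeasure n m k)) =ᵐ[μ]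
      reproIntegrand u v f x := by
  filter_upwards [hint.prod_right_ae, hμ] with a hscale ha
  have hdet : ((a.det ^ ((k : ℝ) / 2) : ℝ) : ℂ) ≠ 0 :=
    Complex.ofReal_ne_zero.2 (Real.rpow_pos_of_pos ha.det_pos _).ne'
  have hK : Integrable (ridgeletKernel u v f a x) (kernelMeasure n m k) :=
    (hscale.mul_const ((a.det ^ ((k : ℝ) / 2) : ℝ) : ℂ)).congr
      (Eventually.of_forall fun q => div_mul_cancel₀ _ hdet)
  simp only [truncKernel]
  rw [integral_div, reproIntegrand, integral_prod _ hK, dualRidgelet]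
  congr 1
  refine integral_congr_ae ?_
  filter_upwards [hK.prod_right_ae] with ξ hξ
  rw [integral_prod _ hξ]
  refine integral_congr_ae (Eventually.of_forall fun t => ?_)
  simp only [ridgeletKernel, ridgelet]
  rw [integral_mul_const]

theorem ae_integrableOn_reproIntegrand (hkn : k ≤ n) (hu : Measurable u) (hv : Measurable v)
    (hf : Measurable f) (hui : Integrable u) (hvi : Integrable v) (hfi : Integrable f)
    {ε : ℝ} (hε : 0 < ε) (ρ : ℝ) :
    ∀ᵐ x : Mat n m, IntegrableOn (reproIntegrand u v f x)
      (coneInterval (ε • (1 : Mat m m)) (ρ • (1 : Mat m m))) (coneInvMeasure m) := by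
  filter_upwards [ae_integrable_truncKernel hkn hu hv hf hui hvi hfi hε ρ] with x hx
  exact hx.integral_prod_left.congr
    (integral_truncKernel_ae_eq_reproIntegrand hx ae_truncMeasure_posDef)

theorem ae_reproTrunc_eq (hkn : k ≤ n) (hu : Measurable u) (hv : Measurable v)
    (hf : Measurable f) (hui : Integrable u) (hvi : Integrable v) (hfi : Integrable f)
    {ε : ℝ} (hε : 0 < ε) (ρ : ℝ) :
    ∀ᵐ x : Mat n m, reproTrunc u v f ε ρ x =
      ∫ z, truncKernel u v f x z ∂((truncMeasure m ε ρ).prod (kernelMeasure n m k)) := by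
  filter_upwards [ae_integrable_truncKernel hkn hu hv hf hui hvi hfi hε ρ] with x hx
  rw [integral_prod _ hx, reproTrunc]
  exact (integral_congr_ae
    (integral_truncKernel_ae_eq_reproIntegrand hx ae_truncMeasure_posDef)).symm

theorem integrableOn_reproTrunc (hkn : k ≤ n) (hu : Measurable u) (hv : Measurable v)
    (hf : Measurable f) (hui : Integrable u) (hvi : Integrable v) (hfi : Integrable f)
    {ε : ℝ} (hε : 0 < ε) (ρ : ℝ) {R : ℝ} (hR : 0 ≤ R) :
    IntegrableOn (reproTrunc u v f ε ρ) (frobBall n m R) := by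
  refine (integrable_truncKernel hkn hu hv hf hui hvi hfi hε ρ hR).integral_prod_left.congr ?_
  filter_upwards [ae_restrict_of_ae (ae_reproTrunc_eq hkn hu hv hf hui hvi hfi hε ρ)] with x hx
  exact hx.symm

theorem locallyIntegrable_reproTrunc (hkn : k ≤ n) (hu : Measurable u) (hv : Measurable v)
    (hf : Measurable f) (hui : Integrable u) (hvi : Integrable v) (hfi : Integrable f)
    {ε : ℝ} (hε : 0 < ε) (ρ : ℝ) : LocallyIntegrable (reproTrunc u v f ε ρ) := by
  rw [locallyIntegrable_iff]
  intro K hK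
  obtain ⟨R, hR, hsub⟩ := exists_subset_frobBall hK
  exact (integrableOn_reproTrunc hkn hu hv hf hui hvi hfi hε ρ hR).mono_set hsub

theorem integrable_test_mul_truncKernel (hkn : k ≤ n) (hu : Measurable u) (hv : Measurable v)
    (hf : Measurable f) (hui : Integrable u) (hvi : Integrable v) (hfi : Integrable f)
    {ε : ℝ} (hε : 0 < ε) (ρ : ℝ) {g : Mat n m → ℝ} (hg : IsTest g) :
    Integrable (fun z : Mat n m × (Mat m m × KernelParam n m k) =>
      (g z.1 : ℂ) * truncKernel u v f z.1 z.2)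
      (volume.prod ((truncMeasure m ε ρ).prod (kernelMeasure n m k))) := by
  obtain ⟨R, hR, hsub⟩ := exists_subset_frobBall hg.2
  obtain ⟨B, hB⟩ := hg.continuous.bounded_above_of_compact_support hg.2
  have hball := (integrable_truncKernel hkn hu hv hf hui hvi hfi hε ρ hR).bdd_mul (c := B)
    (f := fun z => (g z.1 : ℂ)) (Complex.continuous_ofReal.comp
      (hg.continuous.comp continuous_fst)).measurable.aestronglyMeasurable
    (Eventually.of_forall fun z => by rw [Complex.norm_real]; exact hB _)
  rw [← Measure.restrict_univ (μ := (truncMeasure m ε ρ).prod (kernelMeasure n m k)),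
    Measure.prod_restrict] at hball
  have hsupp : Function.support (fun z : Mat n m × (Mat m m × KernelParam n m k) =>
      (g z.1 : ℂ) * truncKernel u v f z.1 z.2) ⊆ frobBall n m R ×ˢ Set.univ := fun z hz =>
    ⟨hsub (subset_tsupport g fun h =>
      hz (by simp only [h, Complex.ofReal_zero, zero_mul])), trivial⟩
  exact (integrableOn_iff_integrable_of_support_subset hsupp).1 hball

theorem integral_test_mul_truncKernel (hkn : k ≤ n) (hu : Measurable u) (hv : Measurable v)
    (hf : Measurable f) (hui : Integrable u) (hvi : Integrable v) (hfi : Integrable f)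
    {g : Mat n m → ℝ} (hg : IsTest g) {a : Mat m m} (ha : a.PosDef) :
    ∫ q, (∫ x : Mat n m, (g x : ℂ) * truncKernel u v f x (a, q)) ∂(kernelMeasure n m k) =
      ((a.det ^ (-(k : ℝ) / 2) : ℝ) : ℂ) *
        (∫ ξ : Stiefel n (n - k), (∫ η : Mat (n - k) m,
          matFourier (fun x => (g x : ℂ)) ((2 * Real.pi) • (ξ.1 * η)) *
            (matFourier u (-(2 * Real.pi) • (η * matSqrt a)) *
              matFourier v (-(2 * Real.pi) • (η * matSqrt a))) *
            matFourier f (-(2 * Real.pi) • (ξ.1 * η))) ∂(stiefelMeasure n k)) := by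
  rw [← integral_kernelMeasure_eq hkn hu hv hf hui hvi hfi hg ha, neg_div,
    Real.rpow_neg ha.det_pos.le, Complex.ofReal_inv]
  simp only [truncKernel, ← integral_const_mul]
  simp only [div_eq_inv_mul (ridgeletKernel _ _ _ _ _ _), mul_left_comm (g _ : ℂ)]

theorem integral_test_smul_reproTrunc (hkn : k ≤ n) (hu : Measurable u) (hv : Measurable v)
    (hf : Measurable f) (hui : Integrable u) (hvi : Integrable v) (hfi : Integrable f)
    {ε : ℝ} (hε : 0 < ε) (ρ : ℝ) {g : Mat n m → ℝ} (hg : IsTest g) :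
    ∫ x, g x • reproTrunc u v f ε ρ x =
      ∫ a, ((a.det ^ (-(k : ℝ) / 2) : ℝ) : ℂ) * (∫ ξ : Stiefel n (n - k), (∫ η : Mat (n - k) m,
        matFourier (fun x => (g x : ℂ)) ((2 * Real.pi) • (ξ.1 * η)) *
          (matFourier u (-(2 * Real.pi) • (η * matSqrt a)) *
            matFourier v (-(2 * Real.pi) • (η * matSqrt a))) *
          matFourier f (-(2 * Real.pi) • (ξ.1 * η))) ∂(stiefelMeasure n k))
        ∂(truncMeasure m ε ρ) := by
  have hint := integrable_test_mul_truncKernel hkn hu hv hf hui hvi hfi hε ρ hg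
  calc ∫ x, g x • reproTrunc u v f ε ρ x
      = ∫ x, (∫ z, (g x : ℂ) * truncKernel u v f x z
          ∂((truncMeasure m ε ρ).prod (kernelMeasure n m k))) := by
        refine integral_congr_ae ?_
        filter_upwards [ae_reproTrunc_eq hkn hu hv hf hui hvi hfi hε ρ] with x hx
        rw [hx, integral_const_mul, Complex.real_smul]
    _ = ∫ z, (∫ x, (g x : ℂ) * truncKernel u v f x z)
          ∂((truncMeasure m ε ρ).prod (kernelMeasure n m k)) := integral_integral_swap hint
    _ = ∫ a, (∫ q, (∫ x, (g x : ℂ) * truncKernel u v f x (a, q)) ∂(kernelMeasure n m k))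
          ∂(truncMeasure m ε ρ) := integral_prod _ hint.integral_prod_right
    _ = _ := by
        refine integral_congr_ae ?_
        filter_upwards [ae_truncMeasure_posDef] with a ha
        exact integral_test_mul_truncKernel hkn hu hv hf hui hvi hfi hg ha

end Truncation

/-! ### Identification of the multiplier and convergence -/

section Reproducing

variable {n m k : ℕ}

theorem integrable_fourier_stiefel_mul {g : Mat n m → ℝ} (hg : IsTest g) :
    Integrable (fun q : Stiefel n (n - k) × Mat (n - k) m =>
      matFourier (fun x => (g x : ℂ)) ((2 * Real.pi) • (q.1.1 * q.2)))
      ((stiefelMeasure n k).prod volume) := by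
  obtain ⟨C, hC⟩ := hg.exists_decay ((n - k) * m + 1)
  have hdecay : Integrable (fun q : Stiefel n (n - k) × Mat (n - k) m => (1 : ℝ) *
      (C * (1 + ‖matE (n - k) m q.2‖) ^ (-(((n - k) * m + 1 : ℕ) : ℝ))))
      ((stiefelMeasure n k).prod volume) :=
    (integrable_const (1 : ℝ)).mul_prod ((integrable_decay (n - k) m).const_mul C)
  refine hdecay.mono' ?_ (Eventually.of_forall fun q => ?_)
  · exact (hg.continuous_fourier.measurable.comp measurable_stiefel_prod_mul).aestronglyMeasurable
  · have hbound := hC (q.1.1 * q.2)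
    rwa [norm_matE_frame_mul q.1.2, ← one_mul (C * _)] at hbound

theorem polarRatio_pos (hm : m ≤ n - k) : 0 < polarConst (n - k) m / polarConst n m :=
  div_pos (polarConst_pos hm) (polarConst_pos (hm.trans (Nat.sub_le n k)))

theorem integrable_of_stiefel_mul (hm : m ≤ n - k) {H : Mat n m → ℂ} (hH : Measurable H)
    (hi : Integrable (fun q : Stiefel n (n - k) × Mat (n - k) m => H (q.1.1 * q.2))
      ((stiefelMeasure n k).prod volume)) :
    Integrable fun Y : Mat n m => (stiefelDensity k Y : ℂ) * H Y := by
  have himage := (integrable_map_measure (g := H) hH.aestronglyMeasurable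
    measurable_stiefel_prod_mul.aemeasurable).2 hi
  rw [map_stiefel_mul hm, integrable_smul_measure
    (ENNReal.ofReal_pos.2 (polarRatio_pos hm)).ne' ENNReal.ofReal_ne_top,
    integrable_withDensity_iff_integrable_smul₀'
      measurable_stiefelDensity.ennreal_ofReal.aemeasurable
      (Eventually.of_forall fun _ => ENNReal.ofReal_lt_top)] at himage
  refine himage.congr (Eventually.of_forall fun Y => ?_)
  simp only [ENNReal.toReal_ofReal (stiefelDensity_nonneg Y), Complex.real_smul]

theorem integral_stiefel_mul (hm : m ≤ n - k) {H : Mat n m → ℂ} (hH : Measurable H) :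
    ∫ q : Stiefel n (n - k) × Mat (n - k) m, H (q.1.1 * q.2)
      ∂((stiefelMeasure n k).prod volume) =
    ((polarConst (n - k) m / polarConst n m : ℝ) : ℂ) *
      ∫ Y : Mat n m, (stiefelDensity k Y : ℂ) * H Y := by
  rw [← integral_map (f := H) measurable_stiefel_prod_mul.aemeasurable hH.aestronglyMeasurable,
    map_stiefel_mul hm, integral_smul_measure,
    ENNReal.toReal_ofReal (polarRatio_pos hm).le,
    integral_withDensity_eq_integral_toReal_smul₀
      measurable_stiefelDensity.ennreal_ofReal.aemeasurable
      (Eventually.of_forall fun _ => ENNReal.ofReal_lt_top), Complex.real_smul]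
  simp only [ENNReal.toReal_ofReal (stiefelDensity_nonneg _), Complex.real_smul]

theorem integrable_stiefelDensity_mul_fourier (hm : m ≤ n - k) {g : Mat n m → ℝ}
    (hg : IsTest g) :
    Integrable fun Y : Mat n m =>
      (stiefelDensity k Y : ℂ) * matFourier (fun x => (g x : ℂ)) ((2 * Real.pi) • Y) :=
  integrable_of_stiefel_mul hm hg.continuous_fourier.measurable (integrable_fourier_stiefel_mul hg)

theorem integral_integral_fourier_stiefel_mul (hm : m ≤ n - k) {g : Mat n m → ℝ}
    (hg : IsTest g) {Φ : Mat n m → ℂ} (hΦ : Measurable Φ) {C : ℝ} (hC : ∀ Y, ‖Φ Y‖ ≤ C) :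
    ∫ ξ : Stiefel n (n - k), (∫ η : Mat (n - k) m,
        matFourier (fun x => (g x : ℂ)) ((2 * Real.pi) • (ξ.1 * η)) * Φ (ξ.1 * η))
        ∂(stiefelMeasure n k) =
      ((polarConst (n - k) m / polarConst n m : ℝ) : ℂ) * ∫ Y : Mat n m,
        (stiefelDensity k Y : ℂ) *
          (matFourier (fun x => (g x : ℂ)) ((2 * Real.pi) • Y) * Φ Y) := by
  refine Eq.trans ?_ (integral_stiefel_mul hm (hg.continuous_fourier.measurable.mul hΦ))
  exact (integral_prod _ ((integrable_fourier_stiefel_mul hg).mul_bdd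
    (g := fun q : Stiefel n (n - k) × Mat (n - k) m => Φ (q.1.1 * q.2))
    (hΦ.comp measurable_stiefel_prod_mul).aestronglyMeasurable
    (Eventually.of_forall fun q => hC _))).symm

/-- The Fourier multiplier of the truncated reproducing integral. -/
noncomputable def reproMultiplier (n k m : ℕ) (G : Mat (n - k) m → ℂ) (ε ρ : ℝ) :
    Mat n m → ℂ :=
  {Y : Mat n m | (Y.transpose * Y).PosDef}.indicator fun Y =>
    truncConst n k m G (ε • ((2 * Real.pi) ^ 2 • (Y.transpose * Y)))
      (ρ • ((2 * Real.pi) ^ 2 • (Y.transpose * Y)))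

theorem reproMultiplier_of_posDef (G : Mat (n - k) m → ℂ) (ε ρ : ℝ) {Y : Mat n m}
    (hY : (Y.transpose * Y).PosDef) :
    reproMultiplier n k m G ε ρ Y =
      truncConst n k m G (ε • ((2 * Real.pi) ^ 2 • (Y.transpose * Y)))
        (ρ • ((2 * Real.pi) ^ 2 • (Y.transpose * Y))) :=
  Set.indicator_of_mem (s := {Y : Mat n m | (Y.transpose * Y).PosDef}) hY _

theorem reproMultiplier_of_not_posDef (G : Mat (n - k) m → ℂ) (ε ρ : ℝ) {Y : Mat n m}
    (hY : ¬ (Y.transpose * Y).PosDef) : reproMultiplier n k m G ε ρ Y = 0 :=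
  Set.indicator_of_notMem (s := {Y : Mat n m | (Y.transpose * Y).PosDef}) hY _

theorem two_pi_pow_mul_det_rpow {r : Mat m m} (hr : r.PosDef) (hkn : k ≤ n) :
    (2 * Real.pi) ^ (k * m) * ((2 * Real.pi) ^ 2 • r).det ^ (-(k : ℝ) / 2) =
      r.det ^ ((((n - k : ℕ) : ℝ) - n) / 2) := by
  have hpi : (0 : ℝ) < 2 * Real.pi := by positivity
  have hexp : (((n - k : ℕ) : ℝ) - n) / 2 = -(k : ℝ) / 2 := by
    rw [Nat.cast_sub hkn]
    ring
  have hpow : (((2 * Real.pi) ^ 2) ^ m) ^ (-(k : ℝ) / 2) = ((2 * Real.pi) ^ (k * m))⁻¹ := by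
    rw [← pow_mul, ← Real.rpow_natCast, ← Real.rpow_mul hpi.le, ← Real.rpow_natCast,
      ← Real.rpow_neg hpi.le]
    congr 1
    push_cast
    ring
  rw [hexp, Matrix.det_smul, Fintype.card_fin, Real.mul_rpow (by positivity) hr.det_pos.le,
    ← mul_assoc, hpow, mul_inv_cancel₀ (by positivity), one_mul]

/-- The profile `w` of a radial Fourier transform at the frequency `2π Y a^{1/2}`. -/
noncomputable def scaledProfile (w : Mat m m → ℂ) (a : Mat m m) (Y : Mat n m) : ℂ :=
  w (matSqrt a * ((2 * Real.pi) ^ 2 • (Y.transpose * Y)) * matSqrt a)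

theorem measurable_scaledProfile {w : Mat m m → ℂ} (hw : Measurable w) {α : Type*}
    [MeasurableSpace α] {a : α → Mat m m} {Y : α → Mat n m} (ha : Measurable a)
    (hY : Measurable Y) : Measurable fun b => scaledProfile w (a b) (Y b) := by
  have hgram : Measurable fun Y : Mat n m => (2 * Real.pi) ^ 2 • (Y.transpose * Y) :=
    ((continuous_const_smul _).comp continuous_gram).measurable
  have hsqrt := measurable_matSqrt.comp ha
  exact hw.comp (measurable_matrix_mul (measurable_matrix_mul hsqrt (hgram.comp hY)) hsqrt)

/-- The integral of the scaled profile over the scales `ε I < a < ρ I` with respect to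
`|a|^{-k/2} d_*a`. -/
noncomputable def scaleAverage (k : ℕ) (w : Mat m m → ℂ) (ε ρ : ℝ) (Y : Mat n m) : ℂ :=
  ∫ a, ((a.det ^ (-(k : ℝ) / 2) : ℝ) : ℂ) * scaledProfile w a Y ∂(truncMeasure m ε ρ)

theorem measurable_scaleAverage {w : Mat m m → ℂ} (hw : Measurable w) (ε ρ : ℝ) :
    Measurable (scaleAverage k w ε ρ : Mat n m → ℂ) := by
  have hintegrand : Measurable fun z : Mat n m × Mat m m =>
      ((z.2.det ^ (-(k : ℝ) / 2) : ℝ) : ℂ) * scaledProfile w z.2 z.1 :=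
    (Complex.measurable_ofReal.comp ((measurable_det.comp measurable_snd).pow_const _)).mul
      (measurable_scaledProfile hw measurable_snd measurable_fst)
  exact hintegrand.stronglyMeasurable.integral_prod_right'.measurable

theorem reproMultiplier_eq (hm : m ≤ n - k) (hkn : k ≤ n) {G : Mat (n - k) m → ℂ}
    {w : Mat m m → ℂ} (hw : Measurable w) (hG : ∀ y, G y = w (y.transpose * y))
    (hsym : IsSymmetricOnCone w) {Y : Mat n m} (hY : (Y.transpose * Y).PosDef) (ε ρ : ℝ) :
    reproMultiplier n k m G ε ρ Y = ((polarConst (n - k) m / polarConst n m : ℝ) : ℂ) *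
      ((stiefelDensity k Y : ℂ) * scaleAverage k w ε ρ Y) := by
  rw [reproMultiplier_of_posDef G ε ρ hY,
    truncConst_smul_eq hm hkn hw hG hsym (hY.smul (by positivity)), stiefelDensity,
    ← two_pi_pow_mul_det_rpow hY hkn, ← mul_assoc, ← Complex.ofReal_mul]
  congr 2
  ring

theorem measurable_reproMultiplier (hm : m ≤ n - k) (hkn : k ≤ n) {G : Mat (n - k) m → ℂ}
    {w : Mat m m → ℂ} (hw : Measurable w) (hG : ∀ y, G y = w (y.transpose * y))
    (hsym : IsSymmetricOnCone w) (ε ρ : ℝ) : Measurable (reproMultiplier n k m G ε ρ) := by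
  have hset : MeasurableSet {Y : Mat n m | (Y.transpose * Y).PosDef} :=
    measurableSet_setOf_posDef.preimage measurable_gram
  have hformula : Measurable fun Y : Mat n m =>
      ((polarConst (n - k) m / polarConst n m : ℝ) : ℂ) *
        ((stiefelDensity k Y : ℂ) * scaleAverage k w ε ρ Y) :=
    ((Complex.measurable_ofReal.comp measurable_stiefelDensity).mul
      (measurable_scaleAverage hw ε ρ)).const_mul _
  convert hformula.indicator hset using 1
  ext Y
  by_cases hY : (Y.transpose * Y).PosDef
  · rw [reproMultiplier_eq hm hkn hw hG hsym hY, Set.indicator_of_mem (by exact hY)]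
  · rw [reproMultiplier_of_not_posDef G ε ρ hY, Set.indicator_of_notMem (by exact hY)]

theorem norm_reproMultiplier_le {G : Mat (n - k) m → ℂ} {C : ℝ}
    (hC : ∀ r : Mat m m, r.PosDef → ∀ ε ρ : ℝ, 0 < ε → ε < ρ →
      ‖truncConst n k m G (ε • r) (ρ • r)‖ ≤ C) {ε ρ : ℝ} (hε : 0 < ε) (hρ : ε < ρ)
    (Y : Mat n m) : ‖reproMultiplier n k m G ε ρ Y‖ ≤ |C| := by
  by_cases hY : (Y.transpose * Y).PosDef
  · rw [reproMultiplier_of_posDef G ε ρ hY]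
    exact (hC _ (hY.smul (by positivity)) ε ρ hε hρ).trans (le_abs_self C)
  · rw [reproMultiplier_of_not_posDef G ε ρ hY, norm_zero]
    exact abs_nonneg C

theorem gram_two_pi_smul_mul {p : ℕ} {ξ : Mat n p} (hξ : ξ.transpose * ξ = 1) (η : Mat p m)
    (a : Mat m m) :
    (-(2 * Real.pi) • (η * matSqrt a)).transpose * (-(2 * Real.pi) • (η * matSqrt a)) =
      matSqrt a * ((2 * Real.pi) ^ 2 • ((ξ * η).transpose * (ξ * η))) * matSqrt a := by
  rw [gram_mul_of_gram_eq_one hξ, Matrix.transpose_smul, Matrix.smul_mul, Matrix.mul_smul,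
    smul_smul, Matrix.transpose_mul, transpose_matSqrt, Matrix.mul_smul, Matrix.smul_mul,
    neg_mul_neg, ← pow_two]
  simp only [Matrix.mul_assoc]

theorem integrable_det_rpow_truncMeasure {ε : ℝ} (hε : 0 < ε) (ρ s : ℝ) :
    Integrable (fun a : Mat m m => ((a.det ^ s : ℝ) : ℂ)) (truncMeasure m ε ρ) := by
  have := isFiniteMeasure_truncMeasure (m := m) (ρ := ρ) hε
  obtain ⟨C, hC⟩ := exists_det_rpow_le hε m ρ s
  refine Integrable.of_bound
    (Complex.measurable_ofReal.comp (measurable_det.pow_const _)).aestronglyMeasurable C ?_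
  filter_upwards [ae_truncMeasure_posDef,
    ae_restrict_mem (measurableSet_coneInterval _ _)] with a ha haI
  rw [Complex.norm_real, Real.norm_of_nonneg (Real.rpow_nonneg ha.det_pos.le _)]
  exact hC a haI

theorem integral_mul_integral_mul_swap {α β : Type*} [MeasurableSpace α] [MeasurableSpace β]
    {μ : Measure α} {ν : Measure β} [SFinite μ] [SFinite ν] {D : α → ℂ} {E : β → ℂ}
    {Φ : α → β → ℂ} (hD : Integrable D μ) (hE : Integrable E ν)
    (hΦ : Measurable fun z : α × β => Φ z.1 z.2) {C : ℝ} (hC : ∀ a b, ‖Φ a b‖ ≤ C) :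
    ∫ a, D a * (∫ b, E b * Φ a b ∂ν) ∂μ = ∫ b, E b * (∫ a, D a * Φ a b ∂μ) ∂ν := by
  have hint : Integrable (fun z : α × β => D z.1 * E z.2 * Φ z.1 z.2) (μ.prod ν) :=
    (hD.mul_prod hE).mul_bdd hΦ.aestronglyMeasurable (Eventually.of_forall fun z => hC _ _)
  simp only [← integral_const_mul, ← mul_assoc]
  rw [integral_integral_swap hint]
  simp only [mul_comm (D _)]

variable {u v : Mat (n - k) m → ℂ} {f : Mat n m → ℂ}

theorem integral_scaled_frame_eq (hm : m ≤ n - k) (hfi : Integrable f) {w : Mat m m → ℂ}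
    (hw : Measurable w) (hG : ∀ y, matFourier u y * matFourier v y = w (y.transpose * y))
    {B : ℝ} (hB : ∀ r, ‖w r‖ ≤ B) {g : Mat n m → ℝ} (hg : IsTest g) (a : Mat m m) :
    ∫ ξ : Stiefel n (n - k), (∫ η : Mat (n - k) m,
        matFourier (fun x => (g x : ℂ)) ((2 * Real.pi) • (ξ.1 * η)) *
          (matFourier u (-(2 * Real.pi) • (η * matSqrt a)) *
            matFourier v (-(2 * Real.pi) • (η * matSqrt a))) *
          matFourier f (-(2 * Real.pi) • (ξ.1 * η))) ∂(stiefelMeasure n k) =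
      ((polarConst (n - k) m / polarConst n m : ℝ) : ℂ) * ∫ Y : Mat n m,
        (stiefelDensity k Y * matFourier (fun x => (g x : ℂ)) ((2 * Real.pi) • Y)) *
          (scaledProfile w a Y * matFourier f (-(2 * Real.pi) • Y)) := by
  have hf_meas : Measurable fun Y : Mat n m => matFourier f (-(2 * Real.pi) • Y) :=
    ((continuous_matFourier hfi).comp (continuous_const_smul _)).measurable
  have hpolar := integral_integral_fourier_stiefel_mul (k := k) hm hg
    (Φ := fun Y => scaledProfile w a Y * matFourier f (-(2 * Real.pi) • Y))
    ((measurable_scaledProfile hw measurable_const measurable_id).mul hf_meas)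
    fun Y => norm_mul_le_of_le (hB _) (norm_matFourier_le _ _)
  simp only [mul_assoc] at hpolar ⊢
  rw [← hpolar]
  simp only [← mul_assoc (matFourier u _), hG, scaledProfile,
    fun (ξ : Stiefel n (n - k)) (η : Mat (n - k) m) => (gram_two_pi_smul_mul ξ.2 η a).symm]

theorem integral_test_smul_reproTrunc_eq (hm : m ≤ n - k) (hkn : k ≤ n) (hu : Measurable u)
    (hv : Measurable v) (hf : Measurable f) (hui : Integrable u) (hvi : Integrable v)
    (hfi : Integrable f) {w : Mat m m → ℂ} (hw : Measurable w)
    (hG : ∀ y, matFourier u y * matFourier v y = w (y.transpose * y))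
    (hsym : IsSymmetricOnCone w) {B : ℝ} (hB : ∀ r, ‖w r‖ ≤ B)
    {ε : ℝ} (hε : 0 < ε) (ρ : ℝ) {g : Mat n m → ℝ} (hg : IsTest g) :
    ∫ x, g x • reproTrunc u v f ε ρ x =
      ∫ Y : Mat n m, matFourier (fun x => (g x : ℂ)) ((2 * Real.pi) • Y) *
        (reproMultiplier n k m (fun ζ => matFourier u ζ * matFourier v ζ) ε ρ Y *
          matFourier f (-(2 * Real.pi) • Y)) := by
  have hf_meas : Measurable fun Y : Mat n m => matFourier f (-(2 * Real.pi) • Y) :=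
    ((continuous_matFourier hfi).comp (continuous_const_smul _)).measurable
  rw [integral_test_smul_reproTrunc hkn hu hv hf hui hvi hfi hε ρ hg]
  simp only [integral_scaled_frame_eq hm hfi hw hG hB hg]
  simp only [mul_left_comm _ ((polarConst (n - k) m / polarConst n m : ℝ) : ℂ),
    integral_const_mul]
  rw [integral_mul_integral_mul_swap (integrable_det_rpow_truncMeasure hε ρ _)
    (integrable_stiefelDensity_mul_fourier hm hg)
    (Φ := fun a Y => scaledProfile w a Y * matFourier f (-(2 * Real.pi) • Y))
    ((measurable_scaledProfile hw measurable_fst measurable_snd).mul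
      (hf_meas.comp measurable_snd))
    fun _ _ => norm_mul_le_of_le (hB _) (norm_matFourier_le _ _), ← integral_const_mul]
  refine integral_congr_ae ?_
  filter_upwards [ae_posDef_gram (p := n) (m := m) (hm.trans (Nat.sub_le n k))] with Y hY
  rw [reproMultiplier_eq hm hkn hw hG hsym hY, scaleAverage]
  simp only [← mul_assoc]
  rw [integral_mul_const]
  ring

theorem tendsto_smul_coneZero {r : Mat m m} (hr : r.PosDef) :
    Tendsto (fun ε : ℝ => ε • r) (𝓝[>] 0) (coneZero m) := by
  refine tendsto_nhdsWithin_iff.2 ⟨?_, ?_⟩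
  · have hlim : Tendsto (fun ε : ℝ => ε • r) (𝓝 0) (𝓝 ((0 : ℝ) • r)) :=
      (continuous_id.smul continuous_const).tendsto 0
    rw [zero_smul] at hlim
    exact hlim.mono_left nhdsWithin_le_nhds
  · filter_upwards [self_mem_nhdsWithin] with ε hε
    exact hr.smul hε

theorem tendsto_smul_coneInfty {r : Mat m m} (hr : r.PosDef) :
    Tendsto (fun ρ : ℝ => ρ • r) atTop (coneInfty m) := by
  refine tendsto_iInf.2 fun c => tendsto_principal.2 ?_
  have hsymm : r.transpose = r := by
    rw [← Matrix.conjTranspose_eq_transpose_of_trivial, hr.isHermitian.eq]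
  have hlim : Tendsto (fun ρ : ℝ => r - (c / ρ) • (1 : Mat m m)) atTop (𝓝 r) := by
    have hcont : Tendsto (fun δ : ℝ => r - δ • (1 : Mat m m)) (𝓝 0) (𝓝 (r - (0 : ℝ) • 1)) :=
      (continuous_const.sub (continuous_id.smul continuous_const)).tendsto 0
    rw [zero_smul, sub_zero] at hcont
    exact hcont.comp (tendsto_const_nhds.div_atTop tendsto_id)
  filter_upwards [hlim.eventually (eventually_posDef hr), eventually_gt_atTop 0] with ρ hρ hpos
  have hdiff := (hρ (by rw [Matrix.transpose_sub, hsymm, transpose_smul_one])).smul hpos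
  rw [smul_sub, smul_smul, mul_div_cancel₀ _ hpos.ne'] at hdiff
  exact ⟨hr.smul hpos, hdiff⟩

theorem tendsto_reproMultiplier {G : Mat (n - k) m → ℂ} {c : ℂ}
    (hc : HasConeIntegral n k m G c) {Y : Mat n m} (hY : (Y.transpose * Y).PosDef) :
    Tendsto (fun p : ℝ × ℝ => reproMultiplier n k m G p.1 p.2 Y) (𝓝[>] (0 : ℝ) ×ˢ atTop)
      (𝓝 c) := by
  have hr : ((2 * Real.pi) ^ 2 • (Y.transpose * Y)).PosDef := hY.smul (by positivity)
  have hcomp := Tendsto.comp hc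
    ((tendsto_smul_coneZero hr).prodMap (tendsto_smul_coneInfty hr))
  exact hcomp.congr fun p => (reproMultiplier_of_posDef G p.1 p.2 hY).symm

end Reproducing

section DominatedConvergence

variable {α ι : Type*} [MeasurableSpace α] {μ : Measure α} {l : Filter ι}
  [l.IsCountablyGenerated]

theorem tendsto_eLpNorm_zero_of_dominated {E : Type*} [NormedAddCommGroup E] {p : ℝ≥0∞}
    (hp0 : p ≠ 0) (hp : p ≠ ⊤) {F : ι → α → E} {b : α → ℝ} (hb : MemLp b p μ)
    (hF : ∀ᶠ i in l, AEStronglyMeasurable (F i) μ)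
    (hbound : ∀ᶠ i in l, ∀ᵐ x ∂μ, ‖F i x‖ ≤ b x)
    (hlim : ∀ᵐ x ∂μ, Tendsto (fun i => F i x) l (𝓝 0)) :
    Tendsto (fun i => eLpNorm (F i) p μ) l (𝓝 0) := by
  have hp_pos : 0 < p.toReal := ENNReal.toReal_pos hp0 hp
  have hpow : Tendsto (fun i => ∫⁻ x, ‖F i x‖ₑ ^ p.toReal ∂μ) l (𝓝 (∫⁻ _, 0 ∂μ)) := by
    refine tendsto_lintegral_filter_of_dominated_convergence' (fun x => ‖b x‖ₑ ^ p.toReal)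
      (hF.mono fun i hi => hi.enorm.pow_const _) ?_
      (lintegral_rpow_enorm_lt_top_of_eLpNorm_lt_top hp0 hp hb.2).ne ?_
    · filter_upwards [hbound] with i hi
      filter_upwards [hi] with x hx
      exact ENNReal.rpow_le_rpow (enorm_le_iff_norm_le.2 (hx.trans (le_abs_self _))) hp_pos.le
    · filter_upwards [hlim] with x hx
      have hcomp := ((ENNReal.continuous_rpow_const (y := p.toReal)).tendsto _).comp hx.enorm
      rwa [enorm_zero, ENNReal.zero_rpow_of_pos hp_pos] at hcomp
  have hroot := ((ENNReal.continuous_rpow_const (y := 1 / p.toReal)).tendsto _).comp hpow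
  rw [lintegral_zero, ENNReal.zero_rpow_of_pos (one_div_pos.2 hp_pos)] at hroot
  simpa only [eLpNorm_eq_lintegral_rpow_enorm_toReal hp0 hp, Function.comp_def] using hroot

theorem tendsto_eLpNorm_mul_zero {p : ℝ≥0∞} (hp0 : p ≠ 0) (hp : p ≠ ⊤) {F : ι → α → ℂ}
    {φ : α → ℂ} (hφ : MemLp φ p μ) {C : ℝ}
    (hF : ∀ᶠ i in l, AEStronglyMeasurable (F i) μ) (hbound : ∀ᶠ i in l, ∀ x, ‖F i x‖ ≤ C)
    (hlim : ∀ᵐ x ∂μ, Tendsto (fun i => F i x) l (𝓝 0)) :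
    Tendsto (fun i => eLpNorm (fun x => F i x * φ x) p μ) l (𝓝 0) := by
  refine tendsto_eLpNorm_zero_of_dominated hp0 hp (hφ.norm.const_mul C)
    (hF.mono fun i hi => hi.mul hφ.aestronglyMeasurable) ?_ ?_
  · exact hbound.mono fun i hi => Eventually.of_forall fun x => norm_mul_le_of_le (hi x) le_rfl
  · filter_upwards [hlim] with x hx
    simpa only [zero_mul] using hx.mul_const (φ x)

end DominatedConvergence

/-! ### The reproducing formula -/

section Main

variable {n m k : ℕ} {u v : Mat (n - k) m → ℂ} {f : Mat n m → ℂ}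

theorem matFourier_congr {p : ℕ} {w w' : Mat p m → ℂ} (h : w =ᵐ[volume] w') :
    matFourier w = matFourier w' := by
  ext y
  refine integral_congr_ae ?_
  filter_upwards [h] with x hx
  rw [hx]

theorem reproTrunc_congr (hkn : k ≤ n) {u' v' : Mat (n - k) m → ℂ} {f' : Mat n m → ℂ}
    (hu : u =ᵐ[volume] u') (hv : v =ᵐ[volume] v') (hf : f =ᵐ[volume] f') (ε ρ : ℝ) :
    reproTrunc u v f ε ρ = reproTrunc u' v' f' ε ρ := by
  ext x
  refine integral_congr_ae ?_
  filter_upwards [ae_truncMeasure_posDef] with a ha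
  exact reproIntegrand_congr hkn hu hv hf x ha

theorem memLp_reproTrunc_and_eLpNorm_sub_eq (hm : m ≤ n - k) (hkn : k ≤ n) (hu : Measurable u)
    (hv : Measurable v) (hf : Measurable f) (hui : Integrable u) (hvi : Integrable v)
    (hfi : Integrable f) (hf2 : MemLp f 2) {w : Mat m m → ℂ} (hw : Measurable w)
    (hG : ∀ y, matFourier u y * matFourier v y = w (y.transpose * y))
    (hsym : IsSymmetricOnCone w) {B : ℝ} (hB : ∀ r, ‖w r‖ ≤ B) {C : ℝ}
    (hC : ∀ r : Mat m m, r.PosDef → ∀ ε ρ : ℝ, 0 < ε → ε < ρ →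
      ‖truncConst n k m (fun ζ => matFourier u ζ * matFourier v ζ) (ε • r) (ρ • r)‖ ≤ C)
    {ε ρ : ℝ} (hε : 0 < ε) (hρ : ε < ρ) (c : ℂ) :
    MemLp (reproTrunc u v f ε ρ) 2 ∧
      eLpNorm (fun x => reproTrunc u v f ε ρ x - c * f x) 2 volume =
        eLpNorm (fun Y : Mat n m =>
          (reproMultiplier n k m (fun ζ => matFourier u ζ * matFourier v ζ) ε ρ Y - c) *
            matFourier f (-(2 * Real.pi) • Y)) 2 volume := by
  obtain ⟨T, hT, hpair, hnorm⟩ := exists_matrix_multiplier hfi hf2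
    (measurable_reproMultiplier hm hkn hw hG hsym ε ρ)
    (fun Y => norm_reproMultiplier_le hC hε hρ Y)
  have hT_eq : reproTrunc u v f ε ρ =ᵐ[volume] T := by
    refine ae_eq_of_integral_isTest
      (locallyIntegrable_reproTrunc hkn hu hv hf hui hvi hfi hε ρ)
      (hT.locallyIntegrable one_le_two) fun g hg => ?_
    rw [hpair g hg]
    exact integral_test_smul_reproTrunc_eq hm hkn hu hv hf hui hvi hfi hw hG hsym hB hε ρ hg
  refine ⟨(memLp_congr_ae hT_eq).2 hT, ?_⟩
  rw [← hnorm c]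
  refine eLpNorm_congr_ae ?_
  filter_upwards [hT_eq] with x hx
  rw [hx]

theorem eventually_pos_lt : ∀ᶠ p : ℝ × ℝ in 𝓝[>] (0 : ℝ) ×ˢ atTop, 0 < p.1 ∧ p.1 < p.2 := by
  have hsmall : ∀ᶠ ε : ℝ in 𝓝[>] (0 : ℝ), 0 < ε ∧ ε < 1 := Ioo_mem_nhdsGT one_pos
  filter_upwards [hsmall.prod_mk (eventually_gt_atTop (1 : ℝ))] with p hp
  exact ⟨hp.1.1, hp.1.2.trans hp.2⟩

theorem tendsto_eLpNorm_reproMultiplier_sub_mul (hm : m ≤ n - k) {G : Mat (n - k) m → ℂ}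
    (hG : ∀ ε ρ : ℝ, Measurable (reproMultiplier n k m G ε ρ)) {C : ℝ}
    (hC : ∀ r : Mat m m, r.PosDef → ∀ ε ρ : ℝ, 0 < ε → ε < ρ →
      ‖truncConst n k m G (ε • r) (ρ • r)‖ ≤ C)
    {c : ℂ} (hc : HasConeIntegral n k m G c) {φ : Mat n m → ℂ} (hφ : MemLp φ 2) :
    Tendsto (fun p : ℝ × ℝ =>
      eLpNorm (fun Y => (reproMultiplier n k m G p.1 p.2 Y - c) * φ Y) 2 volume)
      (𝓝[>] (0 : ℝ) ×ˢ atTop) (𝓝 0) := by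
  refine tendsto_eLpNorm_mul_zero two_ne_zero ENNReal.ofNat_ne_top (C := |C| + ‖c‖) hφ
    (Eventually.of_forall fun p => ((hG p.1 p.2).sub_const c).aestronglyMeasurable) ?_ ?_
  · filter_upwards [eventually_pos_lt] with p hp Y
    exact norm_sub_le_of_le (norm_reproMultiplier_le hC hp.1 hp.2 Y) le_rfl
  · filter_upwards [ae_posDef_gram (p := n) (m := m) (hm.trans (Nat.sub_le n k))] with Y hY
    simpa only [sub_self] using (tendsto_reproMultiplier hc hY).sub_const c

/-- The conclusion of the reproducing formula for a single function `f`: the truncated integrals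
of `V_a^* U_a f` converge absolutely almost everywhere, lie in `L²` and tend to `c f` in `L²`. -/
def HasReproducingFormula (u v : Mat (n - k) m → ℂ) (f : Mat n m → ℂ) (c : ℂ) : Prop :=
  (∀ ε ρ : ℝ, 0 < ε → ε < ρ →
    (∀ᵐ x : Mat n m, IntegrableOn (reproIntegrand u v f x)
      (coneInterval (ε • (1 : Mat m m)) (ρ • (1 : Mat m m))) (coneInvMeasure m)) ∧
    MemLp (reproTrunc u v f ε ρ) 2) ∧
  Tendsto (fun p : ℝ × ℝ => eLpNorm (fun x => reproTrunc u v f p.1 p.2 x - c * f x) 2 volume)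
    (𝓝[>] (0 : ℝ) ×ˢ atTop) (𝓝 0)

theorem HasReproducingFormula.congr (hkn : k ≤ n) {u' v' : Mat (n - k) m → ℂ}
    {f' : Mat n m → ℂ} (hu : u =ᵐ[volume] u') (hv : v =ᵐ[volume] v') (hf : f =ᵐ[volume] f')
    {c : ℂ} (h : HasReproducingFormula u' v' f' c) : HasReproducingFormula u v f c := by
  refine ⟨fun ε ρ hε hρ => ⟨?_, ?_⟩, h.2.congr fun p => eLpNorm_congr_ae ?_⟩
  · filter_upwards [(h.1 ε ρ hε hρ).1] with x hx
    refine hx.congr ?_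
    filter_upwards [ae_truncMeasure_posDef] with a ha
    exact (reproIntegrand_congr hkn hu hv hf x ha).symm
  · rw [reproTrunc_congr hkn hu hv hf]
    exact (h.1 ε ρ hε hρ).2
  · filter_upwards [hf] with x hx
    rw [reproTrunc_congr hkn hu hv hf, hx]

theorem hasReproducingFormula_of_measurable (hm : m ≤ n - k) (hkn : k ≤ n) (hu : Measurable u)
    (hv : Measurable v) (hf : Measurable f) (hui : Integrable u) (hvi : Integrable v)
    (hfi : Integrable f) (hf2 : MemLp f 2)
    (hsym : ∃ u₀ : Mat m m → ℂ, IsSymmetricOnCone u₀ ∧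
      ∀ y, matFourier u y * matFourier v y = u₀ (y.transpose * y)) {C : ℝ}
    (hC : ∀ r : Mat m m, r.PosDef → ∀ ε ρ : ℝ, 0 < ε → ε < ρ →
      ‖truncConst n k m (fun ζ => matFourier u ζ * matFourier v ζ) (ε • r) (ρ • r)‖ ≤ C)
    {c : ℂ} (hc : HasConeIntegral n k m (fun ζ => matFourier u ζ * matFourier v ζ) c) :
    HasReproducingFormula u v f c := by
  obtain ⟨w, hw, hwsym, hG, hB⟩ := exists_measurable_profile hm
    ((continuous_matFourier hui).mul (continuous_matFourier hvi)).measurable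
    (fun y => norm_mul_le_of_le (norm_matFourier_le u y) (norm_matFourier_le v y)) hsym
  have hmult {ε ρ : ℝ} (hε : 0 < ε) (hρ : ε < ρ) := memLp_reproTrunc_and_eLpNorm_sub_eq hm hkn
    hu hv hf hui hvi hfi hf2 hw hG hwsym hB hC hε hρ c
  refine ⟨fun ε ρ hε hρ => ⟨?_, (hmult hε hρ).1⟩, ?_⟩
  · exact ae_integrableOn_reproIntegrand hkn hu hv hf hui hvi hfi hε ρ
  · refine (tendsto_eLpNorm_reproMultiplier_sub_mul hm
      (measurable_reproMultiplier hm hkn hw hG hwsym) hC hc (memLp_matFourier hfi hf2)).congr' ?_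
    filter_upwards [eventually_pos_lt] with p hp
    exact (hmult hp.1 hp.2).2.symm

theorem hasReproducingFormula (hm : m ≤ n - k) (hkn : k ≤ n) (hu : Integrable u)
    (hv : Integrable v)
    (hsym : ∃ u₀ : Mat m m → ℂ, IsSymmetricOnCone u₀ ∧
      ∀ y, matFourier u y * matFourier v y = u₀ (y.transpose * y)) {C : ℝ}
    (hC : ∀ r : Mat m m, r.PosDef → ∀ ε ρ : ℝ, 0 < ε → ε < ρ →
      ‖truncConst n k m (fun ζ => matFourier u ζ * matFourier v ζ) (ε • r) (ρ • r)‖ ≤ C)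
    {c : ℂ} (hc : HasConeIntegral n k m (fun ζ => matFourier u ζ * matFourier v ζ) c)
    (hf : Integrable f) (hf2 : MemLp f 2) : HasReproducingFormula u v f c := by
  have hu_mk := hu.aestronglyMeasurable.ae_eq_mk
  have hv_mk := hv.aestronglyMeasurable.ae_eq_mk
  have hf_mk := hf.aestronglyMeasurable.ae_eq_mk
  rw [matFourier_congr hu_mk, matFourier_congr hv_mk] at hsym hC hc
  exact .congr hkn hu_mk hv_mk hf_mk <| hasReproducingFormula_of_measurable hm hkn
    hu.aestronglyMeasurable.stronglyMeasurable_mk.measurable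
    hv.aestronglyMeasurable.stronglyMeasurable_mk.measurable
    hf.aestronglyMeasurable.stronglyMeasurable_mk.measurable
    (hu.congr hu_mk) (hv.congr hv_mk) (hf.congr hf_mk) ((memLp_congr_ae hf_mk).1 hf2) hsym hC hc

theorem mainTheorem5_general (hm : m ≤ n - k) (hkn : k ≤ n) (hu : Integrable u)
    (hv : Integrable v)
    (hsym : ∃ u₀ : Mat m m → ℂ, IsSymmetricOnCone u₀ ∧
      ∀ y, matFourier (conv u v) y = u₀ (y.transpose * y))
    (hconv : ∃ c : ℂ, HasConeIntegral n k m (matFourier (conv u v)) c)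
    (hbdd : ∃ C : ℝ, ∀ r : Mat m m, r.PosDef → ∀ ε ρ : ℝ, 0 < ε → ε < ρ →
      ‖truncConst n k m (matFourier (conv u v)) (ε • r) (ρ • r)‖ ≤ C) :
    ∃ c : ℂ, HasConeIntegral n k m (fun ζ => matFourier u ζ * matFourier v ζ) c ∧
      ∀ f : Mat n m → ℂ, Integrable f → MemLp f 2 → HasReproducingFormula u v f c := by
  have hprod : matFourier (conv u v) = fun ζ => matFourier u ζ * matFourier v ζ :=
    funext (matFourier_conv hu hv)
  rw [hprod] at hsym hconv hbdd
  obtain ⟨c, hc⟩ := hconv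
  obtain ⟨C, hC⟩ := hbdd
  exact ⟨c, hc, fun f hf hf2 => hasReproducingFormula hm hkn hu hv hsym hC hc hf hf2⟩

end Main

end MatrixRidgelet

theorem mainTheorem5 {n k m : ℕ} (hm : 1 ≤ m) (hk : 1 ≤ k) (hkn : k ≤ n - m)
    (u v : MatrixRidgelet.Mat (n - k) m → ℂ)
    (hu : Integrable u) (hv : Integrable v)
    (hur : MatrixRidgelet.IsRadial u) (hvr : MatrixRidgelet.IsRadial v)
    (hw : MatrixRidgelet.IsAdmissible n k m (MatrixRidgelet.conv u v)) :
    ∃ c : ℂ,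
      MatrixRidgelet.HasConeIntegral n k m
        (fun ζ => MatrixRidgelet.matFourier u ζ * MatrixRidgelet.matFourier v ζ) c ∧
      ∀ f : MatrixRidgelet.Mat n m → ℂ, Integrable f → MemLp f 2 →
        (∀ ε ρ : ℝ, 0 < ε → ε < ρ →
          (∀ᵐ x : MatrixRidgelet.Mat n m,
            IntegrableOn (MatrixRidgelet.reproIntegrand u v f x)
              (MatrixRidgelet.coneInterval (ε • (1 : MatrixRidgelet.Mat m m))
                (ρ • (1 : MatrixRidgelet.Mat m m)))
              (MatrixRidgelet.coneInvMeasure m)) ∧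
          MemLp (MatrixRidgelet.reproTrunc u v f ε ρ) 2) ∧
        Tendsto (fun p : ℝ × ℝ =>
            eLpNorm (fun x => MatrixRidgelet.reproTrunc u v f p.1 p.2 x - c * f x) 2 volume)
          (𝓝[>] (0 : ℝ) ×ˢ atTop) (𝓝 0) :=
  MatrixRidgelet.mainTheorem5_general (by omega) (by omega) hu hv hw.symmetric hw.converges
    hw.bounded
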